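/- **Setting.** Let $\mathcal S$, $\mathcal U$ be finite nonempty sets, let $p(j\mid i,u)\ge 0$ with $\sum_j p(j\mid i,u)=1$ be controlled transition probabilities on $\mathcal S$, let $k:\mathcal S\times\mathcal U\to\mathbb R$ be a running cost, and let $i_0\in\mathcal S$. Assume that for every map $\mu:\mathcal S\to\mathcal U$ the Markov chain with transition probabilities $p(j\mid i,\mu(i))$ is irreducible. Let $\Phi(u\mid i)>0$ with $\sum_u\Phi(u\mid i)=1$ be a randomized sampling policy. Let $(\Omega,\mathcal F,\mathbb P)$ carry square-integrable initial values $Q_0\ge 0$ (in $\mathbb R^{\mathcal S\times\mathcal U}$) and $\rho_0\in\mathbb R$, and processes $X_n\in\mathcal S$, $U_n\in\mathcal U$ with, for all $n\ge 0$, $$\mathbb P(U_n=u\mid Q_0,\rho_0,X_m,U_l,\ m\le n,\ l<n)=\Phi(u\mid X_n),$$ $$\mathbb P(X_{n+1}=j\mid Q_0,\rho_0,X_m,U_m,\ m\le n)=p(j\mid X_n,U_n)\quad\text{a.s.}$$ Asynchronous SSP Q-learning without projection is the iteration $$Q_{n+1}(i,u)=Q_n(i,u)+\alpha_n I\{X_n=i,U_n=u\}\Big(k(i,u)+I\{X_{n+1}\ne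 i_0\}\min_v Q_n(X_{n+1},v)-Q_n(i,u)-\rho_n\Big),$$ $$\rho_{n+1}=\rho_n+\beta'\beta_n\min_v Q_n(i_0,v),\qquad \alpha_n=\frac{\alpha_0}{n+1},\quad \beta_n=\frac{\beta_0}{n+1},$$ where $\beta'>0$ is a fixed scaling constant. For positive weights $w$ write $\|Q\|_w=\max_{i,u}|w(i,u)Q(i,u)|$. **Statement.** There is a unique pair $(Q^*,\rho^*)$ with $$Q^*(i,u)=k(i,u)-\rho^*+\sum_{j\ne i_0}p(j\mid i,u)\min_vQ^*(j,v)\ \ \text{for all } i,u,\qquad \min_v Q^*(i_0,v)=0,$$ and for every initial state $\rho^*$ is the minimum of the average costs $\lim_{n\to\infty}\frac1n\sum_{m=0}^{n-1}\mathbb E[k(X_m,U_m)]$ over all controlled Markov chains $(X_m,U_m)$ with transition probabilities $p$ started at that state, with arbitrary history-dependent randomized controls $U_m$, for which the limit exists. Moreover there is a positive weight $w$, depending only on $p,k,i_0,\Phi$, such that for every $\beta'>0$ there are constants $C_4',C_5'>0$, depending only on $p,k,i_0,\Phi,\beta'$, with the following property. If $\alpha_0>0$, $\beta_0/\alpha_0\le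 C_4'$ and $\beta_0\ge C_5'$, then for every $R$ there is a constant $C$ such that, for all processes as above with $\mathbb E\|Q_0\|_w^2+\mathbb E|\rho_0|^2\le R$ and all $n\ge 0$, $$\mathbb E\big[\|Q_n-Q^*\|_w^2\big]\le\frac{C}{n+1}\qquad\text{and}\qquad \mathbb E\big[|\rho_n-\rho^*|^2\big]\le\frac{C}{n+1},$$ both expectations being of integrable variables. -/

import Mathlib

open MeasureTheory ProbabilityTheory Filter Topology

noncomputable section

namespace SSPQ

/-- A finite Markov decision process with states `S`, actions `A`, controlled transition
probabilities `p i u j = p(j | i, u)` and running cost `k`. -/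
structure MDP (S A : Type*) [Fintype S] where
  p : S → A → S → ℝ
  p_nonneg : ∀ i u j, 0 ≤ p i u j
  p_sum : ∀ i u, ∑ j, p i u j = 1
  k : S → A → ℝ

/-- The chain is irreducible under every control choice, that is, under every assignment
`μ : S → A` of an action to each state. -/
def MDP.IrreducibleUnderAllControls {S A : Type*} [Fintype S] (M : MDP S A) : Prop :=
  ∀ μ : S → A, Matrix.IsIrreducible (Matrix.of fun i j => M.p i (μ i) j)

/-- `min_v Q(i, v)`. -/
def minAct {S A : Type*} [Fintype A] [Nonempty A] (Q : S → A → ℝ) (i : S) : ℝ :=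
  Finset.univ.inf' Finset.univ_nonempty (fun v => Q i v)

/-- The weighted max-norm `‖Q‖_w = max_{i,u} |w(i,u) Q(i,u)|`. -/
def wNorm {S A : Type*} [Fintype S] [Fintype A] [Nonempty S] [Nonempty A]
    (w Q : S → A → ℝ) : ℝ :=
  Finset.univ.sup' Finset.univ_nonempty (fun z : S × A => |w z.1 z.2 * Q z.1 z.2|)

section Processes

variable {S A Ω : Type*} [MeasurableSpace S] [MeasurableSpace A]

/-- The information available just before the action at time `n` is chosen: the initial
information `m0`, the states `X 0, …, X n` and the actions `U 0, …, U (n-1)`. -/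
abbrev preHistory (m0 : MeasurableSpace Ω) (X : ℕ → Ω → S) (U : ℕ → Ω → A) (n : ℕ) :
    MeasurableSpace Ω :=
  m0 ⊔ (⨆ (m : ℕ) (_ : m ≤ n), MeasurableSpace.comap (X m) inferInstance) ⊔
    (⨆ (m : ℕ) (_ : m < n), MeasurableSpace.comap (U m) inferInstance)

/-- The information available just after the action at time `n` is chosen: the initial
information `m0`, the states `X 0, …, X n` and the actions `U 0, …, U n`. -/
abbrev postHistory (m0 : MeasurableSpace Ω) (X : ℕ → Ω → S) (U : ℕ → Ω → A) (n : ℕ) :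
    MeasurableSpace Ω :=
  m0 ⊔ (⨆ (m : ℕ) (_ : m ≤ n), MeasurableSpace.comap (X m) inferInstance) ⊔
    (⨆ (m : ℕ) (_ : m ≤ n), MeasurableSpace.comap (U m) inferInstance)

/-- `X` is a controlled Markov chain with transition probabilities `M.p`, controlled by `U`,
with initial information `m0`:
`P(X (n+1) = j | m0, X m, U m, m ≤ n) = p(j | X n, U n)` almost surely. -/
structure IsControlledChain [Fintype S] [mΩ : MeasurableSpace Ω] (M : MDP S A) (P : Measure Ω)
    (m0 : MeasurableSpace Ω) (X : ℕ → Ω → S) (U : ℕ → Ω → A) : Prop where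
  measurable_state : ∀ n, Measurable[mΩ] (X n)
  measurable_action : ∀ n, Measurable[mΩ] (U n)
  transition : ∀ n j,
    P⟦X (n + 1) ⁻¹' {j} | postHistory m0 X U n⟧ =ᵐ[P] fun ω => M.p (X n ω) (U n ω) j

/-- The actions are drawn from the randomized sampling policy `Φ i u = Φ(u | i)`:
`P(U n = u | m0, X m, U l, m ≤ n, l < n) = Φ(u | X n)` almost surely. -/
def IsSampledBy [mΩ : MeasurableSpace Ω] (Φ : S → A → ℝ) (P : Measure Ω)
    (m0 : MeasurableSpace Ω) (X : ℕ → Ω → S) (U : ℕ → Ω → A) : Prop :=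
  ∀ n u, P⟦U n ⁻¹' {u} | preHistory m0 X U n⟧ =ᵐ[P] fun ω => Φ (X n ω) u

end Processes

/-- The set of average costs `lim (1/n) ∑_{m<n} E[k(X m, U m)]` attained by the control processes
for which this limit exists, for the chain started at the state `x`. The actions may depend on
the past and on additional randomization in an arbitrary way. -/
def averageCosts {S : Type*} {A : Type*} [Fintype S] [MeasurableSpace S] [MeasurableSpace A]
    (M : MDP S A) (x : S) : Set ℝ :=
  {c | ∃ (Ω : Type) (_ : MeasurableSpace Ω) (P : Measure Ω) (_ : IsProbabilityMeasure P)
      (X : ℕ → Ω → S) (U : ℕ → Ω → A),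
      IsControlledChain M P ⊥ X U ∧ (∀ᵐ ω ∂P, X 0 ω = x) ∧
      Tendsto (fun n : ℕ => (1 / (n : ℝ)) * ∑ m ∈ Finset.range n, ∫ ω, M.k (X m ω) (U m ω) ∂P)
        atTop (𝓝 c)}

section Algorithm

variable {S A : Type*} [Fintype S] [Fintype A] [Nonempty A] [DecidableEq S] [DecidableEq A]

/-- The dynamic programming equations with reference state `i₀`. The first one says that `Q` is
the fixed point `Q*(ρ)` of the averaged map of the `Q`-iteration at level `ρ`; the second one says
that `ρ` is the fixed point of `ρ ↦ β' min_v Q*(ρ)(i₀, v) + ρ`. -/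
def IsSSPFixedPoint (M : MDP S A) (i₀ : S) (Q : S → A → ℝ) (ρ : ℝ) : Prop :=
  (∀ i u, Q i u = M.k i u - ρ + ∑ j ∈ Finset.univ.filter (fun j => j ≠ i₀),
    M.p i u j * minAct Q j) ∧
  minAct Q i₀ = 0

/-- The iterates `(Q n, ρ n)` of asynchronous SSP Q-learning (without projection) along the
trajectory `x 0, u 0, x 1, u 1, …`, with step sizes `a n` for `Q` and `b n` for `ρ`. -/
def iterates (M : MDP S A) (i₀ : S) (a b : ℕ → ℝ) (x : ℕ → S) (u : ℕ → A)
    (Q₀ : S → A → ℝ) (ρ₀ : ℝ) : ℕ → (S → A → ℝ) × ℝ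
  | 0 => (Q₀, ρ₀)
  | n + 1 =>
    let Q := (iterates M i₀ a b x u Q₀ ρ₀ n).1
    let ρ := (iterates M i₀ a b x u Q₀ ρ₀ n).2
    (fun i v => Q i v + a n * (if x n = i ∧ u n = v then 1 else 0) *
        (M.k i v + (if x (n + 1) ≠ i₀ then 1 else 0) * minAct Q (x (n + 1)) - Q i v - ρ),
      ρ + b n * minAct Q i₀)

end Algorithm

end SSPQ

end

set_option linter.unusedSectionVars false

namespace SSPQ

/-! Fix a level `ρ` and kill the chain at `i₀`. Since every stationary policy gives an irreducible
chain, the killed process dies out uniformly over all controls. So there is a weight `τ` on states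
for which the killed transitions contract by a factor `lam < 1` whatever the action
(`exists_isContractingWeight`). Then `bellman M i₀ · ρ` is a contraction in the max-norm weighted by
`1/τ`, with fixed point `qs ρ`. The value of `i₀` under `qs ρ` is Lipschitz in `ρ` and decreases
with slope at least one (`minAct_fixed_le`), so it has exactly one zero `ρ*`. At that level killing
at `i₀` changes nothing, the equation is the average-cost optimality equation, and a telescoping
argument identifies `ρ*` as the least average cost (`isLeast_averageCosts`).

For the rate, the component `(i, v)` is updated with long-run frequency `D = Φ i v * d i`, where `d`
is the stationary law of the sampled chain. The iterate `Q` is compared with a sequence `Y` in which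
each update is replaced by its mean with frequency `D`. The gap `Q - Y` is driven by Markovian
noise. The Poisson equation for the indicator of `X n = i` splits this noise into a martingale
difference, a telescoping term and a remainder of order `n⁻²`. With the telescoping term moved into
`correctedError`, its mean square contracts at rate `a₀ δ / n` (`exists_correctedError_sq_le`,
`IsProcess.integral_sumSq_succ_le`). The pair `(Y, ρ)` has the Lyapunov function `K ‖Y - qs ρ‖ + |ρ
- ρ*|`, which contracts at rate `b₀ / (2n)` up to an error proportional to `‖Q - Y‖`
(`lyapunov_succ_le`). A small ratio of step sizes is needed here, so that `Y` follows the moving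
target `qs ρ` faster than `ρ` moves.

Without projection there is no a priori bound on the iterates, so the noise is bounded by their
size. The squared size is in turn controlled by the two error quantities, which closes the
recursion. `exists_rate` then yields `1/n`, provided that the slower contraction coefficient is at
least `2`; this is the lower bound on `β₀`. All constants are fixed before the process is, hence the
uniformity. -/

/-- A set that is closed under the positive transitions of an irreducible matrix contains every
index as soon as it contains one. -/
lemma mem_of_closed {S : Type*} {B : Matrix S S ℝ} (hB : B.IsIrreducible) (C : Set S)
    (hC : ∀ a ∈ C, ∀ b, 0 < B a b → b ∈ C) {i : S} (hi : i ∈ C) (j : S) : j ∈ C := by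
  let := B.toQuiver
  obtain ⟨p, -⟩ := hB.connected i j
  induction p with
  | nil => exact hi
  | cons q e ih => exact hC _ ih _ e.down

/-! ### Uniform contraction of the transitions killed at `i₀`. -/

section Deterministic

variable {S A : Type*} [Fintype S] [Fintype A] [Nonempty A] [DecidableEq S]

lemma minAct_le (Q : S → A → ℝ) (i : S) (v : A) : minAct Q i ≤ Q i v :=
  Finset.inf'_le _ (Finset.mem_univ v)

lemma exists_minAct (Q : S → A → ℝ) (i : S) : ∃ v, minAct Q i = Q i v := by
  obtain ⟨v, -, hv⟩ := Finset.exists_mem_eq_inf' (Finset.univ_nonempty (α := A)) (fun v => Q i v)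
  exact ⟨v, hv⟩

lemma minAct_le_add (Q Q' : S → A → ℝ) (i : S) (c : ℝ) (h : ∀ v, Q i v ≤ Q' i v + c) :
    minAct Q i ≤ minAct Q' i + c := by
  obtain ⟨v, hv⟩ := exists_minAct Q' i
  rw [hv]
  exact (minAct_le Q i v).trans (h v)

lemma abs_minAct_sub_le (Q Q' : S → A → ℝ) (i : S) (c : ℝ) (h : ∀ v, |Q i v - Q' i v| ≤ c) :
    |minAct Q i - minAct Q' i| ≤ c := by
  rw [abs_le]
  constructor
  · have := minAct_le_add Q' Q i c fun v => by have := abs_le.1 (h v); linarith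
    linarith
  · have := minAct_le_add Q Q' i c fun v => by have := abs_le.1 (h v); linarith
    linarith

/-- The largest expected value of `r` at the next state, killed at `i₀`. -/
noncomputable def tabooMax (M : MDP S A) (i₀ : S) (r : S → ℝ) (i : S) : ℝ :=
  Finset.univ.sup' Finset.univ_nonempty
    (fun u => ∑ j ∈ Finset.univ.filter (fun j => j ≠ i₀), M.p i u j * r j)

lemma le_tabooMax (M : MDP S A) (i₀ : S) (r : S → ℝ) (i : S) (u : A) :
    ∑ j ∈ Finset.univ.filter (fun j => j ≠ i₀), M.p i u j * r j ≤ tabooMax M i₀ r i :=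
  Finset.le_sup' (fun u => ∑ j ∈ Finset.univ.filter (fun j => j ≠ i₀), M.p i u j * r j)
    (Finset.mem_univ u)

lemma tabooMax_mono (M : MDP S A) (i₀ : S) : Monotone (tabooMax M i₀) := by
  intro r r' h i
  refine Finset.sup'_le _ _ fun u _ => le_trans ?_ (le_tabooMax M i₀ r' i u)
  exact Finset.sum_le_sum fun j _ => mul_le_mul_of_nonneg_left (h j) (M.p_nonneg i u j)

lemma sum_taboo_le_one (M : MDP S A) (i₀ : S) (i : S) (u : A) :
    ∑ j ∈ Finset.univ.filter (fun j => j ≠ i₀), M.p i u j ≤ 1 := by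
  rw [← M.p_sum i u]
  exact Finset.sum_le_sum_of_subset_of_nonneg (Finset.filter_subset _ _)
    fun j _ _ => M.p_nonneg i u j

lemma tabooMax_one_le (M : MDP S A) (i₀ : S) : tabooMax M i₀ 1 ≤ 1 := by
  intro i
  refine Finset.sup'_le _ _ fun u _ => ?_
  simpa using sum_taboo_le_one M i₀ i u

lemma tabooMax_zero (M : MDP S A) (i₀ : S) : tabooMax M i₀ 0 = 0 := by
  ext i; simp [tabooMax]

lemma continuous_tabooMax (M : MDP S A) (i₀ : S) : Continuous (tabooMax M i₀) := by
  refine continuous_pi fun i => ?_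
  unfold tabooMax
  refine Continuous.finset_sup'_apply _ fun u _ => ?_
  fun_prop

/-- Let `μ` pick maximising actions. If `r` had a positive maximum, a state attaining it could move
under `μ` only to other such states, and never to `i₀`. This contradicts the irreducibility of `μ`.
-/
lemma tabooMax_fixed_eq_zero (M : MDP S A) (hirr : M.IrreducibleUnderAllControls) (i₀ : S)
    (r : S → ℝ) (h0 : 0 ≤ r) (hr : tabooMax M i₀ r = r) : r = 0 := by
  have hex : ∀ i, ∃ u, r i = ∑ j ∈ Finset.univ.filter (fun j => j ≠ i₀), M.p i u j * r j := by
    intro i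
    obtain ⟨u, -, hu⟩ := Finset.exists_mem_eq_sup' (Finset.univ_nonempty (α := A))
      (fun u => ∑ j ∈ Finset.univ.filter (fun j => j ≠ i₀), M.p i u j * r j)
    refine ⟨u, ?_⟩
    rw [← hu]
    exact (congrFun hr i).symm
  choose μ hμ using hex
  have : Nonempty S := ⟨i₀⟩
  obtain ⟨a, ha⟩ := Finite.exists_max r
  by_contra hne
  have hpos : 0 < r a := by
    obtain ⟨b, hb⟩ := Function.ne_iff.1 hne
    exact lt_of_lt_of_le (lt_of_le_of_ne (h0 b) (Ne.symm hb)) (ha b)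
  have key : ∀ i, r i = r a → ∀ j, 0 < M.p i (μ i) j → r j = r a ∧ j ≠ i₀ := by
    intro i hi
    have e1 : ∑ j, M.p i (μ i) j * (r a - if j ≠ i₀ then r j else 0) = 0 := by
      have := hμ i
      rw [Finset.sum_filter] at this
      simp only [mul_sub, Finset.sum_sub_distrib, ← Finset.sum_mul, M.p_sum, one_mul]
      rw [← hi, this, sub_eq_zero]
      exact Finset.sum_congr rfl fun j _ => by split_ifs <;> simp
    have hn : ∀ j ∈ Finset.univ, 0 ≤ M.p i (μ i) j * (r a - if j ≠ i₀ then r j else 0) := by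
      intro j _
      refine mul_nonneg (M.p_nonneg _ _ _) ?_
      split_ifs
      · linarith [ha j]
      · linarith
    intro j hj
    have := (Finset.sum_eq_zero_iff_of_nonneg hn).1 e1 j (Finset.mem_univ j)
    rcases mul_eq_zero.1 this with h | h
    · linarith
    · split_ifs at h with hji
      · exact ⟨by linarith, hji⟩
      · linarith
  have h1 : ∀ j, r j = r a := fun j => mem_of_closed (hirr μ) {i | r i = r a}
    (fun i hi b hb => (key i hi b hb).1) (i := a) rfl j
  have h2 : i₀ ∈ {i | i ≠ i₀} := by
    -- The closure argument starts from a successor of `a`, because `a` itself may be `i₀`.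
    obtain ⟨j, hj⟩ : ∃ j, 0 < M.p a (μ a) j := by
      by_contra! hcon
      have := M.p_sum a (μ a)
      have h3 : ∑ j, M.p a (μ a) j ≤ 0 := Finset.sum_nonpos fun j _ => hcon j
      linarith
    exact mem_of_closed (hirr μ) {i | i ≠ i₀} (fun i _ b hb => (key i (h1 i) b hb).2)
      (i := j) (key a rfl j hj).2 i₀
  exact h2 rfl

/-- A weight for which the transitions killed at `i₀` are uniformly contracting. -/
structure IsContractingWeight (M : MDP S A) (i₀ : S) (τ : S → ℝ) (lam : ℝ) : Prop where
  one_le : ∀ i, 1 ≤ τ i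
  nonneg : 0 ≤ lam
  lt_one : lam < 1
  sum_le : ∀ i u, ∑ j ∈ Finset.univ.filter (fun j => j ≠ i₀), M.p i u j * τ j ≤ lam * τ i

/-- The largest survival probabilities `r m` after `m` steps decrease to a fixed point of
`tabooMax`, which is zero. The weight is the truncated sum of the `r m`, a bound for the expected
survival time. -/
theorem exists_isContractingWeight (M : MDP S A) (hirr : M.IrreducibleUnderAllControls) (i₀ : S) :
    ∃ τ lam, IsContractingWeight M i₀ τ lam := by
  set r : ℕ → S → ℝ := fun m => (tabooMax M i₀)^[m] 1 with hr
  have hs : ∀ m, r (m + 1) = tabooMax M i₀ (r m) := fun m => Function.iterate_succ_apply' _ _ _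
  have hanti : ∀ m, r (m + 1) ≤ r m := by
    intro m
    induction m with
    | zero => exact tabooMax_one_le M i₀
    | succ m ih => rw [hs (m + 1), hs m]; exact tabooMax_mono M i₀ (hs m ▸ ih)
  have hA : Antitone r := antitone_nat_of_succ_le hanti
  have hnn : ∀ m, 0 ≤ r m := by
    intro m
    induction m with
    | zero => exact fun i => zero_le_one
    | succ m ih => rw [hs, ← tabooMax_zero M i₀]; exact tabooMax_mono M i₀ ih
  have hlim : ∃ l, Tendsto r atTop (𝓝 l) := by
    refine ⟨fun i => ⨅ m, r m i, tendsto_pi_nhds.2 fun i => tendsto_atTop_ciInf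
      (fun a b hab => hA hab i) ⟨0, ?_⟩⟩
    rintro _ ⟨m, rfl⟩
    exact hnn m i
  obtain ⟨l, hl⟩ := hlim
  have hl0 : l = 0 := by
    refine tabooMax_fixed_eq_zero M hirr i₀ l ?_ ?_
    · exact ge_of_tendsto' hl hnn
    · have h1 : Tendsto (fun m => r (m + 1)) atTop (𝓝 (tabooMax M i₀ l)) := by
        simp_rw [hs]
        exact ((continuous_tabooMax M i₀).tendsto l).comp hl
      exact tendsto_nhds_unique h1 (hl.comp (tendsto_add_atTop_nat 1))
  subst hl0
  have hev : ∀ᶠ m in atTop, ∀ i, r m i < 1 / 2 := by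
    refine eventually_all.2 fun i => ?_
    exact (tendsto_pi_nhds.1 hl i).eventually (gt_mem_nhds (by norm_num))
  obtain ⟨N, hN, hN1⟩ := (hev.and (eventually_ge_atTop 1)).exists
  have hNpos : (1 : ℝ) ≤ N := by exact_mod_cast hN1
  -- One killed step shifts the sum by one index and so replaces `r 0 = 1` by `r N < 1/2`. The loss
  -- of at least `1/2` is at least the fraction `1/(2N)` of the weight, which is at most `N`.
  refine ⟨fun i => ∑ m ∈ Finset.range N, r m i, 1 - 1 / (2 * N), ?_, ?_, ?_, ?_⟩
  · intro i
    calc (1 : ℝ) = r 0 i := rfl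
      _ ≤ _ := Finset.single_le_sum (f := fun m => r m i) (fun m _ => hnn m i)
        (Finset.mem_range.2 hN1)
  · rw [sub_nonneg, div_le_one (by positivity)]; linarith
  · have : 0 < 1 / (2 * (N : ℝ)) := by positivity
    linarith
  · intro i u
    have h1 : ∑ j ∈ Finset.univ.filter (fun j => j ≠ i₀),
        M.p i u j * ∑ m ∈ Finset.range N, r m j ≤ ∑ m ∈ Finset.range N, r (m + 1) i := by
      simp_rw [Finset.mul_sum]
      rw [Finset.sum_comm]
      exact Finset.sum_le_sum fun m _ => by rw [hs]; exact le_tabooMax M i₀ (r m) i u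
    have h2 := Finset.sum_range_succ' (fun m => r m i) N
    rw [Finset.sum_range_succ] at h2
    have h3 : ∑ m ∈ Finset.range N, r m i ≤ N := by
      calc _ ≤ ∑ m ∈ Finset.range N, (1 : ℝ) :=
            Finset.sum_le_sum fun m _ => hA (Nat.zero_le m) i
        _ = N := by simp
    have h4 := hN i
    have h5 : r 0 i = 1 := rfl
    have h6 : 1 / (2 * (N : ℝ)) * ∑ m ∈ Finset.range N, r m i ≤ 1 / 2 := by
      calc _ ≤ 1 / (2 * (N : ℝ)) * N := mul_le_mul_of_nonneg_left h3 (by positivity)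
        _ = 1 / 2 := by field_simp
    show _ ≤ (1 - 1 / (2 * (N : ℝ))) * ∑ m ∈ Finset.range N, r m i
    rw [sub_mul, one_mul]
    linarith

end Deterministic

/-! ### The fixed points `qs ρ` and the level `ρ*`. -/

section FixedPoint

variable {S A : Type*} [Fintype S] [Fintype A] [Nonempty S] [Nonempty A] [DecidableEq S]

/-- The max-norm of `Q` relative to the weight `τ` on states. -/
noncomputable abbrev tNorm (τ : S → ℝ) (Q : S → A → ℝ) : ℝ :=
  wNorm (fun i _ => (τ i)⁻¹) Q

lemma tNorm_le_iff {τ : S → ℝ} (hτ : ∀ i, 1 ≤ τ i) {Q : S → A → ℝ} {B : ℝ} :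
    tNorm τ Q ≤ B ↔ ∀ i u, |Q i u| ≤ τ i * B := by
  have h (i : S) (u : A) : |(τ i)⁻¹ * Q i u| ≤ B ↔ |Q i u| ≤ τ i * B := by
    have : 0 < τ i := by linarith [hτ i]
    rw [abs_mul, abs_inv, abs_of_pos this, inv_mul_le_iff₀ this]
  simp only [wNorm, Finset.sup'_le_iff, Finset.mem_univ, true_implies, Prod.forall, h]

lemma abs_le_tNorm {τ : S → ℝ} (hτ : ∀ i, 1 ≤ τ i) (Q : S → A → ℝ) (i : S) (u : A) :
    |Q i u| ≤ τ i * tNorm τ Q :=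
  (tNorm_le_iff hτ).1 le_rfl i u

lemma tNorm_nonneg (τ : S → ℝ) (Q : S → A → ℝ) : 0 ≤ tNorm τ Q := by
  obtain ⟨i⟩ := ‹Nonempty S›
  obtain ⟨u⟩ := ‹Nonempty A›
  exact (abs_nonneg _).trans
    (Finset.le_sup' (fun z : S × A => |(τ z.1)⁻¹ * Q z.1 z.2|) (Finset.mem_univ (i, u)))

lemma tNorm_le_of_abs_le_add {τ : S → ℝ} (hτ : ∀ i, 1 ≤ τ i) {Q Q₁ Q₂ : S → A → ℝ} {c : ℝ}
    (hc : 0 ≤ c) (h : ∀ i u, |Q i u| ≤ |Q₁ i u| + |Q₂ i u| + c) :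
    tNorm τ Q ≤ tNorm τ Q₁ + tNorm τ Q₂ + c := by
  rw [tNorm_le_iff hτ]
  intro i u
  have h1 := abs_le_tNorm hτ Q₁ i u
  have h2 := abs_le_tNorm hτ Q₂ i u
  have h3 : c ≤ τ i * c := le_mul_of_one_le_left hc (hτ i)
  have := h i u
  linarith

lemma tNorm_sub_le {τ : S → ℝ} (hτ : ∀ i, 1 ≤ τ i) (Q₁ Q₂ Q₃ : S → A → ℝ) :
    tNorm τ (fun i u => Q₁ i u - Q₃ i u) ≤
      tNorm τ (fun i u => Q₁ i u - Q₂ i u) + tNorm τ (fun i u => Q₂ i u - Q₃ i u) := by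
  have := tNorm_le_of_abs_le_add hτ le_rfl (Q := fun i u => Q₁ i u - Q₃ i u)
    (Q₁ := fun i u => Q₁ i u - Q₂ i u) (Q₂ := fun i u => Q₂ i u - Q₃ i u)
    fun i u => by simpa using abs_sub_le (Q₁ i u) (Q₂ i u) (Q₃ i u)
  simpa using this

/-- The dynamic programming operator of the stochastic shortest path problem at level `ρ`. -/
def bellman (M : MDP S A) (i₀ : S) (Q : S → A → ℝ) (ρ : ℝ) (i : S) (u : A) : ℝ :=
  M.k i u - ρ + ∑ j ∈ Finset.univ.filter (fun j => j ≠ i₀), M.p i u j * minAct Q j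

variable {M : MDP S A} {i₀ : S} {τ : S → ℝ} {lam : ℝ}

lemma abs_bellman_sub_le (hw : IsContractingWeight M i₀ τ lam) {Q Q' : S → A → ℝ} {B : ℝ}
    (hB : 0 ≤ B) (h : ∀ i u, |Q i u - Q' i u| ≤ τ i * B) (ρ : ℝ) (i : S) (u : A) :
    |bellman M i₀ Q ρ i u - bellman M i₀ Q' ρ i u| ≤ τ i * (lam * B) := by
  have h1 : bellman M i₀ Q ρ i u - bellman M i₀ Q' ρ i u =
      ∑ j ∈ Finset.univ.filter (fun j => j ≠ i₀), M.p i u j * (minAct Q j - minAct Q' j) := by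
    simp only [bellman, mul_sub, Finset.sum_sub_distrib]; ring
  rw [h1]
  calc _ ≤ ∑ j ∈ Finset.univ.filter (fun j => j ≠ i₀), |M.p i u j * (minAct Q j - minAct Q' j)| :=
        Finset.abs_sum_le_sum_abs _ _
    _ ≤ ∑ j ∈ Finset.univ.filter (fun j => j ≠ i₀), (M.p i u j * τ j) * B := by
        refine Finset.sum_le_sum fun j _ => ?_
        rw [abs_mul, abs_of_nonneg (M.p_nonneg i u j), mul_assoc]
        exact mul_le_mul_of_nonneg_left (abs_minAct_sub_le _ _ _ _ (h j)) (M.p_nonneg i u j)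
    _ ≤ (lam * τ i) * B := by
        rw [← Finset.sum_mul]
        exact mul_le_mul_of_nonneg_right (hw.sum_le i u) hB
    _ = _ := by ring

lemma exists_bellman_fixed (hw : IsContractingWeight M i₀ τ lam) (ρ : ℝ) :
    ∃ Q, bellman M i₀ Q ρ = Q := by
  have hpos : ∀ i, 0 < τ i := fun i => by linarith [hw.one_le i]
  -- Dividing by `τ` turns the weighted norm into the sup-metric of the product, where Banach's
  -- theorem applies.
  let f : (S → A → ℝ) → (S → A → ℝ) := fun q i u =>
    bellman M i₀ (fun j v => τ j * q j v) ρ i u / τ i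
  have hf : ContractingWith ⟨lam, hw.nonneg⟩ f := by
    refine ⟨by exact_mod_cast hw.lt_one, LipschitzWith.of_dist_le_mul fun q q' => ?_⟩
    have h0 : 0 ≤ lam * dist q q' := mul_nonneg hw.nonneg dist_nonneg
    refine (dist_pi_le_iff h0).2 fun i => (dist_pi_le_iff h0).2 fun u => ?_
    have := abs_bellman_sub_le hw (Q := fun j v => τ j * q j v) (Q' := fun j v => τ j * q' j v)
      (dist_nonneg (x := q) (y := q')) (fun j v => by
        rw [← mul_sub, abs_mul, abs_of_pos (hpos j)]
        refine mul_le_mul_of_nonneg_left ?_ (hpos j).le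
        exact (dist_le_pi_dist (q j) (q' j) v).trans (dist_le_pi_dist q q' j)) ρ i u
    rw [Real.dist_eq, ← sub_div, abs_div, abs_of_pos (hpos i), div_le_iff₀ (hpos i), mul_comm]
    exact this
  refine ⟨fun i u => τ i * hf.fixedPoint f i u, ?_⟩
  ext i u
  have h1 : f hf.fixedPoint i u = hf.fixedPoint f i u :=
    congrFun (congrFun hf.fixedPoint_isFixedPt i) u
  rw [← h1, mul_div_cancel₀ _ (hpos i).ne']

/-- The level enters additively, so the distance `B` satisfies `B ≤ |ρ - ρ'| + lam * B`. -/
lemma tNorm_fixed_sub_le (hw : IsContractingWeight M i₀ τ lam) {Q Q' : S → A → ℝ} {ρ ρ' : ℝ}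
    (h : bellman M i₀ Q ρ = Q) (h' : bellman M i₀ Q' ρ' = Q') :
    tNorm τ (fun i u => Q i u - Q' i u) ≤ 1 / (1 - lam) * |ρ - ρ'| := by
  set B := tNorm τ (fun i u => Q i u - Q' i u) with hB
  have h1 : B ≤ |ρ - ρ'| + lam * B := by
    refine (tNorm_le_iff hw.one_le).2 fun i u => ?_
    have h2 := abs_bellman_sub_le hw (tNorm_nonneg τ (fun i u => Q i u - Q' i u))
      (abs_le_tNorm hw.one_le (fun i u => Q i u - Q' i u)) ρ i u
    have h3 : Q i u - Q' i u =
        (bellman M i₀ Q ρ i u - bellman M i₀ Q' ρ i u) - (ρ - ρ') := by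
      conv_lhs => rw [← h, ← h']
      simp only [bellman]; ring
    have h4 : |ρ - ρ'| ≤ τ i * |ρ - ρ'| := le_mul_of_one_le_left (abs_nonneg _) (hw.one_le i)
    rw [h3]
    refine (abs_sub _ _).trans ?_
    rw [mul_add]
    linarith
  have h5 : 0 < 1 - lam := by linarith [hw.lt_one]
  rw [one_div, ← div_eq_inv_mul, le_div_iff₀ h5]
  linarith

/-- Comparison principle. If the largest ratio `c` of `Q - V` to `τ` were positive, then at a pair
attaining it `Q - V` would be at most `lam * τ * c`, which is less than `τ * c`. -/
lemma fixed_le_of_bellman_le (hw : IsContractingWeight M i₀ τ lam) {Q V : S → A → ℝ} {ρ : ℝ}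
    (h : bellman M i₀ Q ρ = Q) (hV : ∀ i u, bellman M i₀ V ρ i u ≤ V i u) (i : S) (u : A) :
    Q i u ≤ V i u := by
  have hpos : ∀ i, 0 < τ i := fun i => by linarith [hw.one_le i]
  obtain ⟨⟨a, b⟩, hab⟩ := Finite.exists_max fun z : S × A => (Q z.1 z.2 - V z.1 z.2) / τ z.1
  set c := (Q a b - V a b) / τ a with hc
  have h1 : ∀ i u, Q i u ≤ V i u + τ i * c := fun i u => by
    have := hab (i, u)
    rw [div_le_iff₀ (hpos i)] at this
    dsimp only at this
    linarith
  suffices c ≤ 0 by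
    have h2 := h1 i u
    have h3 := mul_nonpos_of_nonneg_of_nonpos (hpos i).le this
    linarith
  by_contra! hcpos
  have h2 : Q a b - V a b ≤ lam * τ a * c := by
    calc Q a b - V a b ≤ bellman M i₀ Q ρ a b - bellman M i₀ V ρ a b := by
          rw [h]; linarith [hV a b]
      _ = ∑ j ∈ Finset.univ.filter (fun j => j ≠ i₀), M.p a b j * (minAct Q j - minAct V j) := by
          simp only [bellman, mul_sub, Finset.sum_sub_distrib]; ring
      _ ≤ ∑ j ∈ Finset.univ.filter (fun j => j ≠ i₀), (M.p a b j * τ j) * c := by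
          refine Finset.sum_le_sum fun j _ => ?_
          rw [mul_assoc]
          refine mul_le_mul_of_nonneg_left ?_ (M.p_nonneg a b j)
          linarith [minAct_le_add Q V j (τ j * c) (h1 j)]
      _ ≤ _ := by
          rw [← Finset.sum_mul]
          exact mul_le_mul_of_nonneg_right (hw.sum_le a b) hcpos.le
  have h3 : Q a b - V a b = c * τ a := by rw [hc, div_mul_cancel₀ _ (hpos a).ne']
  have h4 : 0 < c * τ a := mul_pos hcpos (hpos a)
  have h5 : lam * (c * τ a) < c * τ a := by nlinarith [hw.lt_one]
  linarith

/-- `Q - (ρ' - ρ)` is a supersolution at level `ρ'`: the cost term drops by exactly `ρ' - ρ` and the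
killed sum can only drop further. This slope bound gives existence, uniqueness and stability of the
zero `ρ*`. -/
lemma minAct_fixed_le (hw : IsContractingWeight M i₀ τ lam) {Q Q' : S → A → ℝ} {ρ ρ' : ℝ}
    (h : bellman M i₀ Q ρ = Q) (h' : bellman M i₀ Q' ρ' = Q') (hρ : ρ ≤ ρ') (i : S) :
    minAct Q' i ≤ minAct Q i - (ρ' - ρ) := by
  have h1 : ∀ i u, Q' i u ≤ Q i u + -(ρ' - ρ) := by
    refine fixed_le_of_bellman_le hw h' fun i u => ?_
    conv_rhs => rw [← h]
    have : ∑ j ∈ Finset.univ.filter (fun j => j ≠ i₀),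
          M.p i u j * minAct (fun i u => Q i u + -(ρ' - ρ)) j ≤
        ∑ j ∈ Finset.univ.filter (fun j => j ≠ i₀), M.p i u j * minAct Q j := by
      refine Finset.sum_le_sum fun j _ => mul_le_mul_of_nonneg_left ?_ (M.p_nonneg i u j)
      have := minAct_le_add (fun i u => Q i u + -(ρ' - ρ)) Q j 0 fun v => by linarith
      linarith
    simp only [bellman]
    linarith
  linarith [minAct_le_add Q' Q i _ (h1 i)]

/-- A contracting weight together with the fixed points `qs ρ` of the dynamic programming
operators and the level `ρs` at which the optimal value of `i₀` vanishes. -/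
structure IsSolution (M : MDP S A) (i₀ : S) (τ : S → ℝ) (lam : ℝ) (qs : ℝ → S → A → ℝ)
    (ρs : ℝ) : Prop extends IsContractingWeight M i₀ τ lam where
  fixed : ∀ ρ, bellman M i₀ (qs ρ) ρ = qs ρ
  minAct_eq_zero : minAct (qs ρs) i₀ = 0

lemma abs_minAct_fixed_sub_le (hw : IsContractingWeight M i₀ τ lam) {Q Q' : S → A → ℝ} {ρ ρ' : ℝ}
    (h : bellman M i₀ Q ρ = Q) (h' : bellman M i₀ Q' ρ' = Q') (i : S) :
    |minAct Q i - minAct Q' i| ≤ τ i * (1 / (1 - lam) * |ρ - ρ'|) :=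
  abs_minAct_sub_le _ _ _ _ fun v => (tNorm_le_iff hw.one_le).1 (tNorm_fixed_sub_le hw h h') i v

theorem exists_isSolution (hw : IsContractingWeight M i₀ τ lam) :
    ∃ qs ρs, IsSolution M i₀ τ lam qs ρs := by
  choose qs hqs using exists_bellman_fixed hw
  have hcont : Continuous fun ρ => minAct (qs ρ) i₀ := by
    refine (LipschitzWith.of_dist_le_mul (K := ⟨τ i₀ * (1 / (1 - lam)), ?_⟩)
      fun ρ ρ' => ?_).continuous
    · exact mul_nonneg (by linarith [hw.one_le i₀])
        (one_div_nonneg.2 (by linarith [hw.lt_one]))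
    · have := abs_minAct_fixed_sub_le hw (hqs ρ) (hqs ρ') i₀
      rw [← mul_assoc] at this
      exact this
  -- With slope at most `-1`, the value changes sign between level `0` and the level `c` equal to
  -- the value at `0`.
  have hex : ∃ ρs, minAct (qs ρs) i₀ = 0 := by
    set c := minAct (qs 0) i₀ with hc
    rcases le_total 0 c with h | h
    · have h1 := minAct_fixed_le hw (hqs 0) (hqs c) h i₀
      obtain ⟨x, -, hx⟩ := intermediate_value_Icc' h hcont.continuousOn
        (show (0 : ℝ) ∈ Set.Icc _ _ from ⟨by linarith, by linarith⟩)
      exact ⟨x, hx⟩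
    · have h1 := minAct_fixed_le hw (hqs c) (hqs 0) h i₀
      obtain ⟨x, -, hx⟩ := intermediate_value_Icc' h hcont.continuousOn
        (show (0 : ℝ) ∈ Set.Icc _ _ from ⟨by linarith, by linarith⟩)
      exact ⟨x, hx⟩
  obtain ⟨ρs, hρs⟩ := hex
  exact ⟨qs, ρs, ⟨hw, hqs, hρs⟩⟩

lemma IsSolution.isSSPFixedPoint {qs : ℝ → S → A → ℝ} {ρs : ℝ}
    (h : IsSolution M i₀ τ lam qs ρs) : IsSSPFixedPoint M i₀ (qs ρs) ρs :=
  ⟨fun i u => (congrFun (congrFun (h.fixed ρs) i) u).symm, h.minAct_eq_zero⟩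

lemma IsSolution.unique {qs : ℝ → S → A → ℝ} {ρs : ℝ} (h : IsSolution M i₀ τ lam qs ρs)
    {Q' : S → A → ℝ} {ρ' : ℝ} (h' : IsSSPFixedPoint M i₀ Q' ρ') : Q' = qs ρs ∧ ρ' = ρs := by
  have hQ' : bellman M i₀ Q' ρ' = Q' := by ext i u; exact (h'.1 i u).symm
  have hρ : ρ' = ρs := by
    have h0 := h'.2
    have h1 := h.minAct_eq_zero
    rcases le_total ρ' ρs with hle | hle
    · have := minAct_fixed_le h.toIsContractingWeight hQ' (h.fixed ρs) hle i₀
      linarith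
    · have := minAct_fixed_le h.toIsContractingWeight (h.fixed ρs) hQ' hle i₀
      linarith
  subst hρ
  refine ⟨?_, rfl⟩
  ext i u
  have := (tNorm_le_iff h.one_le).1
    (tNorm_fixed_sub_le h.toIsContractingWeight hQ' (h.fixed ρ')) i u
  simpa [sub_eq_zero] using this

end FixedPoint

/-! ### The Poisson equation of the chain under the sampling policy. -/

section Poisson

variable {S A : Type*} [Fintype S] [Fintype A] [Nonempty A] [DecidableEq S]

/-- The transition probabilities of the states under the sampling policy `Φ`. -/
def stateKernel (M : MDP S A) (Φ : S → A → ℝ) (x y : S) : ℝ := ∑ v, Φ x v * M.p x v y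

variable {M : MDP S A} {Φ : S → A → ℝ}

lemma stateKernel_nonneg (hΦ : ∀ i u, 0 < Φ i u) (x y : S) : 0 ≤ stateKernel M Φ x y :=
  Finset.sum_nonneg fun v _ => mul_nonneg (hΦ x v).le (M.p_nonneg x v y)

lemma sum_stateKernel (hΦsum : ∀ i, ∑ u, Φ i u = 1) (x : S) : ∑ y, stateKernel M Φ x y = 1 := by
  simp only [stateKernel]
  rw [Finset.sum_comm]
  simp only [← Finset.mul_sum, M.p_sum, mul_one, hΦsum]

/-- The set of minimisers of `V` is closed under the sampled chain. Since `Φ > 0`, that chain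
charges every transition of a constant policy, whose irreducibility therefore suffices. -/
lemma superharmonic_const (hirr : M.IrreducibleUnderAllControls) (hΦ : ∀ i u, 0 < Φ i u)
    (hΦsum : ∀ i, ∑ u, Φ i u = 1) {V : S → ℝ}
    (hV : ∀ x, ∑ y, stateKernel M Φ x y * V y ≤ V x) (x y : S) : V x = V y := by
  have : Nonempty S := ⟨x⟩
  obtain ⟨a, ha⟩ := Finite.exists_min V
  obtain ⟨v⟩ := ‹Nonempty A›
  have h : ∀ z, V z = V a := fun z => by
    refine mem_of_closed (hirr fun _ => v) {z | V z = V a} (fun b hb c hc => ?_) (i := a) rfl z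
    have h1 : ∑ y, stateKernel M Φ b y * (V y - V a) ≤ 0 := by
      simp only [mul_sub, Finset.sum_sub_distrib, ← Finset.sum_mul, sum_stateKernel hΦsum, one_mul]
      have : V b = V a := hb
      linarith [hV b]
    have hn : ∀ y ∈ Finset.univ, 0 ≤ stateKernel M Φ b y * (V y - V a) := fun y _ =>
      mul_nonneg (stateKernel_nonneg hΦ b y) (by linarith [ha y])
    have h2 := (Finset.sum_eq_zero_iff_of_nonneg hn).1 (le_antisymm h1 (Finset.sum_nonneg hn)) c
      (Finset.mem_univ c)
    have h3 : 0 < stateKernel M Φ b c := by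
      refine lt_of_lt_of_le (mul_pos (hΦ b v) hc) ?_
      exact Finset.single_le_sum (f := fun v => Φ b v * M.p b v c)
        (fun v _ => mul_nonneg (hΦ b v).le (M.p_nonneg b v c)) (Finset.mem_univ v)
    rcases mul_eq_zero.1 h2 with h4 | h4
    · linarith
    · exact sub_eq_zero.1 h4
  rw [h x, h y]

/-- The Poisson equation for the state chain under the sampling policy. -/
theorem exists_poisson (hirr : M.IrreducibleUnderAllControls) (hΦ : ∀ i u, 0 < Φ i u)
    (hΦsum : ∀ i, ∑ u, Φ i u = 1) (f : S → ℝ) :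
    ∃ (V : S → ℝ) (d : ℝ), ∀ x, f x = d + V x - ∑ y, stateKernel M Φ x y * V y := by
  rcases isEmpty_or_nonempty S with hS | ⟨⟨a⟩⟩
  · exact ⟨0, 0, fun x => isEmptyElim x⟩
  -- `T` is the identity minus the kernel plus the rank-one term `V a`. That term removes the
  -- constants from the kernel of `T`, and in a solution it supplies the constant `d`.
  let T : (S → ℝ) →ₗ[ℝ] (S → ℝ) :=
    { toFun := fun V x => V a + V x - ∑ y, stateKernel M Φ x y * V y
      map_add' := fun V W => by
        ext x
        simp only [Pi.add_apply, mul_add, Finset.sum_add_distrib]; ring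
      map_smul' := fun c V => by
        ext x
        simp only [Pi.smul_apply, smul_eq_mul, RingHom.id_apply, mul_sub, mul_add, Finset.mul_sum]
        congr 1
        exact Finset.sum_congr rfl fun y _ => by ring }
  have hT : ∀ V x, T V x = V a + V x - ∑ y, stateKernel M Φ x y * V y := fun V x => rfl
  have key : ∀ V, T V = 0 → V a ≤ 0 → V = 0 := by
    intro V hV ha
    have hc := superharmonic_const hirr hΦ hΦsum (V := V) fun x => by
      have := congrFun hV x
      rw [hT, Pi.zero_apply] at this
      linarith
    ext x
    have h1 := congrFun hV x
    have h2 : ∑ y, stateKernel M Φ x y * V y = V a := by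
      rw [Finset.sum_congr rfl fun y _ => by rw [hc y a], ← Finset.sum_mul,
        sum_stateKernel hΦsum, one_mul]
    rw [hT, h2, Pi.zero_apply] at h1
    rw [Pi.zero_apply]
    linarith
  have hinj : Function.Injective T := by
    rw [← LinearMap.ker_eq_bot, LinearMap.ker_eq_bot']
    intro V hV
    rcases le_total (V a) 0 with h | h
    · exact key V hV h
    · exact neg_eq_zero.1 (key (-V) (by rw [map_neg, hV, neg_zero])
        (by rw [Pi.neg_apply]; linarith))
  obtain ⟨V, hV⟩ := LinearMap.injective_iff_surjective.1 hinj f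
  exact ⟨V, V a, fun x => by rw [← hV, hT]⟩

/-- The indicator of each state solves a Poisson equation whose constant lies in `(0, 1]`. -/
theorem exists_poisson_indicator (hirr : M.IrreducibleUnderAllControls) (hΦ : ∀ i u, 0 < Φ i u)
    (hΦsum : ∀ i, ∑ u, Φ i u = 1) :
    ∃ (V : S → S → ℝ) (d : S → ℝ), (∀ i, 0 < d i) ∧ (∀ i, d i ≤ 1) ∧
      ∀ i x, (if x = i then 1 else 0) = d i + V i x - ∑ y, stateKernel M Φ x y * V i y := by
  choose V d h using fun i : S => exists_poisson hirr hΦ hΦsum fun x => if x = i then (1 : ℝ) else 0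
  have hconst : ∀ W : S → ℝ, (∀ x y, W x = W y) → ∀ x, ∑ y, stateKernel M Φ x y * W y = W x := by
    intro W hc x
    rw [Finset.sum_congr rfl fun y _ => by rw [hc y x], ← Finset.sum_mul,
      sum_stateKernel hΦsum, one_mul]
  refine ⟨V, d, fun i => ?_, fun i => ?_, h⟩
  -- If `d i ≤ 0` then `V i` is superharmonic, hence constant, and the equation at `x = i` reads `1
  -- = d i`. For `d i > 1` the same applies to `-V i`.
  · by_contra! hd
    have hc := superharmonic_const hirr hΦ hΦsum (V := V i) fun x => by
      have := h i x
      have h0 : (0 : ℝ) ≤ if x = i then 1 else 0 := by split_ifs <;> norm_num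
      linarith
    have := h i i
    rw [hconst _ hc i, if_pos rfl] at this
    linarith
  · by_contra! hd
    have hc := superharmonic_const hirr hΦ hΦsum (V := fun x => -V i x) fun x => by
      have := h i x
      have h0 : (if x = i then (1 : ℝ) else 0) ≤ 1 := by split_ifs <;> norm_num
      simp only [mul_neg, Finset.sum_neg_distrib]
      linarith
    have := h i i
    rw [hconst (V i) (fun x y => neg_injective (hc x y)) i, if_pos rfl] at this
    linarith

end Poisson

/-! ### Filtrations and conditional probabilities. -/

section Histories

variable {S A Ω : Type*} [MeasurableSpace S] [MeasurableSpace A] {m0 m mΩ : MeasurableSpace Ω}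
  {X : ℕ → Ω → S} {U : ℕ → Ω → A}

lemma preHistory_le_postHistory (n : ℕ) : preHistory m0 X U n ≤ postHistory m0 X U n :=
  sup_le_sup le_rfl (iSup₂_le fun m hm => le_iSup₂_of_le m hm.le le_rfl)

lemma postHistory_le_preHistory_succ (n : ℕ) :
    postHistory m0 X U n ≤ preHistory m0 X U (n + 1) :=
  sup_le_sup (sup_le_sup le_rfl (iSup₂_le fun m hm => le_iSup₂_of_le m (by omega) le_rfl))
    (iSup₂_le fun m hm => le_iSup₂_of_le m (by omega) le_rfl)

lemma postHistory_le (hm0 : m0 ≤ mΩ) (hX : ∀ n, Measurable (X n)) (hU : ∀ n, Measurable (U n))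
    (n : ℕ) : postHistory m0 X U n ≤ mΩ :=
  sup_le (sup_le hm0 (iSup₂_le fun m _ => (hX m).comap_le)) (iSup₂_le fun m _ => (hU m).comap_le)

lemma measurable_state_preHistory (n : ℕ) : Measurable[preHistory m0 X U n] (X n) := by
  have h1 : MeasurableSpace.comap (X n) inferInstance ≤
      ⨆ (l : ℕ) (_ : l ≤ n), MeasurableSpace.comap (X l) inferInstance :=
    le_iSup₂_of_le n le_rfl le_rfl
  have h2 : MeasurableSpace.comap (X n) inferInstance ≤ preHistory m0 X U n :=
    h1.trans (le_sup_right.trans le_sup_left)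
  exact fun s hs => h2 _ ⟨s, hs, rfl⟩

lemma measurable_action_postHistory (n : ℕ) : Measurable[postHistory m0 X U n] (U n) := by
  have h1 : MeasurableSpace.comap (U n) inferInstance ≤
      ⨆ (l : ℕ) (_ : l ≤ n), MeasurableSpace.comap (U l) inferInstance :=
    le_iSup₂_of_le n le_rfl le_rfl
  have h2 : MeasurableSpace.comap (U n) inferInstance ≤ postHistory m0 X U n :=
    h1.trans le_sup_right
  exact fun s hs => h2 _ ⟨s, hs, rfl⟩

lemma le_preHistory_zero : m0 ≤ preHistory m0 X U 0 :=
  le_sup_of_le_left le_sup_left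

/-- Integration against a conditional probability. -/
lemma integral_indicator_mul_of_condProb {P : Measure Ω} [IsProbabilityMeasure P]
    (hm : m ≤ mΩ) {s : Set Ω} (hs : MeasurableSet s) {q B : Ω → ℝ}
    (hq : P⟦s | m⟧ =ᵐ[P] q) (hB : Measurable[m] B) (hBi : Integrable B P) :
    ∫ ω, s.indicator (fun _ => (1 : ℝ)) ω * B ω ∂P = ∫ ω, q ω * B ω ∂P := by
  have hi : Integrable (s.indicator fun _ => (1 : ℝ)) P := (integrable_const 1).indicator hs
  have hmul : Integrable (s.indicator (fun _ => (1 : ℝ)) * B) P := by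
    have : s.indicator (fun _ => (1 : ℝ)) * B = s.indicator B := by
      ext ω
      by_cases h : ω ∈ s <;> simp [h]
    rw [this]
    exact hBi.indicator hs
  have h1 := condExp_mul_of_stronglyMeasurable_right (m := m) hB.stronglyMeasurable hmul hi
  calc _ = ∫ ω, (P[s.indicator (fun _ => (1 : ℝ)) * B | m]) ω ∂P := (integral_condExp hm).symm
    _ = _ := by
      refine integral_congr_ae ?_
      filter_upwards [h1, hq] with ω h1 h2
      rw [h1, Pi.mul_apply, h2]

end Histories

/-! ### Optimality of `ρ*` among average costs. -/

section AverageCost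

variable {S A : Type*} [Fintype S] [Fintype A] [Nonempty S] [Nonempty A] [DecidableEq S]
  [MeasurableSpace S] [MeasurableSingletonClass S] [MeasurableSpace A] [MeasurableSingletonClass A]
  {M : MDP S A}

lemma integrable_of_finite {Ω T : Type*} [Finite T] [MeasurableSpace T]
    [MeasurableSingletonClass T] [MeasurableSpace Ω] {P : Measure Ω} [IsFiniteMeasure P]
    {Z : Ω → T} (hZ : Measurable Z) (f : T → ℝ) : Integrable (fun ω => f (Z ω)) P := by
  obtain ⟨C, hC⟩ := (Set.finite_range fun t => ‖f t‖).bddAbove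
  exact Integrable.of_bound ((Measurable.of_discrete (f := f)).comp hZ).aestronglyMeasurable C
    (ae_of_all _ fun ω => hC ⟨Z ω, rfl⟩)

lemma IsControlledChain.integral_next {Ω : Type*} {m0 mΩ : MeasurableSpace Ω} {P : Measure Ω}
    [IsProbabilityMeasure P] (hm0 : m0 ≤ mΩ) {X : ℕ → Ω → S}
    {U : ℕ → Ω → A} (hc : IsControlledChain M P m0 X U) (h : S → ℝ) (n : ℕ) :
    ∫ ω, h (X (n + 1) ω) ∂P = ∫ ω, ∑ j, M.p (X n ω) (U n ω) j * h j ∂P := by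
  have hm := postHistory_le hm0 hc.measurable_state hc.measurable_action n
  have h1 : ∀ j, ∫ ω, (X (n + 1) ⁻¹' {j}).indicator (fun _ => (1 : ℝ)) ω * h j ∂P =
      ∫ ω, M.p (X n ω) (U n ω) j * h j ∂P := fun j =>
    integral_indicator_mul_of_condProb hm (hc.measurable_state (n + 1) (measurableSet_singleton j))
      (hc.transition n j) measurable_const (integrable_const _)
  have h2 : ∀ ω, h (X (n + 1) ω) =
      ∑ j, (X (n + 1) ⁻¹' {j}).indicator (fun _ => (1 : ℝ)) ω * h j := by
    intro ω
    rw [Finset.sum_eq_single (X (n + 1) ω)]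
    · simp
    · intro b _ hb
      rw [Set.indicator_of_notMem (by simpa using hb.symm), zero_mul]
    · simp
  simp_rw [h2]
  rw [integral_finsetSum, integral_finsetSum]
  · exact Finset.sum_congr rfl fun j _ => h1 j
  · intro j _
    exact integrable_of_finite ((hc.measurable_state n).prodMk (hc.measurable_action n))
      fun z => M.p z.1 z.2 j * h j
  · intro j _
    exact ((integrable_const (1 : ℝ)).indicator
      (hc.measurable_state (n + 1) (measurableSet_singleton j))).mul_const _

lemma tendsto_average_telescope {a : ℕ → ℝ} {B : ℝ} (ha : ∀ n, |a n| ≤ B) (ρ : ℝ) :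
    Tendsto (fun n : ℕ => (1 / (n : ℝ)) * ∑ m ∈ Finset.range n, (ρ + (a m - a (m + 1))))
      atTop (𝓝 ρ) := by
  have h1 : Tendsto (fun n : ℕ => ρ + (a 0 - a n) / (n : ℝ)) atTop (𝓝 (ρ + 0)) := by
    refine tendsto_const_nhds.add ?_
    refine squeeze_zero_norm (a := fun n : ℕ => (2 * B) / (n : ℝ)) (fun n => ?_)
      (tendsto_const_div_atTop_nhds_zero_nat _)
    rw [Real.norm_eq_abs, abs_div, Nat.abs_cast]
    refine div_le_div_of_nonneg_right ?_ (Nat.cast_nonneg n)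
    linarith [abs_sub (a 0) (a n), ha 0, ha n]
  rw [add_zero] at h1
  refine h1.congr' ?_
  filter_upwards [eventually_gt_atTop 0] with n hn
  have : (n : ℝ) ≠ 0 := by positivity
  rw [Finset.sum_add_distrib, Finset.sum_range_sub']
  simp only [Finset.sum_const, Finset.card_range, nsmul_eq_mul]
  field_simp

/-- A Markov chain with given transition probabilities, on a probability space in `Type`. -/
theorem exists_markovChain (q : S → S → ℝ) (hq0 : ∀ i j, 0 ≤ q i j) (hq1 : ∀ i, ∑ j, q i j = 1)
    (x : S) :
    ∃ (Ω : Type) (_ : MeasurableSpace Ω) (P : Measure Ω) (_ : IsProbabilityMeasure P)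
      (X : ℕ → Ω → S), (∀ n, Measurable (X n)) ∧ (∀ ω, X 0 ω = x) ∧
      ∀ n (m : MeasurableSpace Ω), m ≤ (⨆ (l : ℕ) (_ : l ≤ n), MeasurableSpace.comap (X l)
        inferInstance) → Measurable[m] (X n) → ∀ j,
        P⟦X (n + 1) ⁻¹' {j} | m⟧ =ᵐ[P] fun ω => q (X n ω) j := by
  classical
  -- Coding the states by `Fin s` puts the sample space in `Type`, whatever the universe of `S`.
  let s := Fintype.card S
  let e : S ≃ Fin s := Fintype.equivFin S
  let κ : Fin s → PMF (Fin s) := fun i =>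
    PMF.ofFintype (fun b => ENNReal.ofReal (q (e.symm i) (e.symm b))) (by
      rw [← ENNReal.ofReal_sum_of_nonneg fun b _ => hq0 _ _, e.symm.sum_comp, hq1,
        ENNReal.ofReal_one])
  let ν : ℕ × Fin s → Measure (Fin s) := fun z => (κ z.2).toMeasure
  have hν : ∀ z, IsProbabilityMeasure (ν z) := fun z => inferInstance
  let P : Measure (ℕ × Fin s → Fin s) := Measure.infinitePi ν
  -- The coordinate `(n, b)` is the successor to be used if the chain is in state `b` at time `n`;
  -- all coordinates are independent.
  let X : ℕ → (ℕ × Fin s → Fin s) → S := fun n ω =>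
    Nat.rec x (fun n y => e.symm (ω (n, e y))) n
  have hX1 : ∀ n ω, X (n + 1) ω = e.symm (ω (n, e (X n ω))) := fun n ω => rfl
  let F : ℕ → MeasurableSpace (ℕ × Fin s → Fin s) := fun n =>
    ⨆ z ∈ {z : ℕ × Fin s | z.1 < n}, MeasurableSpace.comap (fun ω => ω z) inferInstance
  have hFmono : ∀ n, F n ≤ F (n + 1) := fun n =>
    biSup_mono fun z hz => lt_trans hz (Nat.lt_succ_self n)
  have hFle : ∀ n, F n ≤ MeasurableSpace.pi := fun n =>
    iSup₂_le fun z _ => (measurable_pi_apply z).comap_le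
  have hpre : ∀ n j, X (n + 1) ⁻¹' {j} =
      ⋃ i, (X n ⁻¹' {i} ∩ (fun ω : ℕ × Fin s → Fin s => ω (n, e i)) ⁻¹' {e j}) := by
    intro n j
    ext ω
    simp only [Set.mem_preimage, Set.mem_singleton_iff, Set.mem_iUnion, Set.mem_inter_iff, hX1,
      exists_eq_left']
    exact Equiv.symm_apply_eq e
  have hXF : ∀ n, Measurable[F n] (X n) := by
    intro n
    induction n with
    | zero => exact measurable_const
    | succ n ih =>
      refine @measurable_to_countable' _ _ _ _ (F (n + 1)) _ fun j => ?_
      rw [hpre]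
      refine MeasurableSet.iUnion fun i => MeasurableSet.inter ?_ ?_
      · exact hFmono n _ (ih (measurableSet_singleton i))
      · have : MeasurableSpace.comap (fun ω : ℕ × Fin s → Fin s => ω (n, e i)) inferInstance ≤
            F (n + 1) := le_iSup₂_of_le (n, e i) (Nat.lt_succ_self n) le_rfl
        exact this _ ⟨{e j}, measurableSet_singleton _, rfl⟩
  have hF_le : ∀ {l n}, l ≤ n → F l ≤ F n := fun h => monotone_nat_of_le_succ hFmono h
  have hXm : ∀ n, Measurable (X n) := fun n => (hXF n).mono (hFle n) le_rfl
  have hsω : ∀ n i j, MeasurableSet ((fun ω : ℕ × Fin s → Fin s => ω (n, e i)) ⁻¹' {e j}) := fun n i j =>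
    measurable_pi_apply _ (measurableSet_singleton _)
  have hint : ∀ n i j, ∫ ω, ((fun ω : ℕ × Fin s → Fin s => ω (n, e i)) ⁻¹' {e j}).indicator
      (fun _ => (1 : ℝ)) ω ∂P = q i j := by
    intro n i j
    have h1 : P ((fun ω : ℕ × Fin s → Fin s => ω (n, e i)) ⁻¹' {e j}) = ENNReal.ofReal (q i j) := by
      rw [(measurePreserving_eval_infinitePi ν (n, e i)).measure_preimage
        (measurableSet_singleton _).nullMeasurableSet]
      simp [ν, κ]
    rw [integral_indicator_const _ (hsω n i j), measureReal_def, h1,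
      ENNReal.toReal_ofReal (hq0 i j)]
    simp
  refine ⟨_, inferInstance, P, inferInstance, X, hXm, fun ω => rfl, ?_⟩
  intro n m hm hXn j
  have hmF : m ≤ F n := hm.trans (iSup₂_le fun l hl => ((hXF l).comap_le).trans (hF_le hl))
  have hmle : m ≤ MeasurableSpace.pi := hmF.trans (hFle n)
  -- The past involves only coordinates with time index less than `n`, so it is independent of those
  -- with index `n`.
  have hind : ∀ i, Indep (MeasurableSpace.comap (fun ω : ℕ × Fin s → Fin s => ω (n, e i))
      inferInstance) m P := by
    intro i
    have h1 : iIndepFun (fun (z : ℕ × Fin s) (ω : ℕ × Fin s → Fin s) => ω z) P :=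
      iIndepFun_infinitePi (P := ν) (X := fun _ => id) fun _ => measurable_id
    have h2 := indep_iSup_of_disjoint (fun z => (measurable_pi_apply z).comap_le) h1.iIndep
      (S := {(n, e i)}) (T := {z : ℕ × Fin s | z.1 < n}) (by simp)
    rw [iSup_singleton] at h2
    exact indep_of_indep_of_le_right h2 hmF
  have hsX : ∀ i, MeasurableSet[m] (X n ⁻¹' {i}) := fun i => hXn (measurableSet_singleton i)
  let f : S → (ℕ × Fin s → Fin s) → ℝ := fun i => (X n ⁻¹' {i}).indicator fun _ => 1
  let g : S → (ℕ × Fin s → Fin s) → ℝ := fun i =>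
    ((fun ω : ℕ × Fin s → Fin s => ω (n, e i)) ⁻¹' {e j}).indicator fun _ => 1
  have hfg : (X (n + 1) ⁻¹' {j}).indicator (fun _ => (1 : ℝ)) = ∑ i, f i * g i := by
    ext ω
    rw [Finset.sum_apply, Finset.sum_eq_single (X n ω)]
    · simp [f, g, Set.indicator_apply, hX1, Equiv.symm_apply_eq]
    · intro b _ hb
      simp [f, hb.symm]
    · simp
  have hgi : ∀ i, Integrable (g i) P := fun i => (integrable_const 1).indicator (hsω n i j)
  have hfgi : ∀ i, Integrable (f i * g i) P := fun i => by
    have : f i * g i = (X n ⁻¹' {i}).indicator (g i) := by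
      ext ω
      simp [f, Set.indicator_apply]
    rw [this]
    exact (hgi i).indicator (hmle _ (hsX i))
  have hgint : ∀ i, ∫ ω, g i ω ∂P = q i j := fun i => hint n i j
  have hcond : ∀ i, P[f i * g i | m] =ᵐ[P] fun ω => f i ω * q i j := by
    intro i
    have h1 := condExp_mul_of_stronglyMeasurable_left (μ := P) (m := m) (f := f i) (g := g i)
      (stronglyMeasurable_const.indicator (hsX i)) (hfgi i) (hgi i)
    have h2 : P[g i | m] =ᵐ[P] fun _ => ∫ ω, g i ω ∂P := by
      refine condExp_indep_eq (measurable_pi_apply _).comap_le hmle ?_ (hind i)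
      exact stronglyMeasurable_const.indicator ⟨{e j}, measurableSet_singleton _, rfl⟩
    filter_upwards [h1, h2] with ω h1 h2
    rw [h1, Pi.mul_apply, h2, hgint]
  rw [hfg]
  have hsum := condExp_finsetSum (μ := P) (m := m) (s := Finset.univ) (f := fun i => f i * g i)
    fun i _ => hfgi i
  have hall : ∀ᵐ ω ∂P, ∀ i, (P[f i * g i | m]) ω = f i ω * q i j := ae_all_iff.2 hcond
  filter_upwards [hsum, hall] with ω h1 h2
  rw [h1, Finset.sum_apply, Finset.sum_congr rfl fun i _ => h2 i, Finset.sum_eq_single (X n ω)]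
  · simp [f]
  · intro b _ hb
    simp [f, hb.symm]
  · simp

/-- By the optimality equation the expected cost at time `n` is `ρs`, plus a telescoping difference
of bounded values, plus the expected gap `Qs - minAct Qs` at the chosen action. The gap is
nonnegative, and it vanishes for the policy that minimises `Qs`. -/
theorem isLeast_averageCosts {i₀ : S} {Qs : S → A → ℝ} {ρs : ℝ}
    (hfix : IsSSPFixedPoint M i₀ Qs ρs) (x : S) : IsLeast (averageCosts M x) ρs := by
  -- The term `j = i₀`, missing from the killed sum, is zero by the normalisation of `Qs`.
  have hQ : ∀ i u, Qs i u = M.k i u - ρs + ∑ j, M.p i u j * minAct Qs j := by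
    intro i u
    rw [hfix.1 i u, Finset.sum_filter]
    congr 1
    refine Finset.sum_congr rfl fun j _ => ?_
    split_ifs with h
    · rfl
    · rw [not_not.1 h, hfix.2, mul_zero]
  obtain ⟨B, hB⟩ := (Set.finite_range fun i => |minAct Qs i|).bddAbove
  have hbound : ∀ {Ω : Type} [MeasurableSpace Ω] (P : Measure Ω) [IsProbabilityMeasure P]
      (Z : Ω → S), |∫ ω, minAct Qs (Z ω) ∂P| ≤ B := by
    intro Ω _ P _ Z
    have := norm_integral_le_of_norm_le_const (μ := P) (f := fun ω => minAct Qs (Z ω)) (C := B)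
      (ae_of_all _ fun ω => hB ⟨Z ω, rfl⟩)
    simpa using this
  have hcost : ∀ {Ω : Type} [MeasurableSpace Ω] (P : Measure Ω) [IsProbabilityMeasure P]
      (X : ℕ → Ω → S) (U : ℕ → Ω → A), IsControlledChain M P ⊥ X U → ∀ n,
      ∫ ω, M.k (X n ω) (U n ω) ∂P = ρs + (∫ ω, minAct Qs (X n ω) ∂P -
        ∫ ω, minAct Qs (X (n + 1) ω) ∂P) + ∫ ω, (Qs (X n ω) (U n ω) - minAct Qs (X n ω)) ∂P := by
    intro Ω mΩ P _ X U hc n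
    have hXU := (hc.measurable_state n).prodMk (hc.measurable_action n)
    rw [hc.integral_next bot_le, integral_sub
      (integrable_of_finite hXU fun z => Qs z.1 z.2)
      (integrable_of_finite (hc.measurable_state n) fun z => minAct Qs z)]
    have h1 : ∫ ω, Qs (X n ω) (U n ω) ∂P = ∫ ω, (M.k (X n ω) (U n ω) - ρs +
        ∑ j, M.p (X n ω) (U n ω) j * minAct Qs j) ∂P := by simp_rw [← hQ]
    rw [h1, integral_add (integrable_of_finite hXU fun z => M.k z.1 z.2 - ρs)
      (integrable_of_finite hXU fun z => ∑ j, M.p z.1 z.2 j * minAct Qs j),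
      integral_sub (integrable_of_finite hXU fun z => M.k z.1 z.2) (integrable_const _),
      integral_const]
    simp only [probReal_univ, one_smul]
    ring
  constructor
  · choose μ hμ using fun i => exists_minAct Qs i
    obtain ⟨Ω, mΩ, P, hP, X, hX, hX0, hXt⟩ := exists_markovChain (fun i j => M.p i (μ i) j)
      (fun i j => M.p_nonneg i _ j) (fun i => M.p_sum i _) x
    have hμm : Measurable μ := Measurable.of_discrete
    have hc : IsControlledChain M P ⊥ X (fun n ω => μ (X n ω)) := by
      refine ⟨hX, fun n => hμm.comp (hX n), fun n j => ?_⟩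
      -- The actions are functions of the states, so the history contains nothing beyond `X 0, …, X
      -- n`.
      refine hXt n _ ?_ ?_ j
      · refine sup_le (sup_le bot_le le_rfl) (iSup₂_le fun l hl => le_iSup₂_of_le l hl ?_)
        rintro _ ⟨t, ht, rfl⟩
        exact ⟨μ ⁻¹' t, hμm ht, rfl⟩
      · exact (measurable_state_preHistory n).mono (preHistory_le_postHistory n) le_rfl
    refine ⟨Ω, mΩ, P, hP, X, fun n ω => μ (X n ω), hc, ae_of_all _ hX0, ?_⟩
    refine (tendsto_average_telescope (fun n => hbound P (X n)) ρs).congr fun n => ?_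
    congr 1
    refine Finset.sum_congr rfl fun m _ => ?_
    rw [hcost P X _ hc m]
    simp [← hμ]
  · rintro c ⟨Ω, mΩ, P, hP, X, U, hc, -, hlim⟩
    refine le_of_tendsto_of_tendsto' (tendsto_average_telescope (fun n => hbound P (X n)) ρs)
      hlim fun n => ?_
    refine mul_le_mul_of_nonneg_left (Finset.sum_le_sum fun m _ => ?_) (by positivity)
    rw [hcost P X U hc m]
    refine le_add_of_nonneg_right (integral_nonneg fun ω => ?_)
    exact sub_nonneg.2 (minAct_le _ _ _)

end AverageCost

/-! ### Trajectories, and the martingale noise of the updates. -/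

section Pathwise

variable {S A : Type*} [Fintype S] [Fintype A] [Nonempty S] [Nonempty A] [DecidableEq S]
  [DecidableEq A]

/-- A trajectory `(Q n, ρ n)` of the algorithm, together with the averaged iterates `Y n` in which
the update of each component is replaced by its mean with frequencies `D`. -/
structure IsPath (M : MDP S A) (i₀ : S) (D : S → A → ℝ) (a₀ b₀ : ℝ) (x : ℕ → S) (u : ℕ → A)
    (Q : ℕ → S → A → ℝ) (ρ : ℕ → ℝ) (Y : ℕ → S → A → ℝ) : Prop where
  Q_succ : ∀ n i v, Q (n + 1) i v = Q n i v + a₀ / ((n : ℝ) + 1) *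
    (if x n = i ∧ u n = v then 1 else 0) * (M.k i v +
      (if x (n + 1) ≠ i₀ then 1 else 0) * minAct (Q n) (x (n + 1)) - Q n i v - ρ n)
  ρ_succ : ∀ n, ρ (n + 1) = ρ n + b₀ / ((n : ℝ) + 1) * minAct (Q n) i₀
  Y_zero : Y 0 = Q 0
  Y_succ : ∀ n i v, Y (n + 1) i v = (1 - a₀ / ((n : ℝ) + 1) * D i v) * Y n i v +
    a₀ / ((n : ℝ) + 1) * D i v * bellman M i₀ (Q n) (ρ n) i v

/-- The size of an iterate. -/
noncomputable def size (τ : S → ℝ) (Q : S → A → ℝ) (ρ : ℝ) : ℝ := 1 + tNorm τ Q + |ρ|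

lemma one_le_size (τ : S → ℝ) (Q : S → A → ℝ) (ρ : ℝ) : 1 ≤ size τ Q ρ := by
  have := tNorm_nonneg τ Q
  have := abs_nonneg ρ
  unfold size; linarith

/-- The displacement of the averaged map. -/
def displacement (M : MDP S A) (i₀ : S) (Q : S → A → ℝ) (ρ : ℝ) (i : S) (v : A) : ℝ :=
  bellman M i₀ Q ρ i v - Q i v

/-- The increment of the component `(i, v)` along a transition to `y`. -/
def increment (M : MDP S A) (i₀ : S) (Q : S → A → ℝ) (ρ : ℝ) (y : S) (i : S) (v : A) : ℝ :=
  M.k i v + (if y ≠ i₀ then 1 else 0) * minAct Q y - Q i v - ρ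

/-- The martingale noise of the component `(i, v)` after correction by the solution `V` of the
Poisson equation, at the state `x`, action `u` and next state `y`. -/
def noise (M : MDP S A) (i₀ : S) (Φ : S → A → ℝ) (V : S → S → ℝ) (Q : S → A → ℝ) (ρ : ℝ)
    (x : S) (u : A) (y : S) (i : S) (v : A) : ℝ :=
  (if x = i ∧ u = v then 1 else 0) * increment M i₀ Q ρ y i v
    - (if x = i then 1 else 0) * Φ i v * displacement M i₀ Q ρ i v
    + Φ i v * displacement M i₀ Q ρ i v * (V i y - ∑ z, stateKernel M Φ x z * V i z)

variable {M : MDP S A} {i₀ : S} {τ : S → ℝ} {lam : ℝ} {Φ : S → A → ℝ}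

lemma minAct_zero (j : S) : minAct (0 : S → A → ℝ) j = 0 := by
  obtain ⟨v, hv⟩ := exists_minAct (0 : S → A → ℝ) j
  rw [hv]; rfl

lemma abs_minAct_le (hτ : ∀ i, 1 ≤ τ i) (Q : S → A → ℝ) (j : S) :
    |minAct Q j| ≤ τ j * tNorm τ Q := by
  have := abs_minAct_sub_le Q 0 j (τ j * tNorm τ Q) fun v => by
    simpa using abs_le_tNorm hτ Q j v
  rwa [minAct_zero, sub_zero] at this

/-- Every quantity in the update grows at most linearly in the iterate; the summand `1` in `size`
absorbs the running cost. -/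
lemma exists_size_bounds (M : MDP S A) (i₀ : S) (hτ : ∀ i, 1 ≤ τ i) :
    ∃ C, 1 ≤ C ∧ ∀ (Q : S → A → ℝ) (ρ : ℝ),
      (∀ j, |minAct Q j| ≤ C * size τ Q ρ) ∧ (∀ i v, |Q i v| ≤ C * size τ Q ρ) ∧
      (∀ i v, |bellman M i₀ Q ρ i v| ≤ C * size τ Q ρ) ∧
      (∀ i v, |displacement M i₀ Q ρ i v| ≤ C * size τ Q ρ) ∧
      (∀ y i v, |increment M i₀ Q ρ y i v| ≤ C * size τ Q ρ) := by
  obtain ⟨T, hT⟩ := (Set.finite_range τ).bddAbove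
  obtain ⟨κ, hκ⟩ := (Set.finite_range fun z : S × A => |M.k z.1 z.2|).bddAbove
  have hT' : ∀ i, τ i ≤ T := fun i => hT ⟨i, rfl⟩
  have hκ' : ∀ i v, |M.k i v| ≤ κ := fun i v => hκ ⟨(i, v), rfl⟩
  obtain ⟨a⟩ := ‹Nonempty S›
  obtain ⟨w⟩ := ‹Nonempty A›
  have hT1 : 1 ≤ T := (hτ a).trans (hT' a)
  have hκ0 : 0 ≤ κ := (abs_nonneg _).trans (hκ' a w)
  refine ⟨κ + 1 + 2 * T, by linarith, fun Q ρ => ?_⟩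
  have hN := tNorm_nonneg τ Q
  have hρ := abs_nonneg ρ
  have hs : size τ Q ρ = 1 + tNorm τ Q + |ρ| := rfl
  have hmin : ∀ j, |minAct Q j| ≤ T * tNorm τ Q := fun j =>
    (abs_minAct_le hτ Q j).trans (mul_le_mul_of_nonneg_right (hT' j) hN)
  have hQ : ∀ i v, |Q i v| ≤ T * tNorm τ Q := fun i v =>
    (abs_le_tNorm hτ Q i v).trans (mul_le_mul_of_nonneg_right (hT' i) hN)
  have hTN : 0 ≤ T * tNorm τ Q := mul_nonneg (by linarith) hN
  have hTρ : 0 ≤ T * |ρ| := mul_nonneg (by linarith) hρ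
  have hκN : 0 ≤ κ * tNorm τ Q := mul_nonneg hκ0 hN
  have hκρ : 0 ≤ κ * |ρ| := mul_nonneg hκ0 hρ
  have hmain : κ + |ρ| + 2 * (T * tNorm τ Q) ≤ (κ + 1 + 2 * T) * size τ Q ρ := by
    rw [hs]; nlinarith
  have hbell : ∀ i v, |bellman M i₀ Q ρ i v| ≤ κ + |ρ| + T * tNorm τ Q := by
    intro i v
    have h1 : |∑ j ∈ Finset.univ.filter (fun j => j ≠ i₀), M.p i v j * minAct Q j| ≤
        T * tNorm τ Q := by
      calc _ ≤ ∑ j ∈ Finset.univ.filter (fun j => j ≠ i₀), |M.p i v j * minAct Q j| :=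
            Finset.abs_sum_le_sum_abs _ _
        _ ≤ ∑ j ∈ Finset.univ.filter (fun j => j ≠ i₀), M.p i v j * (T * tNorm τ Q) := by
            refine Finset.sum_le_sum fun j _ => ?_
            rw [abs_mul, abs_of_nonneg (M.p_nonneg i v j)]
            exact mul_le_mul_of_nonneg_left (hmin j) (M.p_nonneg i v j)
        _ ≤ 1 * (T * tNorm τ Q) := by
            rw [← Finset.sum_mul]
            exact mul_le_mul_of_nonneg_right (sum_taboo_le_one M i₀ i v) hTN
        _ = _ := one_mul _
    unfold bellman
    refine (abs_add_le _ _).trans ?_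
    linarith [abs_sub (M.k i v) ρ, hκ' i v]
  refine ⟨fun j => ?_, fun i v => ?_, fun i v => ?_, fun i v => ?_, fun y i v => ?_⟩
  · linarith [hmin j]
  · linarith [hQ i v]
  · linarith [hbell i v]
  · unfold displacement
    linarith [abs_sub (bellman M i₀ Q ρ i v) (Q i v), hbell i v, hQ i v]
  · have h1 : |(if y ≠ i₀ then (1 : ℝ) else 0) * minAct Q y| ≤ T * tNorm τ Q := by
      split_ifs
      · simpa using hmin y
      · simpa using hTN
    unfold increment
    have h2 := abs_sub (M.k i v + (if y ≠ i₀ then (1 : ℝ) else 0) * minAct Q y - Q i v) ρ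
    have h3 := abs_sub (M.k i v + (if y ≠ i₀ then (1 : ℝ) else 0) * minAct Q y) (Q i v)
    have h4 := abs_add_le (M.k i v) ((if y ≠ i₀ then (1 : ℝ) else 0) * minAct Q y)
    linarith [hκ' i v, hQ i v]

lemma abs_displacement_sub_le {Q Q' : S → A → ℝ} {ρ ρ' c : ℝ}
    (h : ∀ i v, |Q' i v - Q i v| ≤ c) (i : S) (v : A) :
    |displacement M i₀ Q' ρ' i v - displacement M i₀ Q ρ i v| ≤ 2 * c + |ρ' - ρ| := by
  have hc : 0 ≤ c := (abs_nonneg _).trans (h i v)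
  have h1 : displacement M i₀ Q' ρ' i v - displacement M i₀ Q ρ i v =
      ∑ j ∈ Finset.univ.filter (fun j => j ≠ i₀), M.p i v j * (minAct Q' j - minAct Q j) -
        (Q' i v - Q i v) - (ρ' - ρ) := by
    simp only [displacement, bellman, mul_sub, Finset.sum_sub_distrib]; ring
  have h2 : |∑ j ∈ Finset.univ.filter (fun j => j ≠ i₀),
      M.p i v j * (minAct Q' j - minAct Q j)| ≤ c := by
    calc _ ≤ ∑ j ∈ Finset.univ.filter (fun j => j ≠ i₀),
            |M.p i v j * (minAct Q' j - minAct Q j)| := Finset.abs_sum_le_sum_abs _ _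
      _ ≤ ∑ j ∈ Finset.univ.filter (fun j => j ≠ i₀), M.p i v j * c := by
          refine Finset.sum_le_sum fun j _ => ?_
          rw [abs_mul, abs_of_nonneg (M.p_nonneg i v j)]
          exact mul_le_mul_of_nonneg_left (abs_minAct_sub_le _ _ _ _ (h j)) (M.p_nonneg i v j)
      _ ≤ 1 * c := by
          rw [← Finset.sum_mul]
          exact mul_le_mul_of_nonneg_right (sum_taboo_le_one M i₀ i v) hc
      _ = c := one_mul c
  rw [h1]
  refine (abs_sub _ _).trans (add_le_add ((abs_sub _ _).trans ?_) le_rfl)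
  linarith [h i v]

/-- Averaged over the action and the next state, the first term of the noise equals the second, and
`V i y` averages to the kernel sum in the third. -/
lemma sum_noise_eq_zero (hΦsum : ∀ i, ∑ u, Φ i u = 1) (V : S → S → ℝ) (Q : S → A → ℝ) (ρ : ℝ)
    (x i : S) (v : A) :
    ∑ u, ∑ y, Φ x u * M.p x u y * noise M i₀ Φ V Q ρ x u y i v = 0 := by
  have h1 : ∀ u, ∑ y, M.p x u y * increment M i₀ Q ρ y i v =
      M.k i v - Q i v - ρ + ∑ j ∈ Finset.univ.filter (fun j => j ≠ i₀), M.p x u j * minAct Q j := by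
    intro u
    have : ∀ y, M.p x u y * increment M i₀ Q ρ y i v = M.p x u y * (M.k i v - Q i v - ρ) +
        if y ≠ i₀ then M.p x u y * minAct Q y else 0 := by
      intro y
      unfold increment
      split_ifs <;> ring
    simp_rw [this]
    rw [Finset.sum_add_distrib, ← Finset.sum_mul, M.p_sum, one_mul, Finset.sum_filter]
  have h2 : ∀ c : ℝ, ∑ u, ∑ y, Φ x u * M.p x u y * c = c := by
    intro c
    simp only [← Finset.sum_mul, ← Finset.mul_sum, M.p_sum, mul_one, hΦsum, one_mul]
  have h3 : ∑ u, ∑ y, Φ x u * M.p x u y * V i y = ∑ z, stateKernel M Φ x z * V i z := by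
    rw [Finset.sum_comm]
    simp only [stateKernel, Finset.sum_mul]
  have h4 : ∑ u, ∑ y, Φ x u * M.p x u y *
      ((if x = i ∧ u = v then 1 else 0) * increment M i₀ Q ρ y i v) =
      (if x = i then 1 else 0) * Φ i v * displacement M i₀ Q ρ i v := by
    rw [Finset.sum_eq_single v]
    · split_ifs with h h' h'
      · obtain rfl := h.1
        simp only [one_mul, mul_assoc, ← Finset.mul_sum, h1]
        unfold displacement bellman
        ring
      · exact absurd h.1 h'
      · exact absurd ⟨h', rfl⟩ h
      · simp
    · intro u _ hu
      simp [hu]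
    · simp
  have h5 : ∀ u y, Φ x u * M.p x u y * noise M i₀ Φ V Q ρ x u y i v =
      Φ x u * M.p x u y * ((if x = i ∧ u = v then 1 else 0) * increment M i₀ Q ρ y i v)
      - Φ x u * M.p x u y * ((if x = i then 1 else 0) * Φ i v * displacement M i₀ Q ρ i v)
      + Φ x u * M.p x u y * V i y * (Φ i v * displacement M i₀ Q ρ i v)
      - Φ x u * M.p x u y *
        (Φ i v * displacement M i₀ Q ρ i v * ∑ z, stateKernel M Φ x z * V i z) := by
    intro u y
    unfold noise
    ring
  simp_rw [h5, Finset.sum_sub_distrib, Finset.sum_add_distrib, Finset.sum_sub_distrib]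
  simp_rw [h2, h4, ← Finset.sum_mul, h3]
  ring

lemma exists_noise_bound (M : MDP S A) (i₀ : S) (hτ : ∀ i, 1 ≤ τ i) (Φ : S → A → ℝ)
    (V : S → S → ℝ) :
    ∃ C, 0 ≤ C ∧ ∀ (Q : S → A → ℝ) (ρ : ℝ) x u y i v,
      |noise M i₀ Φ V Q ρ x u y i v| ≤ C * size τ Q ρ := by
  obtain ⟨C, hC1, hC⟩ := exists_size_bounds M i₀ hτ
  obtain ⟨B, hB⟩ := (Set.finite_range fun z : S × A × S × S =>
    |Φ z.1 z.2.1| + |Φ z.1 z.2.1| * |V z.1 z.2.2.1 -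
      ∑ w, stateKernel M Φ z.2.2.2 w * V z.1 w|).bddAbove
  have hB' : ∀ i v y x, |Φ i v| + |Φ i v| * |V i y - ∑ w, stateKernel M Φ x w * V i w| ≤ B :=
    fun i v y x => hB ⟨(i, v, y, x), rfl⟩
  have hB0 : 0 ≤ B := by
    obtain ⟨a⟩ := ‹Nonempty S›
    obtain ⟨w⟩ := ‹Nonempty A›
    exact le_trans (by positivity) (hB' a w a a)
  refine ⟨C * (1 + B), by positivity, fun Q ρ x u y i v => ?_⟩
  obtain ⟨-, -, -, hd, hi⟩ := hC Q ρ
  have hs : 0 ≤ C * size τ Q ρ := by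
    have := one_le_size τ Q ρ
    positivity
  have h1 : |(if x = i ∧ u = v then (1 : ℝ) else 0) * increment M i₀ Q ρ y i v| ≤
      C * size τ Q ρ := by
    split_ifs
    · simpa using hi y i v
    · simpa using hs
  have h2 : |(if x = i then (1 : ℝ) else 0) * Φ i v * displacement M i₀ Q ρ i v| ≤
      |Φ i v| * (C * size τ Q ρ) := by
    split_ifs
    · rw [one_mul, abs_mul]
      exact mul_le_mul_of_nonneg_left (hd i v) (abs_nonneg _)
    · simpa using mul_nonneg (abs_nonneg (Φ i v)) hs
  have h3 : |Φ i v * displacement M i₀ Q ρ i v * (V i y - ∑ z, stateKernel M Φ x z * V i z)| ≤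
      |Φ i v| * |V i y - ∑ z, stateKernel M Φ x z * V i z| * (C * size τ Q ρ) := by
    rw [abs_mul, abs_mul, mul_right_comm]
    exact mul_le_mul_of_nonneg_left (hd i v) (by positivity)
  have h4 := mul_le_mul_of_nonneg_right (hB' i v y x) hs
  unfold noise
  refine (abs_add_le _ _).trans ?_
  have h5 := abs_sub ((if x = i ∧ u = v then (1 : ℝ) else 0) * increment M i₀ Q ρ y i v)
    ((if x = i then (1 : ℝ) else 0) * Φ i v * displacement M i₀ Q ρ i v)
  linarith

end Pathwise

/-! ### Recursion for the gap between `Q` and the averaged iterate. -/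

section Dynamics

variable {S A : Type*} [Fintype S] [Fintype A] [Nonempty S] [Nonempty A] [DecidableEq S]
  [DecidableEq A] {M : MDP S A} {i₀ : S} {τ : S → ℝ} {lam : ℝ} {Φ : S → A → ℝ}

lemma exists_step_bounds (M : MDP S A) (i₀ : S) (hτ : ∀ i, 1 ≤ τ i) (a₀ b₀ : ℝ) :
    ∃ C, 1 ≤ C ∧ ∀ {D x u Q ρ Y}, IsPath M i₀ D a₀ b₀ x u Q ρ Y → ∀ n,
      (∀ i v, |Q (n + 1) i v - Q n i v| ≤ C * (size τ (Q n) (ρ n) / ((n : ℝ) + 1))) ∧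
      |ρ (n + 1) - ρ n| ≤ C * (size τ (Q n) (ρ n) / ((n : ℝ) + 1)) ∧
      size τ (Q (n + 1)) (ρ (n + 1)) ≤ C * size τ (Q n) (ρ n) := by
  obtain ⟨C, hC1, hC⟩ := exists_size_bounds M i₀ hτ
  have hC0 : 0 ≤ C := by linarith
  refine ⟨1 + 2 * (C * (|a₀| + |b₀|)), by
    have : 0 ≤ C * (|a₀| + |b₀|) := by positivity
    linarith, fun {D x u Q ρ Y} hp n => ?_⟩
  obtain ⟨hmin, -, -, -, hinc⟩ := hC (Q n) (ρ n)
  have hs := one_le_size τ (Q n) (ρ n)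
  set s := size τ (Q n) (ρ n) with hsdef
  have hn : (0 : ℝ) < (n : ℝ) + 1 := by positivity
  have hsn : 0 ≤ s / ((n : ℝ) + 1) := by positivity
  have h1 : ∀ i v, |Q (n + 1) i v - Q n i v| ≤ C * |a₀| * (s / ((n : ℝ) + 1)) := by
    intro i v
    have h2 : Q (n + 1) i v - Q n i v = a₀ / ((n : ℝ) + 1) *
        ((if x n = i ∧ u n = v then 1 else 0) * increment M i₀ (Q n) (ρ n) (x (n + 1)) i v) := by
      rw [hp.Q_succ]; unfold increment; ring
    have h3 : |(if x n = i ∧ u n = v then (1 : ℝ) else 0) *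
        increment M i₀ (Q n) (ρ n) (x (n + 1)) i v| ≤ C * s := by
      split_ifs
      · simpa using hinc _ i v
      · rw [zero_mul, abs_zero]; positivity
    rw [h2, abs_mul, abs_div, abs_of_pos hn]
    calc _ ≤ |a₀| / ((n : ℝ) + 1) * (C * s) := mul_le_mul_of_nonneg_left h3 (by positivity)
      _ = _ := by ring
  have h4 : |ρ (n + 1) - ρ n| ≤ C * |b₀| * (s / ((n : ℝ) + 1)) := by
    rw [hp.ρ_succ, add_sub_cancel_left, abs_mul, abs_div, abs_of_pos hn]
    calc _ ≤ |b₀| / ((n : ℝ) + 1) * (C * s) := mul_le_mul_of_nonneg_left (hmin i₀) (by positivity)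
      _ = _ := by ring
  have ha : 0 ≤ C * |a₀| := by positivity
  have hb : 0 ≤ C * |b₀| := by positivity
  refine ⟨fun i v => (h1 i v).trans (mul_le_mul_of_nonneg_right (by linarith) hsn),
    h4.trans (mul_le_mul_of_nonneg_right (by linarith) hsn), ?_⟩
  have hdiv : s / ((n : ℝ) + 1) ≤ s := div_le_self (by linarith) (by
    have : (0 : ℝ) ≤ n := Nat.cast_nonneg n
    linarith)
  have h5 : tNorm τ (Q (n + 1)) ≤ tNorm τ (Q n) + C * |a₀| * s := by
    rw [tNorm_le_iff hτ]
    intro i v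
    have e1 := abs_le_tNorm hτ (Q n) i v
    have e2 := h1 i v
    have e3 : C * |a₀| * (s / ((n : ℝ) + 1)) ≤ C * |a₀| * s := mul_le_mul_of_nonneg_left hdiv ha
    have e4 : C * |a₀| * s ≤ τ i * (C * |a₀| * s) :=
      le_mul_of_one_le_left (by positivity) (hτ i)
    have e5 := abs_sub_abs_le_abs_sub (Q (n + 1) i v) (Q n i v)
    rw [mul_add]
    linarith
  have h6 : |ρ (n + 1)| ≤ |ρ n| + C * |b₀| * s := by
    have e3 : C * |b₀| * (s / ((n : ℝ) + 1)) ≤ C * |b₀| * s := mul_le_mul_of_nonneg_left hdiv hb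
    have e5 := abs_sub_abs_le_abs_sub (ρ (n + 1)) (ρ n)
    linarith
  have h7 : size τ (Q (n + 1)) (ρ (n + 1)) = 1 + tNorm τ (Q (n + 1)) + |ρ (n + 1)| := rfl
  have h8 : s = 1 + tNorm τ (Q n) + |ρ n| := rfl
  have h9 : 0 ≤ C * |a₀| * s := by positivity
  have h10 : 0 ≤ C * |b₀| * s := by positivity
  rw [h7]
  linarith

/-- A crude bound, with no control of `B` in `n`. It serves for integrability at each time and for
the finitely many times before the asymptotic estimates apply. -/
lemma exists_growth_bound (M : MDP S A) (i₀ : S) (hτ : ∀ i, 1 ≤ τ i) {D : S → A → ℝ}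
    (hD0 : ∀ i v, 0 ≤ D i v) (hD1 : ∀ i v, D i v ≤ 1) (a₀ b₀ : ℝ) (n : ℕ) :
    ∃ B, 0 ≤ B ∧ ∀ {x u Q ρ Y}, IsPath M i₀ D a₀ b₀ x u Q ρ Y →
      size τ (Q n) (ρ n) ≤ B * size τ (Q 0) (ρ 0) ∧
      ∀ i v, |Y n i v| ≤ B * size τ (Q 0) (ρ 0) := by
  obtain ⟨C, hC1, hC⟩ := exists_size_bounds M i₀ hτ
  obtain ⟨C', hC'1, hC'⟩ := exists_step_bounds M i₀ hτ a₀ b₀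
  induction n with
  | zero =>
    refine ⟨C, by linarith, fun {x u Q ρ Y} hp => ?_⟩
    have hs := one_le_size τ (Q 0) (ρ 0)
    refine ⟨by nlinarith, fun i v => ?_⟩
    rw [hp.Y_zero]
    exact (hC _ _).2.1 i v
  | succ n ih =>
    obtain ⟨B, hB0, hB⟩ := ih
    refine ⟨C' * B + (1 + |a₀|) * B + |a₀| * (C * B), by positivity, fun {x u Q ρ Y} hp => ?_⟩
    obtain ⟨h1, h2⟩ := hB hp
    have hs := one_le_size τ (Q 0) (ρ 0)
    set s := size τ (Q 0) (ρ 0)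
    have e1 : 0 ≤ C' * B * s := by positivity
    have e2 : 0 ≤ (1 + |a₀|) * B * s := by positivity
    have e3 : 0 ≤ |a₀| * (C * B) * s := by positivity
    constructor
    · have h3 := (hC' hp n).2.2
      have h4 : C' * size τ (Q n) (ρ n) ≤ C' * (B * s) :=
        mul_le_mul_of_nonneg_left h1 (by linarith)
      linarith
    · intro i v
      rw [hp.Y_succ]
      have hn : (1 : ℝ) ≤ (n : ℝ) + 1 := by
        have : (0 : ℝ) ≤ n := Nat.cast_nonneg n
        linarith
      have ha : |a₀ / ((n : ℝ) + 1) * D i v| ≤ |a₀| := by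
        rw [abs_mul, abs_div, abs_of_pos (by linarith : (0 : ℝ) < (n : ℝ) + 1),
          abs_of_nonneg (hD0 i v)]
        calc _ ≤ |a₀| * 1 := mul_le_mul (div_le_self (abs_nonneg _) hn) (hD1 i v) (hD0 i v)
              (abs_nonneg _)
          _ = _ := mul_one _
      have h5 : |1 - a₀ / ((n : ℝ) + 1) * D i v| ≤ 1 + |a₀| := by
        have := abs_sub 1 (a₀ / ((n : ℝ) + 1) * D i v)
        rw [abs_one] at this
        linarith
      have h6 : |(1 - a₀ / ((n : ℝ) + 1) * D i v) * Y n i v| ≤ (1 + |a₀|) * (B * s) := by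
        rw [abs_mul]
        exact mul_le_mul h5 (h2 i v) (abs_nonneg _) (by positivity)
      have h7 : |bellman M i₀ (Q n) (ρ n) i v| ≤ C * (B * s) :=
        ((hC _ _).2.2.1 i v).trans (mul_le_mul_of_nonneg_left h1 (by linarith))
      have h8 : |a₀ / ((n : ℝ) + 1) * D i v * bellman M i₀ (Q n) (ρ n) i v| ≤
          |a₀| * (C * (B * s)) := by
        rw [abs_mul]
        exact mul_le_mul ha h7 (abs_nonneg _) (abs_nonneg _)
      refine (abs_add_le _ _).trans ?_
      linarith

/-- The difference between the iterate and the averaged iterate, corrected by the telescoping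
term of the Poisson equation. -/
noncomputable def correctedError (M : MDP S A) (i₀ : S) (Φ : S → A → ℝ) (V : S → S → ℝ) (a₀ : ℝ) (n : ℕ)
    (Q : S → A → ℝ) (ρ : ℝ) (Y : S → A → ℝ) (x : S) (i : S) (v : A) : ℝ :=
  Q i v - Y i v + a₀ / ((n : ℝ) + 1) * (Φ i v * displacement M i₀ Q ρ i v * V i x)

lemma exists_correction_bound (M : MDP S A) (i₀ : S) (hτ : ∀ i, 1 ≤ τ i) (Φ : S → A → ℝ)
    (V : S → S → ℝ) (a₀ : ℝ) :
    ∃ C, 0 ≤ C ∧ ∀ (n : ℕ) (Q : S → A → ℝ) (ρ : ℝ) x i v,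
      |a₀ / ((n : ℝ) + 1) * (Φ i v * displacement M i₀ Q ρ i v * V i x)| ≤
        C * (size τ Q ρ / ((n : ℝ) + 1)) := by
  obtain ⟨C, hC1, hC⟩ := exists_size_bounds M i₀ hτ
  obtain ⟨B, hB⟩ := (Set.finite_range fun z : S × A × S => |Φ z.1 z.2.1 * V z.1 z.2.2|).bddAbove
  have hB' : ∀ i v y, |Φ i v * V i y| ≤ B := fun i v y => hB ⟨(i, v, y), rfl⟩
  have hB0 : 0 ≤ B := by
    obtain ⟨a⟩ := ‹Nonempty S›
    obtain ⟨w⟩ := ‹Nonempty A›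
    exact (abs_nonneg _).trans (hB' a w a)
  refine ⟨|a₀| * B * C, by positivity, fun n Q ρ x i v => ?_⟩
  have hn : (0 : ℝ) < (n : ℝ) + 1 := by positivity
  have h1 : a₀ / ((n : ℝ) + 1) * (Φ i v * displacement M i₀ Q ρ i v * V i x) =
      a₀ / ((n : ℝ) + 1) * ((Φ i v * V i x) * displacement M i₀ Q ρ i v) := by ring
  rw [h1, abs_mul, abs_mul, abs_div, abs_of_pos hn]
  calc _ ≤ |a₀| / ((n : ℝ) + 1) * (B * (C * size τ Q ρ)) := by
        refine mul_le_mul_of_nonneg_left ?_ (by positivity)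
        exact mul_le_mul (hB' i v x) ((hC Q ρ).2.2.2.1 i v) (abs_nonneg _) hB0
    _ = _ := by ring

/-- The corrected error is a contraction driven by martingale noise and a second-order
remainder. -/
lemma exists_correctedError_succ (M : MDP S A) (i₀ : S) (hτ : ∀ i, 1 ≤ τ i) {Φ : S → A → ℝ}
    {V : S → S → ℝ} {d : S → ℝ}
    (hV : ∀ i x, (if x = i then 1 else 0) = d i + V i x - ∑ y, stateKernel M Φ x y * V i y)
    (hD0 : ∀ i v, 0 ≤ Φ i v * d i) (hD1 : ∀ i v, Φ i v * d i ≤ 1) (a₀ b₀ : ℝ) :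
    ∃ C, 0 ≤ C ∧ ∀ {x u Q ρ Y}, IsPath M i₀ (fun i v => Φ i v * d i) a₀ b₀ x u Q ρ Y → ∀ n i v,
      |correctedError M i₀ Φ V a₀ (n + 1) (Q (n + 1)) (ρ (n + 1)) (Y (n + 1)) (x (n + 1)) i v
        - (1 - a₀ / ((n : ℝ) + 1) * (Φ i v * d i)) *
          correctedError M i₀ Φ V a₀ n (Q n) (ρ n) (Y n) (x n) i v
        - a₀ / ((n : ℝ) + 1) * noise M i₀ Φ V (Q n) (ρ n) (x n) (u n) (x (n + 1)) i v| ≤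
      C * (size τ (Q n) (ρ n) / ((n : ℝ) + 1) ^ 2) := by
  obtain ⟨C, hC1, hC⟩ := exists_size_bounds M i₀ hτ
  obtain ⟨C₁, hC₁1, hC₁⟩ := exists_step_bounds M i₀ hτ a₀ b₀
  obtain ⟨C₂, hC₂0, hC₂⟩ := exists_correction_bound M i₀ hτ Φ V a₀
  obtain ⟨B, hB⟩ := (Set.finite_range fun z : S × A × S => |Φ z.1 z.2.1 * V z.1 z.2.2|).bddAbove
  have hB' : ∀ i v y, |Φ i v * V i y| ≤ B := fun i v y => hB ⟨(i, v, y), rfl⟩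
  have hB0 : 0 ≤ B := by
    obtain ⟨a⟩ := ‹Nonempty S›
    obtain ⟨w⟩ := ‹Nonempty A›
    exact (abs_nonneg _).trans (hB' a w a)
  refine ⟨|a₀| * C₂ + B * (|a₀| * (3 * C₁) + |a₀| * C), by positivity,
    fun {x u Q ρ Y} hp n i v => ?_⟩
  have hn : (0 : ℝ) < (n : ℝ) + 1 := by positivity
  set s := size τ (Q n) (ρ n) with hsdef
  have hs : 1 ≤ s := one_le_size τ (Q n) (ρ n)
  set a := a₀ / ((n : ℝ) + 1) with ha
  set a' := a₀ / (((n + 1 : ℕ) : ℝ) + 1) with ha'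
  set h := displacement M i₀ (Q n) (ρ n) i v with hh
  set h' := displacement M i₀ (Q (n + 1)) (ρ (n + 1)) i v with hh'
  -- Exact identity. Writing the indicator of `x n = i` through the Poisson equation turns its
  -- deviation from `d i` into `V i (x n) - V i (x (n + 1))` plus noise. The correction absorbs this
  -- difference, and only the variation of the coefficient `a * h` and a product of two steps
  -- remain.
  have key : correctedError M i₀ Φ V a₀ (n + 1) (Q (n + 1)) (ρ (n + 1)) (Y (n + 1)) (x (n + 1)) i v
        - (1 - a * (Φ i v * d i)) * correctedError M i₀ Φ V a₀ n (Q n) (ρ n) (Y n) (x n) i v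
        - a * noise M i₀ Φ V (Q n) (ρ n) (x n) (u n) (x (n + 1)) i v =
      a * (Φ i v * d i) * (a * (Φ i v * h * V i (x n))) +
        (Φ i v * V i (x (n + 1))) * (a' * (h' - h) + (a' - a) * h) := by
    have hVx := hV i (x n)
    have hb : bellman M i₀ (Q n) (ρ n) i v = h + Q n i v := by
      rw [hh]; unfold displacement; ring
    unfold correctedError noise
    rw [← hh, ← hh', ← ha, ← ha', hp.Q_succ, hp.Y_succ, hb, hVx, ← ha]
    unfold increment
    ring
  rw [key]
  have habs : |a| = |a₀| / ((n : ℝ) + 1) := by rw [ha, abs_div, abs_of_pos hn]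
  have ha'le : |a'| ≤ |a₀| / ((n : ℝ) + 1) := by
    rw [ha', abs_div]
    push_cast
    rw [abs_of_pos (by positivity : (0 : ℝ) < (n : ℝ) + 1 + 1)]
    exact div_le_div_of_nonneg_left (abs_nonneg _) hn (by linarith)
  have hdiff : |a' - a| ≤ |a₀| / ((n : ℝ) + 1) ^ 2 := by
    have : a' - a = -(a₀ / (((n : ℝ) + 1) * ((n : ℝ) + 1 + 1))) := by
      rw [ha, ha']
      push_cast
      field_simp
      ring
    rw [this, abs_neg, abs_div, abs_of_pos (by positivity :
      (0 : ℝ) < ((n : ℝ) + 1) * ((n : ℝ) + 1 + 1))]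
    exact div_le_div_of_nonneg_left (abs_nonneg _) (by positivity) (by nlinarith)
  have hhd : |h' - h| ≤ 3 * (C₁ * (s / ((n : ℝ) + 1))) := by
    obtain ⟨e1, e2, -⟩ := hC₁ hp n
    have := abs_displacement_sub_le (M := M) (i₀ := i₀) (ρ := ρ n) (ρ' := ρ (n + 1)) e1 i v
    linarith
  have hhC : |h| ≤ C * s := (hC _ _).2.2.2.1 i v
  have t1 : |a * (Φ i v * d i) * (a * (Φ i v * h * V i (x n)))| ≤
      |a₀| / ((n : ℝ) + 1) * 1 * (C₂ * (s / ((n : ℝ) + 1))) := by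
    rw [abs_mul, abs_mul, habs, abs_of_nonneg (hD0 i v)]
    refine mul_le_mul ?_ (hC₂ n _ _ _ i v) (abs_nonneg _) (by positivity)
    exact mul_le_mul_of_nonneg_left (hD1 i v) (by positivity)
  have t2 : |a' * (h' - h) + (a' - a) * h| ≤
      |a₀| / ((n : ℝ) + 1) * (3 * (C₁ * (s / ((n : ℝ) + 1)))) +
        |a₀| / ((n : ℝ) + 1) ^ 2 * (C * s) := by
    refine (abs_add_le _ _).trans (add_le_add ?_ ?_)
    · rw [abs_mul]
      exact mul_le_mul ha'le hhd (abs_nonneg _) (by positivity)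
    · rw [abs_mul]
      exact mul_le_mul hdiff hhC (abs_nonneg _) (by positivity)
  calc _ ≤ |a₀| / ((n : ℝ) + 1) * 1 * (C₂ * (s / ((n : ℝ) + 1))) +
        B * (|a₀| / ((n : ℝ) + 1) * (3 * (C₁ * (s / ((n : ℝ) + 1)))) +
          |a₀| / ((n : ℝ) + 1) ^ 2 * (C * s)) := by
        refine (abs_add_le _ _).trans (add_le_add t1 ?_)
        rw [abs_mul]
        exact mul_le_mul (hB' i v _) t2 (abs_nonneg _) hB0
    _ = _ := by
        field_simp

/-- Young's inequality with parameter `t = a * D`: the factor `1 + t` on the main part is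
compensated by `(1 + t) * (1 - t) ≤ 1`, and the remainder pays `1 + 1/t ≤ 2/t`. The cross term is
kept exact because its expectation vanishes. -/
lemma sq_le_of_remainder {E' E ν r a D : ℝ} (ha : 0 < a) (hD : 0 < D) (haD : a * D ≤ 1)
    (h : |E' - (1 - a * D) * E - a * ν| ≤ r) :
    E' ^ 2 ≤ (1 - a * D) * E ^ 2 + 2 * a * (1 + a * D) * (1 - a * D) * (E * ν)
      + (2 * a ^ 2 * ν ^ 2 + 2 / (a * D) * r ^ 2) := by
  set t := a * D with ht
  have ht0 : 0 < t := mul_pos ha hD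
  set w := E' - (1 - t) * E - a * ν with hw
  have hE' : E' = ((1 - t) * E + a * ν) + w := by rw [hw]; ring
  have hw2 : w ^ 2 ≤ r ^ 2 := sq_le_sq' (by linarith [(abs_le.1 h).1]) (abs_le.1 h).2
  have h1 : E' ^ 2 ≤ (1 + t) * ((1 - t) * E + a * ν) ^ 2 + (1 + 1 / t) * w ^ 2 := by
    have : 0 ≤ t * (((1 - t) * E + a * ν) - w / t) ^ 2 := by positivity
    have e : t * (((1 - t) * E + a * ν) - w / t) ^ 2 =
        t * ((1 - t) * E + a * ν) ^ 2 - 2 * ((1 - t) * E + a * ν) * w + 1 / t * w ^ 2 := by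
      field_simp
      ring
    rw [hE']
    nlinarith
  have h2 : (1 + t) * ((1 - t) * E + a * ν) ^ 2 = (1 - t ^ 2) * (1 - t) * E ^ 2 +
      2 * a * (1 + t) * (1 - t) * (E * ν) + (1 + t) * (a ^ 2 * ν ^ 2) := by ring
  have h3 : (1 - t ^ 2) * (1 - t) * E ^ 2 ≤ (1 - t) * E ^ 2 := by
    have : 0 ≤ t ^ 2 * ((1 - t) * E ^ 2) :=
      mul_nonneg (sq_nonneg _) (mul_nonneg (by linarith) (sq_nonneg _))
    linarith
  have h4 : (1 + t) * (a ^ 2 * ν ^ 2) ≤ 2 * (a ^ 2 * ν ^ 2) :=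
    mul_le_mul_of_nonneg_right (by linarith) (by positivity)
  have h5 : (1 + 1 / t) * w ^ 2 ≤ 2 / t * r ^ 2 := by
    refine mul_le_mul ?_ hw2 (sq_nonneg _) (by positivity)
    have : 1 ≤ 1 / t := by rw [le_div_iff₀ ht0]; linarith
    have e : 2 / t = 1 / t + 1 / t := by ring
    linarith
  linarith

lemma exists_correctedError_sq_le (M : MDP S A) (i₀ : S) (hτ : ∀ i, 1 ≤ τ i) {Φ : S → A → ℝ}
    {V : S → S → ℝ} {d : S → ℝ}
    (hV : ∀ i x, (if x = i then 1 else 0) = d i + V i x - ∑ y, stateKernel M Φ x y * V i y)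
    (hD0 : ∀ i v, 0 < Φ i v * d i) (hD1 : ∀ i v, Φ i v * d i ≤ 1) {a₀ : ℝ} (ha₀ : 0 < a₀)
    (b₀ : ℝ) :
    ∃ C, 0 ≤ C ∧ ∀ {x u Q ρ Y}, IsPath M i₀ (fun i v => Φ i v * d i) a₀ b₀ x u Q ρ Y →
      ∀ n : ℕ, a₀ ≤ (n : ℝ) + 1 → ∀ i v,
      correctedError M i₀ Φ V a₀ (n + 1) (Q (n + 1)) (ρ (n + 1)) (Y (n + 1)) (x (n + 1)) i v ^ 2
        ≤ (1 - a₀ / ((n : ℝ) + 1) * (Φ i v * d i)) *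
          correctedError M i₀ Φ V a₀ n (Q n) (ρ n) (Y n) (x n) i v ^ 2
        + 2 * (a₀ / ((n : ℝ) + 1)) * (1 + a₀ / ((n : ℝ) + 1) * (Φ i v * d i)) *
          (1 - a₀ / ((n : ℝ) + 1) * (Φ i v * d i)) *
          (correctedError M i₀ Φ V a₀ n (Q n) (ρ n) (Y n) (x n) i v *
            noise M i₀ Φ V (Q n) (ρ n) (x n) (u n) (x (n + 1)) i v)
        + C * (size τ (Q n) (ρ n) ^ 2 / ((n : ℝ) + 1) ^ 2) := by
  obtain ⟨C₁, hC₁0, hC₁⟩ := exists_correctedError_succ M i₀ hτ hV (fun i v => (hD0 i v).le) hD1 a₀ b₀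
  obtain ⟨C₂, hC₂0, hC₂⟩ := exists_noise_bound M i₀ hτ Φ V
  obtain ⟨⟨i₁, v₁⟩, hmin⟩ := Finite.exists_min fun z : S × A => Φ z.1 z.2 * d z.1
  have hδ : 0 < Φ i₁ v₁ * d i₁ := hD0 i₁ v₁
  set δ := Φ i₁ v₁ * d i₁ with hδdef
  refine ⟨2 * a₀ ^ 2 * C₂ ^ 2 + 2 / (a₀ * δ) * C₁ ^ 2, by positivity,
    fun {x u Q ρ Y} hp n hn i v => ?_⟩
  have hn1 : (1 : ℝ) ≤ (n : ℝ) + 1 := by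
    have : (0 : ℝ) ≤ n := Nat.cast_nonneg n
    linarith
  have hn0 : (0 : ℝ) < (n : ℝ) + 1 := by linarith
  have ha : 0 < a₀ / ((n : ℝ) + 1) := by positivity
  have ha1 : a₀ / ((n : ℝ) + 1) ≤ 1 := by rw [div_le_one hn0]; exact hn
  have h1 := sq_le_of_remainder ha (hD0 i v)
    (mul_le_one₀ ha1 (hD0 i v).le (hD1 i v)) (hC₁ hp n i v)
  refine h1.trans (add_le_add le_rfl ?_)
  set s := size τ (Q n) (ρ n) with hsdef
  have hs : 1 ≤ s := one_le_size τ (Q n) (ρ n)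
  have h2 : noise M i₀ Φ V (Q n) (ρ n) (x n) (u n) (x (n + 1)) i v ^ 2 ≤ (C₂ * s) ^ 2 := by
    have := abs_le.1 (hC₂ (Q n) (ρ n) (x n) (u n) (x (n + 1)) i v)
    exact sq_le_sq' this.1 this.2
  -- The squared remainder has order `n⁻⁴` and is divided by a step of order `n⁻¹`; the resulting
  -- `n⁻³` is more than enough.
  have h3 : 2 / (a₀ / ((n : ℝ) + 1) * (Φ i v * d i)) * (C₁ * (s / ((n : ℝ) + 1) ^ 2)) ^ 2 ≤
      2 / (a₀ * δ) * C₁ ^ 2 * (s ^ 2 / ((n : ℝ) + 1) ^ 2) := by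
    have e1 : 2 / (a₀ / ((n : ℝ) + 1) * (Φ i v * d i)) ≤ 2 / (a₀ / ((n : ℝ) + 1) * δ) :=
      div_le_div_of_nonneg_left (by norm_num) (by positivity)
        (mul_le_mul_of_nonneg_left (hmin (i, v)) ha.le)
    calc _ ≤ 2 / (a₀ / ((n : ℝ) + 1) * δ) * (C₁ * (s / ((n : ℝ) + 1) ^ 2)) ^ 2 :=
          mul_le_mul_of_nonneg_right e1 (sq_nonneg _)
      _ = 2 / (a₀ * δ) * C₁ ^ 2 * (s ^ 2 / ((n : ℝ) + 1) ^ 2) * (1 / ((n : ℝ) + 1)) := by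
          field_simp
      _ ≤ 2 / (a₀ * δ) * C₁ ^ 2 * (s ^ 2 / ((n : ℝ) + 1) ^ 2) * 1 := by
          refine mul_le_mul_of_nonneg_left ?_ (by positivity)
          rw [div_le_one hn0]
          exact hn1
      _ = _ := mul_one _
  have h4 : 2 * (a₀ / ((n : ℝ) + 1)) ^ 2 *
      noise M i₀ Φ V (Q n) (ρ n) (x n) (u n) (x (n + 1)) i v ^ 2 ≤
      2 * a₀ ^ 2 * C₂ ^ 2 * (s ^ 2 / ((n : ℝ) + 1) ^ 2) := by
    calc _ ≤ 2 * (a₀ / ((n : ℝ) + 1)) ^ 2 * (C₂ * s) ^ 2 :=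
          mul_le_mul_of_nonneg_left h2 (by positivity)
      _ = _ := by field_simp
  rw [add_mul]
  exact add_le_add h4 h3

end Dynamics

/-! ### Lyapunov drift of the averaged iteration. -/

section Drift

variable {S A : Type*} [Fintype S] [Fintype A] [Nonempty S] [Nonempty A] [DecidableEq S]
  [DecidableEq A] {M : MDP S A} {i₀ : S} {τ : S → ℝ} {lam : ℝ} {Φ : S → A → ℝ}
  {qs : ℝ → S → A → ℝ} {ρs : ℝ}

/-- The Lyapunov function of the averaged iteration. -/
noncomputable def lyapunov (τ : S → ℝ) (qs : ℝ → S → A → ℝ) (ρs K : ℝ) (Y : S → A → ℝ) (ρ : ℝ) :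
    ℝ :=
  K * tNorm τ (fun i v => Y i v - qs ρ i v) + |ρ - ρs|

lemma lyapunov_nonneg {K : ℝ} (hK : 0 ≤ K) (Y : S → A → ℝ) (ρ : ℝ) :
    0 ≤ lyapunov τ qs ρs K Y ρ :=
  add_nonneg (mul_nonneg hK (tNorm_nonneg _ _)) (abs_nonneg _)

/-- Write `y = ‖Y - qs ρ‖` and `z = |ρ - ρs|`. A move of `ρ` displaces the target `qs ρ` by at most
`L` times as much. By `hKL` the part of this due to `z`, weighted by `K`, costs at most half of the
decay `θ z`. By `hθa` the decay `a δ` of `y` pays for the effect of `y` on `ρ` and on its own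
target. Both components keep the factor `1 - θ/2`. -/
lemma lyapunov_succ_le (hsol : IsSolution M i₀ τ lam qs ρs) {D : S → A → ℝ}
    (hD0 : ∀ i v, 0 ≤ D i v) (hD1 : ∀ i v, D i v ≤ 1) {δ K L : ℝ}
    (hδ : ∀ i v, δ ≤ D i v * (1 - lam)) (hL : L = 1 / (1 - lam)) (hK : 0 ≤ K)
    (hKL : K * (τ i₀ * L ^ 2) ≤ 1 / 2) {a θ : ℝ} (ha0 : 0 ≤ a) (ha1 : a ≤ 1) (hθ0 : 0 ≤ θ)
    (hθ1 : θ * (τ i₀ * L) ≤ 1) (hθa : θ * (K * (L * τ i₀) + τ i₀ + K / 2) ≤ K * (a * δ))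
    {Q Y Y' : S → A → ℝ} {ρ ρ' : ℝ}
    (hY : ∀ i v, Y' i v = (1 - a * D i v) * Y i v + a * D i v * bellman M i₀ Q ρ i v)
    (hρ : ρ' = ρ + θ * minAct Q i₀) :
    lyapunov τ qs ρs K Y' ρ' ≤ (1 - θ / 2) * lyapunov τ qs ρs K Y ρ +
      (K * (a + L * θ * τ i₀) + θ * τ i₀) * tNorm τ (fun i v => Q i v - Y i v) := by
  have hw := hsol.toIsContractingWeight
  have hlam : 0 < 1 - lam := by linarith [hw.lt_one]
  have hL0 : 0 ≤ L := by rw [hL]; positivity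
  have hτ0 : 1 ≤ τ i₀ := hw.one_le i₀
  unfold lyapunov
  set y := tNorm τ (fun i v => Y i v - qs ρ i v) with hy
  set y' := tNorm τ (fun i v => Y' i v - qs ρ' i v) with hy'
  set B := tNorm τ (fun i v => Q i v - Y i v) with hB
  have hy0 : 0 ≤ y := tNorm_nonneg _ _
  have hB0 : 0 ≤ B := tNorm_nonneg _ _
  have hQ : tNorm τ (fun i v => Q i v - qs ρ i v) ≤ B + y := tNorm_sub_le hw.one_le _ _ _
  have hQc : ∀ i v, |Q i v - qs ρ i v| ≤ τ i * (B + y) := (tNorm_le_iff hw.one_le).1 hQ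
  have h1 : tNorm τ (fun i v => Y' i v - qs ρ i v) ≤ (1 - a * δ) * y + a * B := by
    rw [tNorm_le_iff hw.one_le]
    intro i v
    have hτi : 0 ≤ τ i := by linarith [hw.one_le i]
    have hfix : bellman M i₀ (qs ρ) ρ i v = qs ρ i v := congrFun (congrFun (hsol.fixed ρ) i) v
    have e1 : Y' i v - qs ρ i v = (1 - a * D i v) * (Y i v - qs ρ i v) +
        a * D i v * (bellman M i₀ Q ρ i v - bellman M i₀ (qs ρ) ρ i v) := by
      rw [hY, hfix]; ring
    have haD0 : 0 ≤ a * D i v := mul_nonneg ha0 (hD0 i v)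
    have haD1 : a * D i v ≤ 1 := mul_le_one₀ ha1 (hD0 i v) (hD1 i v)
    have e2 := abs_bellman_sub_le hw (add_nonneg hB0 hy0) hQc ρ i v
    have e3 : |Y i v - qs ρ i v| ≤ τ i * y :=
      abs_le_tNorm hw.one_le (fun i v => Y i v - qs ρ i v) i v
    calc |Y' i v - qs ρ i v| ≤ (1 - a * D i v) * (τ i * y) +
          a * D i v * (τ i * (lam * (B + y))) := by
          rw [e1]
          refine (abs_add_le _ _).trans (add_le_add ?_ ?_)
          · rw [abs_mul, abs_of_nonneg (by linarith : 0 ≤ 1 - a * D i v)]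
            exact mul_le_mul_of_nonneg_left e3 (by linarith)
          · rw [abs_mul, abs_of_nonneg haD0]
            exact mul_le_mul_of_nonneg_left e2 haD0
      _ = τ i * ((1 - a * (D i v * (1 - lam))) * y + a * (D i v * lam) * B) := by ring
      _ ≤ τ i * ((1 - a * δ) * y + a * 1 * B) := by
          refine mul_le_mul_of_nonneg_left (add_le_add ?_ ?_) hτi
          · refine mul_le_mul_of_nonneg_right ?_ hy0
            linarith [mul_le_mul_of_nonneg_left (hδ i v) ha0]
          · refine mul_le_mul_of_nonneg_right (mul_le_mul_of_nonneg_left ?_ ha0) hB0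
            exact mul_le_one₀ (hD1 i v) hw.nonneg hw.lt_one.le
      _ = _ := by rw [mul_one]
  have h2 : |minAct Q i₀ - minAct (qs ρ) i₀| ≤ τ i₀ * (B + y) :=
    abs_minAct_sub_le _ _ _ _ (hQc i₀)
  have h3 : |minAct (qs ρ) i₀| ≤ τ i₀ * (L * |ρ - ρs|) := by
    have := abs_minAct_fixed_sub_le hw (hsol.fixed ρ) (hsol.fixed ρs) i₀
    rwa [hsol.minAct_eq_zero, sub_zero, ← hL] at this
  have h4 : |ρ' - ρ| ≤ θ * (τ i₀ * (B + y) + τ i₀ * (L * |ρ - ρs|)) := by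
    rw [hρ, add_sub_cancel_left, abs_mul, abs_of_nonneg hθ0]
    refine mul_le_mul_of_nonneg_left ?_ hθ0
    have := abs_add_le (minAct Q i₀ - minAct (qs ρ) i₀) (minAct (qs ρ) i₀)
    rw [sub_add_cancel] at this
    linarith
  have h5 : y' ≤ (1 - a * δ) * y + a * B +
      L * (θ * (τ i₀ * (B + y) + τ i₀ * (L * |ρ - ρs|))) := by
    have e1 := tNorm_sub_le hw.one_le Y' (qs ρ) (qs ρ')
    have e2 := tNorm_fixed_sub_le hw (hsol.fixed ρ) (hsol.fixed ρ')
    rw [← hL, abs_sub_comm] at e2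
    have e3 := mul_le_mul_of_nonneg_left h4 hL0
    linarith
  -- Slope at most `-1` gives the decay; the Lipschitz bound with `θ * τ i₀ * L ≤ 1` prevents
  -- overshooting `ρs`.
  have h6 : |ρ + θ * minAct (qs ρ) i₀ - ρs| ≤ (1 - θ) * |ρ - ρs| := by
    have hg := h3
    rcases le_total ρs ρ with hle | hle
    · have e1 := minAct_fixed_le hw (hsol.fixed ρs) (hsol.fixed ρ) hle i₀
      rw [hsol.minAct_eq_zero] at e1
      rw [abs_of_nonneg (sub_nonneg.2 hle)] at hg ⊢
      have e2 := (abs_le.1 hg).1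
      have e3 := mul_le_mul_of_nonneg_left e2 hθ0
      have e4 := mul_le_mul_of_nonneg_left e1 hθ0
      have e5 := mul_le_mul_of_nonneg_right hθ1 (sub_nonneg.2 hle)
      rw [abs_of_nonneg (by linarith)]
      linarith
    · have e1 := minAct_fixed_le hw (hsol.fixed ρ) (hsol.fixed ρs) hle i₀
      rw [hsol.minAct_eq_zero] at e1
      rw [abs_of_nonpos (sub_nonpos.2 hle)] at hg ⊢
      have e2 := (abs_le.1 hg).2
      have e3 := mul_le_mul_of_nonneg_left e2 hθ0
      have e4 := mul_le_mul_of_nonneg_left e1 hθ0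
      have e5 := mul_le_mul_of_nonneg_right hθ1 (sub_nonneg.2 hle)
      rw [abs_of_nonpos (by linarith)]
      linarith
  have h7 : |ρ' - ρs| ≤ (1 - θ) * |ρ - ρs| + θ * (τ i₀ * (B + y)) := by
    have e1 : ρ' - ρs = (ρ + θ * minAct (qs ρ) i₀ - ρs) +
        θ * (minAct Q i₀ - minAct (qs ρ) i₀) := by rw [hρ]; ring
    rw [e1]
    refine (abs_add_le _ _).trans (add_le_add h6 ?_)
    rw [abs_mul, abs_of_nonneg hθ0]
    exact mul_le_mul_of_nonneg_left h2 hθ0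
  have h8 := mul_le_mul_of_nonneg_left h5 hK
  have h9 := mul_le_mul_of_nonneg_right hθa hy0
  have h10 := mul_le_mul_of_nonneg_right hKL (mul_nonneg hθ0 (abs_nonneg (ρ - ρs)))
  linarith

/-- Convexity of the square, applied to `(1 - t) * H + t * (b / t)`. -/
lemma sq_add_le_of_contraction {x H b t : ℝ} (hx0 : 0 ≤ x) (ht0 : 0 < t) (ht1 : t ≤ 1)
    (h : x ≤ (1 - t) * H + b) : x ^ 2 ≤ (1 - t) * H ^ 2 + b ^ 2 / t := by
  have h1 : x ^ 2 ≤ ((1 - t) * H + b) ^ 2 := pow_le_pow_left₀ hx0 h 2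
  have h2 : (1 - t) * H ^ 2 + b ^ 2 / t - ((1 - t) * H + b) ^ 2 =
      t * (1 - t) * (H - b / t) ^ 2 := by
    field_simp
    ring
  have h3 : 0 ≤ t * (1 - t) * (H - b / t) ^ 2 :=
    mul_nonneg (mul_nonneg ht0.le (by linarith)) (sq_nonneg _)
  linarith

lemma exists_lyapunov_sq_le (hsol : IsSolution M i₀ τ lam qs ρs) {D : S → A → ℝ}
    (hD0 : ∀ i v, 0 ≤ D i v) (hD1 : ∀ i v, D i v ≤ 1) {δ K L : ℝ}
    (hδ : ∀ i v, δ ≤ D i v * (1 - lam)) (hL : L = 1 / (1 - lam)) (hK : 0 ≤ K)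
    (hKL : K * (τ i₀ * L ^ 2) ≤ 1 / 2) {a₀ b₀ : ℝ} (ha₀ : 0 < a₀) (hb₀ : 0 < b₀)
    (hab : b₀ * (K * (L * τ i₀) + τ i₀ + K / 2) ≤ K * (a₀ * δ)) :
    ∃ C, 0 ≤ C ∧ ∀ {x u Q ρ Y}, IsPath M i₀ D a₀ b₀ x u Q ρ Y →
      ∀ n : ℕ, a₀ ≤ (n : ℝ) + 1 → b₀ * (τ i₀ * L) ≤ (n : ℝ) + 1 → b₀ / 2 ≤ (n : ℝ) + 1 →
      lyapunov τ qs ρs K (Y (n + 1)) (ρ (n + 1)) ^ 2 ≤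
        (1 - b₀ / 2 / ((n : ℝ) + 1)) * lyapunov τ qs ρs K (Y n) (ρ n) ^ 2 +
        C * (tNorm τ (fun i v => Q n i v - Y n i v) ^ 2 / ((n : ℝ) + 1)) := by
  have hlam : 0 < 1 - lam := by linarith [hsol.lt_one]
  have hL0 : 0 ≤ L := by rw [hL]; positivity
  set c := K * (a₀ + L * b₀ * τ i₀) + b₀ * τ i₀ with hc
  refine ⟨c ^ 2 * (2 / b₀), by positivity, fun {x u Q ρ Y} hp n hn1 hn2 hn3 => ?_⟩
  have hn0 : (0 : ℝ) < (n : ℝ) + 1 := by positivity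
  have h1 := lyapunov_succ_le hsol hD0 hD1 hδ hL hK hKL (a := a₀ / ((n : ℝ) + 1))
    (θ := b₀ / ((n : ℝ) + 1)) (by positivity) (by rwa [div_le_one hn0]) (by positivity)
    (by rwa [div_mul_eq_mul_div, div_le_one hn0])
    (by
      have : K * (a₀ / ((n : ℝ) + 1) * δ) = K * (a₀ * δ) / ((n : ℝ) + 1) := by ring
      rw [this, div_mul_eq_mul_div]
      exact div_le_div_of_nonneg_right hab hn0.le)
    (fun i v => hp.Y_succ n i v) (hp.ρ_succ n)
  have h2 : (K * (a₀ / ((n : ℝ) + 1) + L * (b₀ / ((n : ℝ) + 1)) * τ i₀) +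
      b₀ / ((n : ℝ) + 1) * τ i₀) = c / ((n : ℝ) + 1) := by rw [hc]; ring
  have h3 : b₀ / ((n : ℝ) + 1) / 2 = b₀ / 2 / ((n : ℝ) + 1) := by ring
  rw [h2, h3] at h1
  have h4 := sq_add_le_of_contraction (lyapunov_nonneg hK _ _) (by positivity)
    (by rwa [div_le_one hn0]) h1
  refine h4.trans (le_of_eq ?_)
  congr 1
  field_simp

/-- The errors control the size of the iterate and its distance to the solution. The last clause is
the crude converse, used only at a fixed time. -/
lemma exists_size_le (hsol : IsSolution M i₀ τ lam qs ρs) {K : ℝ} (hK : 0 < K) :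
    ∃ C, 0 ≤ C ∧ ∀ (Q Y : S → A → ℝ) (ρ : ℝ),
      size τ Q ρ ≤ C * (1 + lyapunov τ qs ρs K Y ρ + tNorm τ (fun i v => Q i v - Y i v)) ∧
      tNorm τ (fun i v => Q i v - qs ρs i v) ≤
        C * (lyapunov τ qs ρs K Y ρ + tNorm τ (fun i v => Q i v - Y i v)) ∧
      |ρ - ρs| ≤ lyapunov τ qs ρs K Y ρ ∧
      ∀ B s, 0 ≤ B → 1 ≤ s → |ρ| ≤ s → (∀ i v, |Y i v| ≤ B * s) →
        lyapunov τ qs ρs K Y ρ ≤ C * (1 + B) * s := by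
  have hw := hsol.toIsContractingWeight
  have hτ := hw.one_le
  have hlam : 0 < 1 - lam := by linarith [hsol.lt_one]
  set L := 1 / (1 - lam) with hL
  have hL0 : 0 ≤ L := by positivity
  set N := tNorm τ (qs ρs) with hN
  have hN0 : 0 ≤ N := tNorm_nonneg _ _
  refine ⟨1 + |ρs| + N + 1 / K + L + K * (1 + N + L + L * |ρs|), by positivity, fun Q Y ρ => ?_⟩
  set y := tNorm τ (fun i v => Y i v - qs ρ i v) with hy
  set B := tNorm τ (fun i v => Q i v - Y i v) with hB
  have hy0 : 0 ≤ y := tNorm_nonneg _ _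
  have hB0 : 0 ≤ B := tNorm_nonneg _ _
  have hz0 := abs_nonneg (ρ - ρs)
  have hH : lyapunov τ qs ρs K Y ρ = K * y + |ρ - ρs| := rfl
  have hyH : y ≤ 1 / K * lyapunov τ qs ρs K Y ρ := by
    rw [one_div, ← div_eq_inv_mul, le_div_iff₀ hK, hH]
    linarith
  have hKy : 0 ≤ K * y := by positivity
  have hzH : |ρ - ρs| ≤ lyapunov τ qs ρs K Y ρ := by rw [hH]; linarith
  have hLz : L * |ρ - ρs| ≤ L * lyapunov τ qs ρs K Y ρ := mul_le_mul_of_nonneg_left hzH hL0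
  have hq : tNorm τ (fun i v => qs ρ i v - qs ρs i v) ≤ L * |ρ - ρs| :=
    tNorm_fixed_sub_le hw (hsol.fixed ρ) (hsol.fixed ρs)
  have hQq : tNorm τ (fun i v => Q i v - qs ρs i v) ≤ B + y + L * |ρ - ρs| := by
    have e1 := tNorm_sub_le hτ Q Y (qs ρs)
    have e2 := tNorm_sub_le hτ Y (qs ρ) (qs ρs)
    linarith
  have hzero : ∀ Z : S → A → ℝ, tNorm τ (fun i v => Z i v - (0 : S → A → ℝ) i v) = tNorm τ Z := by
    intro Z; simp
  have hQN : tNorm τ Q ≤ B + y + L * |ρ - ρs| + N := by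
    have e1 := tNorm_sub_le hτ Q (qs ρs) 0
    rw [hzero, hzero] at e1
    linarith
  have hρ : |ρ| ≤ |ρ - ρs| + |ρs| := by
    have := abs_add_le (ρ - ρs) ρs
    rwa [sub_add_cancel] at this
  set H := lyapunov τ qs ρs K Y ρ with hHdef
  have hH0 : 0 ≤ H := by rw [hH]; positivity
  set E := K * (1 + N + L + L * |ρs|) with hE
  have hE0 : 0 ≤ E := by positivity
  have hρs := abs_nonneg ρs
  have hK1 : 0 ≤ 1 / K := by positivity
  refine ⟨?_, ?_, hzH, fun b s hb0 hs hρsz hb => ?_⟩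
  · have h0 : size τ Q ρ = 1 + tNorm τ Q + |ρ| := rfl
    have h1 : size τ Q ρ ≤ (1 + |ρs| + N) + (1 / K + L + 1) * H + B := by rw [h0]; linarith
    have h2 : 0 ≤ (|ρs| + N + E) * H := by positivity
    have h3 : 0 ≤ (|ρs| + N + 1 / K + L + E) * B := by positivity
    have h4 : 0 ≤ 1 / K + L + E := by positivity
    linarith
  · have h2 : 0 ≤ (1 + |ρs| + N + E) * H := by positivity
    have h3 : 0 ≤ (|ρs| + N + 1 / K + L + E) * B := by positivity
    linarith
  · have hbs : 0 ≤ b * s := by positivity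
    have hYN : tNorm τ Y ≤ b * s := by
      rw [tNorm_le_iff hτ]
      intro i v
      exact (hb i v).trans (le_mul_of_one_le_left hbs (hτ i))
    have hzs : |ρ - ρs| ≤ s + |ρs| := (abs_sub _ _).trans (by linarith)
    have hyb : y ≤ b * s + N + L * (s + |ρs|) := by
      have e1 := tNorm_sub_le hτ Y 0 (qs ρ)
      have e2 := tNorm_sub_le hτ 0 (qs ρs) (qs ρ)
      rw [hzero] at e1
      have e3 := tNorm_fixed_sub_le hw (hsol.fixed ρs) (hsol.fixed ρ)
      rw [← hL, abs_sub_comm] at e3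
      have e4 := mul_le_mul_of_nonneg_left hzs hL0
      have e5 : tNorm τ (fun i v => (0 : S → A → ℝ) i v - qs ρs i v) = N := by
        simp only [Pi.zero_apply, zero_sub, hN, tNorm, wNorm, mul_neg, abs_neg]
      linarith
    have h1 : H ≤ K * (b * s + N + L * (s + |ρs|)) + s + |ρs| := by
      rw [hH]
      have := mul_le_mul_of_nonneg_left hyb hK.le
      linarith
    have h2 : K * (b * s + N + L * (s + |ρs|)) ≤ E * ((1 + b) * s) := by
      have e : E * ((1 + b) * s) - K * (b * s + N + L * (s + |ρs|)) =
          K * (s + N * (s - 1) + L * |ρs| * (s - 1) + (N + L + L * |ρs|) * (b * s)) := by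
        rw [hE]; ring
      have : 0 ≤ s - 1 := by linarith
      have : 0 ≤ K * (s + N * (s - 1) + L * |ρs| * (s - 1) + (N + L + L * |ρs|) * (b * s)) := by
        positivity
      linarith
    have h3 : s + |ρs| ≤ (1 + |ρs|) * ((1 + b) * s) := by
      have e : (1 + |ρs|) * ((1 + b) * s) - (s + |ρs|) =
          |ρs| * (s - 1) + (1 + |ρs|) * (b * s) := by ring
      have : 0 ≤ s - 1 := by linarith
      have : 0 ≤ |ρs| * (s - 1) + (1 + |ρs|) * (b * s) := by positivity
      linarith
    have h4 : 0 ≤ (N + 1 / K + L) * ((1 + b) * s) := by positivity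
    linarith

end Drift

/-! ### Scalar recursions with steps `1/n`. -/

/-- A coupled pair of scalar recursions with `1/n` steps decays like `1/n`. -/
lemma exists_rate {b g C : ℝ} (hb : 2 ≤ b) (hg : b < g) (hC : 0 ≤ C) (n₀ : ℕ) (B : ℕ → ℝ) :
    ∃ C', ∀ h e s : ℕ → ℝ, (∀ n, 0 ≤ h n) → (∀ n, 0 ≤ e n) → (∀ n, 0 ≤ s n) →
      (∀ n, h n ≤ B n ∧ e n ≤ B n ∧ s n ≤ B n) →
      (∀ n ≥ n₀, h (n + 1) ≤ (1 - b / ((n : ℝ) + 1)) * h n +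
        C * ((e n + s n / ((n : ℝ) + 1) ^ 2) / ((n : ℝ) + 1))) →
      (∀ n ≥ n₀, e (n + 1) ≤ (1 - g / ((n : ℝ) + 1)) * e n + C * (s n / ((n : ℝ) + 1) ^ 2)) →
      (∀ n ≥ n₀, s n ≤ C * (1 + h n + e n)) →
      ∀ n, h n + e n + s n / ((n : ℝ) + 1) ^ 2 ≤ C' / ((n : ℝ) + 1) := by
  -- Since `K * (g - b) ≥ C`, the faster decay of `K * e` absorbs the coupling `C * e / N` into `h`,
  -- and `h + K * e` satisfies a single recursion.
  set K := C / (g - b) + 1 with hK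
  have hgb : 0 < g - b := by linarith
  have hK1 : 1 ≤ K := by
    have : 0 ≤ C / (g - b) := by positivity
    linarith
  have hKC : C ≤ K * (g - b) := by
    have : C / (g - b) * (g - b) = C := div_mul_cancel₀ _ hgb.ne'
    rw [hK, add_mul, this]
    linarith
  set C₁ := (1 + K) * C * C with hC₁
  have hC₁0 : 0 ≤ C₁ := by positivity
  obtain ⟨n₁, hn₁⟩ := exists_nat_ge (max (n₀ : ℝ) (max 1 (2 * C₁)))
  have hn₁0 : n₀ ≤ n₁ := by exact_mod_cast (le_max_left _ _).trans hn₁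
  have hn₁1 : (1 : ℝ) ≤ n₁ := (le_max_left _ _).trans ((le_max_right _ _).trans hn₁)
  have hn₁2 : 2 * C₁ ≤ n₁ := (le_max_right _ _).trans ((le_max_right _ _).trans hn₁)
  -- The first entry absorbs the forcing `C₁ / N²` in the induction step; the second starts the
  -- induction at `n₁`.
  set G := max (2 * C₁) (((n₁ : ℝ) + 1) * ((1 + K) * B n₁)) with hG
  have hG0 : 0 ≤ G := le_trans (by positivity) (le_max_left _ _)
  have hs0 : 0 ≤ ∑ m ∈ Finset.range n₁, 3 * |B m| * ((n₁ : ℝ) + 1) :=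
    Finset.sum_nonneg fun m _ => by positivity
  -- The summands account for `h + e`, for the term in `s`, and for the finitely many `n < n₁`.
  refine ⟨G + C * (1 + G) + ∑ m ∈ Finset.range n₁, 3 * |B m| * ((n₁ : ℝ) + 1),
    fun h e s h0 e0 s0 hB h1 h2 h3 => ?_⟩
  have hZ : ∀ n ≥ n₁, h n + K * e n ≤ G / ((n : ℝ) + 1) := by
    intro n hn
    induction n, hn using Nat.le_induction with
    | base =>
      rw [le_div_iff₀ (by positivity)]
      refine le_trans ?_ (le_max_right _ _)
      rw [mul_comm]
      refine mul_le_mul_of_nonneg_left ?_ (by positivity)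
      have := mul_le_mul_of_nonneg_left (hB n₁).2.1 (by linarith : 0 ≤ K)
      linarith [(hB n₁).1]
    | succ n hn ih =>
      have hnn : (n₁ : ℝ) ≤ n := by exact_mod_cast hn
      have hN : (0 : ℝ) < (n : ℝ) + 1 := by positivity
      have e1 := h1 n (hn₁0.trans hn)
      have e2 := h2 n (hn₁0.trans hn)
      have e3 := h3 n (hn₁0.trans hn)
      set N := (n : ℝ) + 1 with hNdef
      set Z := h n + K * e n with hZdef
      have hZ0 : 0 ≤ Z := add_nonneg (h0 n) (mul_nonneg (by linarith) (e0 n))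
      have e4 : s n ≤ C * (1 + Z) := e3.trans (mul_le_mul_of_nonneg_left (by
        have := le_mul_of_one_le_left (e0 n) hK1
        linarith) hC)
      have e5 : C * (s n / N ^ 2 / N) ≤ C * (s n / N ^ 2) := by
        refine mul_le_mul_of_nonneg_left (div_le_self (by have := s0 n; positivity) ?_) hC
        linarith
      have e6 : C * (s n / N ^ 2) * (1 + K) ≤ C₁ * (1 + Z) / N ^ 2 := by
        calc _ = (1 + K) * C * s n / N ^ 2 := by ring
          _ ≤ (1 + K) * C * (C * (1 + Z)) / N ^ 2 := by gcongr
          _ = _ := by rw [hC₁]; ring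
      have e7 : h (n + 1) + K * e (n + 1) ≤ (1 - b / N) * Z + C₁ * (1 + Z) / N ^ 2 := by
        have t1 := mul_le_mul_of_nonneg_left e2 (by linarith : 0 ≤ K)
        have t2 : C * (e n / N) ≤ K * (g - b) * (e n / N) :=
          mul_le_mul_of_nonneg_right hKC (by have := e0 n; positivity)
        have t3 : C * ((e n + s n / N ^ 2) / N) = C * (e n / N) + C * (s n / N ^ 2 / N) := by ring
        have t4 : (1 - b / N) * Z = (1 - b / N) * h n + K * ((1 - g / N) * e n) +
            K * (g - b) * (e n / N) := by rw [hZdef]; ring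
        linarith
      -- The part of the noise proportional to `Z` uses up `1/2` of the decay coefficient `2`. The
      -- remaining `3/2` still exceeds `1`, as decay of order `1/n` requires.
      have e8 : C₁ * (1 + Z) / N ^ 2 ≤ C₁ / N ^ 2 + (1 / 2) / N * Z := by
        have : C₁ * (1 + Z) / N ^ 2 = C₁ / N ^ 2 + C₁ / N / N * Z := by field_simp
        rw [this]
        have t1 : C₁ / N ≤ 1 / 2 := by rw [div_le_iff₀ hN]; linarith
        have t2 : C₁ / N / N ≤ 1 / 2 / N := div_le_div_of_nonneg_right t1 hN.le
        linarith [mul_le_mul_of_nonneg_right t2 hZ0]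
      have e9 : (1 - b / N) * Z ≤ (1 - 2 / N) * Z := by
        refine mul_le_mul_of_nonneg_right ?_ hZ0
        linarith [div_le_div_of_nonneg_right hb hN.le]
      have e10 : h (n + 1) + K * e (n + 1) ≤ (1 - (3 / 2) / N) * Z + C₁ / N ^ 2 := by
        have : (1 - (3 / 2) / N) * Z = (1 - 2 / N) * Z + (1 / 2) / N * Z := by ring
        linarith
      have e11 : (1 - (3 / 2) / N) * Z ≤ (1 - (3 / 2) / N) * (G / N) := by
        refine mul_le_mul_of_nonneg_left ih ?_
        rw [sub_nonneg, div_le_one hN]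
        linarith
      have e12 : C₁ / N ^ 2 ≤ (G / 2) / N ^ 2 := by
        refine div_le_div_of_nonneg_right ?_ (by positivity)
        linarith [le_max_left (2 * C₁) (((n₁ : ℝ) + 1) * ((1 + K) * B n₁))]
      -- After division by `G` this is `(N - 1) * (N + 1) ≤ N²`.
      have e13 : (1 - (3 / 2) / N) * (G / N) + (G / 2) / N ^ 2 ≤ G / (N + 1) := by
        have t1 : (1 - (3 / 2) / N) * (G / N) + (G / 2) / N ^ 2 = G * ((N - 1) / N ^ 2) := by
          field_simp
          ring
        rw [t1, div_eq_mul_one_div G (N + 1)]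
        refine mul_le_mul_of_nonneg_left ?_ hG0
        rw [div_le_div_iff₀ (by positivity) (by positivity)]
        nlinarith
      push_cast
      rw [← hNdef]
      linarith
  intro n
  have hN : (0 : ℝ) < (n : ℝ) + 1 := by positivity
  have hN1 : (1 : ℝ) ≤ (n : ℝ) + 1 := by
    have : (0 : ℝ) ≤ n := Nat.cast_nonneg n
    linarith
  rw [le_div_iff₀ hN]
  rcases le_or_gt n₁ n with hn | hn
  · have e1 := hZ n hn
    have e2 : h n + e n ≤ G / ((n : ℝ) + 1) := by
      have := le_mul_of_one_le_left (e0 n) hK1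
      linarith
    have e3 : s n ≤ C * (1 + G) := by
      refine (h3 n (hn₁0.trans hn)).trans (mul_le_mul_of_nonneg_left ?_ hC)
      linarith [div_le_self hG0 hN1]
    have e4 : s n / ((n : ℝ) + 1) ^ 2 * ((n : ℝ) + 1) ≤ C * (1 + G) := by
      have : s n / ((n : ℝ) + 1) ^ 2 * ((n : ℝ) + 1) = s n / ((n : ℝ) + 1) := by field_simp
      rw [this]
      exact (div_le_self (s0 n) hN1).trans e3
    rw [le_div_iff₀ hN] at e2
    linarith [add_mul (h n + e n) (s n / ((n : ℝ) + 1) ^ 2) ((n : ℝ) + 1)]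
  · obtain ⟨b1, b2, b3⟩ := hB n
    have e1 : s n / ((n : ℝ) + 1) ^ 2 ≤ s n := div_le_self (s0 n) (one_le_pow₀ hN1)
    have e2 : h n + e n + s n / ((n : ℝ) + 1) ^ 2 ≤ 3 * |B n| := by
      linarith [le_abs_self (B n)]
    have e3 : 3 * |B n| * ((n : ℝ) + 1) ≤ 3 * |B n| * ((n₁ : ℝ) + 1) := by
      refine mul_le_mul_of_nonneg_left ?_ (by positivity)
      have : (n : ℝ) ≤ n₁ := by exact_mod_cast hn.le
      linarith
    have e4 := Finset.single_le_sum (f := fun m => 3 * |B m| * ((n₁ : ℝ) + 1))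
      (fun m _ => by positivity) (Finset.mem_range.2 hn)
    have e5 := mul_le_mul_of_nonneg_right e2 hN.le
    have e6 : 0 ≤ C * (1 + G) := by positivity
    linarith

/-! ### Quadratic comparison of the error quantities. -/

section Squares

variable {S A : Type*} [Fintype S] [Fintype A] [Nonempty S] [Nonempty A] [DecidableEq S]
  [DecidableEq A] {M : MDP S A} {i₀ : S} {τ : S → ℝ} {lam : ℝ} {Φ : S → A → ℝ}
  {V : S → S → ℝ} {qs : ℝ → S → A → ℝ} {ρs : ℝ}

/-- The sum of the squares of the components. -/
def sumSq (E : S → A → ℝ) : ℝ := ∑ i, ∑ v, E i v ^ 2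

lemma sq_le_sumSq (E : S → A → ℝ) (i : S) (v : A) : E i v ^ 2 ≤ sumSq E :=
  (Finset.single_le_sum (f := fun v => E i v ^ 2) (fun _ _ => sq_nonneg _)
    (Finset.mem_univ v)).trans
    (Finset.single_le_sum (f := fun i => ∑ v, E i v ^ 2)
      (fun _ _ => Finset.sum_nonneg fun _ _ => sq_nonneg _) (Finset.mem_univ i))

lemma sumSq_nonneg (E : S → A → ℝ) : 0 ≤ sumSq E :=
  Finset.sum_nonneg fun _ _ => Finset.sum_nonneg fun _ _ => sq_nonneg _

lemma tNorm_sq_le_sumSq (hτ : ∀ i, 1 ≤ τ i) (E : S → A → ℝ) : tNorm τ E ^ 2 ≤ sumSq E := by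
  have h : tNorm τ E ≤ √(sumSq E) := by
    rw [tNorm_le_iff hτ]
    intro i v
    exact (Real.abs_le_sqrt (sq_le_sumSq E i v)).trans
      (le_mul_of_one_le_left (Real.sqrt_nonneg _) (hτ i))
  calc _ ≤ √(sumSq E) ^ 2 := pow_le_pow_left₀ (tNorm_nonneg _ _) h 2
    _ = _ := Real.sq_sqrt (sumSq_nonneg E)

lemma sq_add_three_le (x y z : ℝ) : (x + y + z) ^ 2 ≤ 3 * (x ^ 2 + y ^ 2 + z ^ 2) := by
  nlinarith [sq_nonneg (x - y), sq_nonneg (x - z), sq_nonneg (y - z)]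

/-- The third bound closes the system of recursions. The size is bounded by the errors plus a
correction of order `size / n`, which is absorbed into the left side once `n ≥ n₀`. -/
lemma exists_sq_bounds (hsol : IsSolution M i₀ τ lam qs ρs) (Φ : S → A → ℝ) (V : S → S → ℝ)
    (a₀ : ℝ) {K : ℝ} (hK : 0 < K) :
    ∃ (C : ℝ) (n₀ : ℕ), 0 ≤ C ∧ ∀ (n : ℕ) (Q Y : S → A → ℝ) (ρ : ℝ) (x : S),
      tNorm τ (fun i v => Q i v - Y i v) ^ 2 ≤
        C * (sumSq (correctedError M i₀ Φ V a₀ n Q ρ Y x) + size τ Q ρ ^ 2 / ((n : ℝ) + 1) ^ 2) ∧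
      tNorm τ (fun i v => Q i v - qs ρs i v) ^ 2 ≤ C * (lyapunov τ qs ρs K Y ρ ^ 2 +
        sumSq (correctedError M i₀ Φ V a₀ n Q ρ Y x) + size τ Q ρ ^ 2 / ((n : ℝ) + 1) ^ 2) ∧
      (n₀ ≤ n → size τ Q ρ ^ 2 ≤ C * (1 + lyapunov τ qs ρs K Y ρ ^ 2 +
        sumSq (correctedError M i₀ Φ V a₀ n Q ρ Y x))) := by
  have hτ := hsol.one_le
  obtain ⟨C₁, hC₁0, hC₁⟩ := exists_size_le hsol hK
  obtain ⟨C₂, hC₂0, hC₂⟩ := exists_correction_bound M i₀ hτ Φ V a₀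
  obtain ⟨n₀, hn₀⟩ := exists_nat_ge (2 * (C₁ * C₂))
  set c := 2 + 2 * C₂ ^ 2 with hc
  have hc0 : 0 ≤ c := by positivity
  refine ⟨c + (2 * C₁ ^ 2 + 2 * C₁ ^ 2 * c) + 12 * C₁ ^ 2, n₀, by positivity,
    fun n Q Y ρ x => ?_⟩
  have hN : (0 : ℝ) < (n : ℝ) + 1 := by positivity
  set E := correctedError M i₀ Φ V a₀ n Q ρ Y x with hE
  set s := size τ Q ρ with hs
  have hs1 : 1 ≤ s := one_le_size τ Q ρ
  obtain ⟨h1, h2, -, -⟩ := hC₁ Q Y ρ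
  set H := lyapunov τ qs ρs K Y ρ with hH
  have hH0 : 0 ≤ H := lyapunov_nonneg hK.le Y ρ
  set B := tNorm τ (fun i v => Q i v - Y i v) with hB
  have hB0 : 0 ≤ B := tNorm_nonneg _ _
  set t := tNorm τ E with ht
  have ht0 : 0 ≤ t := tNorm_nonneg _ _
  have ht2 : t ^ 2 ≤ sumSq E := tNorm_sq_le_sumSq hτ E
  have he0 : 0 ≤ sumSq E := sumSq_nonneg E
  have hsN : 0 ≤ C₂ * (s / ((n : ℝ) + 1)) := by positivity
  have hBt : B ≤ t + C₂ * (s / ((n : ℝ) + 1)) := by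
    rw [hB, tNorm_le_iff hτ]
    intro i v
    have e1 : Q i v - Y i v =
        E i v - a₀ / ((n : ℝ) + 1) * (Φ i v * displacement M i₀ Q ρ i v * V i x) := by
      rw [hE]; unfold correctedError; ring
    have e2 := hC₂ n Q ρ x i v
    have e3 := abs_le_tNorm hτ E i v
    have e4 : C₂ * (s / ((n : ℝ) + 1)) ≤ τ i * (C₂ * (s / ((n : ℝ) + 1))) :=
      le_mul_of_one_le_left hsN (hτ i)
    rw [e1]
    refine (abs_sub _ _).trans ?_
    rw [mul_add]
    linarith
  have hB2 : B ^ 2 ≤ c * (sumSq E + s ^ 2 / ((n : ℝ) + 1) ^ 2) := by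
    have e1 : B ^ 2 ≤ (t + C₂ * (s / ((n : ℝ) + 1))) ^ 2 := pow_le_pow_left₀ hB0 hBt 2
    have e2 : (C₂ * (s / ((n : ℝ) + 1))) ^ 2 = C₂ ^ 2 * (s ^ 2 / ((n : ℝ) + 1) ^ 2) := by
      rw [mul_pow, div_pow]
    have e3 : 0 ≤ s ^ 2 / ((n : ℝ) + 1) ^ 2 := by positivity
    have e4 : 0 ≤ C₂ ^ 2 * sumSq E := by positivity
    rw [hc]
    linarith [add_sq_le (a := t) (b := C₂ * (s / ((n : ℝ) + 1)))]
  have hr0 : 0 ≤ s ^ 2 / ((n : ℝ) + 1) ^ 2 := by positivity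
  refine ⟨hB2.trans (mul_le_mul_of_nonneg_right ?_ (by positivity)), ?_, fun hn => ?_⟩
  · have : 0 ≤ 2 * C₁ ^ 2 + 2 * C₁ ^ 2 * c + 12 * C₁ ^ 2 := by positivity
    linarith
  · have e1 := pow_le_pow_left₀ (tNorm_nonneg _ _) h2 2
    have e2 : (C₁ * (H + B)) ^ 2 ≤ 2 * C₁ ^ 2 * (H ^ 2 + B ^ 2) := by
      rw [mul_pow]
      have := mul_le_mul_of_nonneg_left (add_sq_le (a := H) (b := B)) (sq_nonneg C₁)
      linarith
    have e3 := mul_le_mul_of_nonneg_left hB2 (by positivity : 0 ≤ 2 * C₁ ^ 2)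
    have e4 : 0 ≤ (c + 2 * C₁ ^ 2 * c + 12 * C₁ ^ 2) * H ^ 2 := by positivity
    have e5 : 0 ≤ (c + 2 * C₁ ^ 2 + 12 * C₁ ^ 2) * (sumSq E + s ^ 2 / ((n : ℝ) + 1) ^ 2) := by
      positivity
    linarith
  · have e1 : s ≤ C₁ * (1 + H + t) + C₁ * C₂ / ((n : ℝ) + 1) * s := by
      have := mul_le_mul_of_nonneg_left hBt hC₁0
      have e : C₁ * C₂ / ((n : ℝ) + 1) * s = C₁ * (C₂ * (s / ((n : ℝ) + 1))) := by ring
      rw [e]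
      linarith
    have e2 : C₁ * C₂ / ((n : ℝ) + 1) ≤ 1 / 2 := by
      rw [div_le_iff₀ hN]
      have : (n₀ : ℝ) ≤ n := by exact_mod_cast hn
      linarith
    have e3 : s ≤ 2 * (C₁ * (1 + H + t)) := by
      have := mul_le_mul_of_nonneg_right e2 (by linarith : 0 ≤ s)
      linarith
    have e4 := pow_le_pow_left₀ (by linarith) e3 2
    have e5 := mul_le_mul_of_nonneg_left (sq_add_three_le 1 H t) (by positivity : 0 ≤ 4 * C₁ ^ 2)
    have e6 := mul_le_mul_of_nonneg_left ht2 (by positivity : 0 ≤ 12 * C₁ ^ 2)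
    have e7 : 0 ≤ (c + (2 * C₁ ^ 2 + 2 * C₁ ^ 2 * c)) * (1 + H ^ 2 + sumSq E) := by positivity
    linarith

lemma exists_initial_bounds (hsol : IsSolution M i₀ τ lam qs ρs) {D : S → A → ℝ}
    (hD0 : ∀ i v, 0 ≤ D i v) (hD1 : ∀ i v, D i v ≤ 1) (Φ : S → A → ℝ) (V : S → S → ℝ)
    (a₀ b₀ : ℝ) {K : ℝ} (hK : 0 < K) (n : ℕ) :
    ∃ B, 0 ≤ B ∧ ∀ {x u Q ρ Y}, IsPath M i₀ D a₀ b₀ x u Q ρ Y →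
      size τ (Q n) (ρ n) ≤ B * size τ (Q 0) (ρ 0) ∧
      lyapunov τ qs ρs K (Y n) (ρ n) ≤ B * size τ (Q 0) (ρ 0) ∧
      ∀ i v, |correctedError M i₀ Φ V a₀ n (Q n) (ρ n) (Y n) (x n) i v| ≤
        B * size τ (Q 0) (ρ 0) := by
  have hτ := hsol.one_le
  obtain ⟨C, hC1, hC⟩ := exists_size_bounds M i₀ hτ
  obtain ⟨C₁, hC₁0, hC₁⟩ := exists_size_le hsol hK
  obtain ⟨C₂, hC₂0, hC₂⟩ := exists_correction_bound M i₀ hτ Φ V a₀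
  obtain ⟨B, hB0, hB⟩ := exists_growth_bound M i₀ hτ hD0 hD1 a₀ b₀ n
  refine ⟨B + 2 * C₁ * (1 + B) + (C * B + B + C₂ * B), by positivity,
    fun {x u Q ρ Y} hp => ?_⟩
  obtain ⟨h1, h2⟩ := hB hp
  have hs0 := one_le_size τ (Q 0) (ρ 0)
  have hs := one_le_size τ (Q n) (ρ n)
  set s₀ := size τ (Q 0) (ρ 0)
  set s := size τ (Q n) (ρ n)
  have hN : (1 : ℝ) ≤ (n : ℝ) + 1 := by
    have : (0 : ℝ) ≤ n := Nat.cast_nonneg n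
    linarith
  have p1 : 0 ≤ B * s₀ := by positivity
  have p2 : 0 ≤ 2 * C₁ * (1 + B) * s₀ := by positivity
  have p4 : 0 ≤ (C * B + B + C₂ * B) * s₀ := by positivity
  refine ⟨by linarith, ?_, fun i v => ?_⟩
  · have hρ : |ρ n| ≤ (1 + B) * s₀ := by
      have : |ρ n| ≤ s := by
        have := tNorm_nonneg τ (Q n)
        simp only [s, size]
        linarith
      linarith
    have e1 := (hC₁ (Q n) (Y n) (ρ n)).2.2.2 1 ((1 + B) * s₀) zero_le_one (by nlinarith) hρ
      fun i v => by linarith [h2 i v]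
    linarith
  · have e1 := (hC (Q n) (ρ n)).2.1 i v
    have e2 := h2 i v
    have e3 := hC₂ n (Q n) (ρ n) (x n) i v
    have e4 : size τ (Q n) (ρ n) / ((n : ℝ) + 1) ≤ s := div_le_self (by linarith) hN
    have e5 : C₂ * (size τ (Q n) (ρ n) / ((n : ℝ) + 1)) ≤ C₂ * (B * s₀) :=
      mul_le_mul_of_nonneg_left (e4.trans h1) hC₂0
    have e6 : C * s ≤ C * (B * s₀) := mul_le_mul_of_nonneg_left h1 (by linarith)
    unfold correctedError
    refine (abs_add_le _ _).trans ?_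
    have e7 := abs_sub (Q n i v) (Y n i v)
    linarith

end Squares

/-! ### Measurability of the iterates. -/

section Measurability

variable {S A : Type*} [Fintype S] [Fintype A] [Nonempty S] [Nonempty A] [DecidableEq S]
  [DecidableEq A] [MeasurableSpace S] [MeasurableSingletonClass S] [MeasurableSpace A]
  [MeasurableSingletonClass A] {M : MDP S A} {i₀ : S} {τ : S → ℝ} {lam : ℝ} {Φ : S → A → ℝ}
  {V : S → S → ℝ} {qs : ℝ → S → A → ℝ} {ρs : ℝ} {Ω : Type*} {m : MeasurableSpace Ω}
  {Q Y : Ω → S → A → ℝ} {ρ : Ω → ℝ}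

lemma measurable_eval_finite {T : Type*} [Fintype T] [MeasurableSpace T]
    [MeasurableSingletonClass T] {Z : Ω → T} (hZ : Measurable Z) {f : T → Ω → ℝ}
    (hf : ∀ t, Measurable (f t)) : Measurable fun ω => f (Z ω) ω := by
  classical
  have h : (fun ω => f (Z ω) ω) = fun ω => ∑ t, (Z ⁻¹' {t}).indicator (f t) ω := by
    ext ω
    rw [Finset.sum_eq_single (Z ω)]
    · simp
    · intro t _ ht
      simp [ht.symm]
    · simp
  rw [h]
  exact Finset.measurable_sum _ fun t _ => (hf t).indicator (hZ (measurableSet_singleton t))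

lemma measurable_apply_apply (hQ : Measurable Q) (i : S) (v : A) : Measurable fun ω => Q ω i v :=
  (measurable_pi_apply v).comp ((measurable_pi_apply i).comp hQ)

lemma measurable_minAct (hQ : Measurable Q) (i : S) : Measurable fun ω => minAct (Q ω) i := by
  have h : Continuous fun Q : S → A → ℝ => minAct Q i := by
    unfold minAct
    exact Continuous.finset_inf'_apply _ fun v _ => by fun_prop
  exact h.measurable.comp hQ

lemma measurable_bellman (hQ : Measurable Q) (hρ : Measurable ρ) (i : S) (v : A) :
    Measurable fun ω => bellman M i₀ (Q ω) (ρ ω) i v := by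
  unfold bellman
  exact (measurable_const.sub hρ).add
    (Finset.measurable_sum _ fun j _ => (measurable_minAct hQ j).const_mul _)

lemma measurable_displacement (hQ : Measurable Q) (hρ : Measurable ρ) (i : S) (v : A) :
    Measurable fun ω => displacement M i₀ (Q ω) (ρ ω) i v :=
  (measurable_bellman hQ hρ i v).sub (measurable_apply_apply hQ i v)

lemma measurable_increment (hQ : Measurable Q) (hρ : Measurable ρ) (y i : S) (v : A) :
    Measurable fun ω => increment M i₀ (Q ω) (ρ ω) y i v :=
  ((measurable_const.add ((measurable_minAct hQ y).const_mul _)).sub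
    (measurable_apply_apply hQ i v)).sub hρ

lemma measurable_noise (hQ : Measurable Q) (hρ : Measurable ρ) {X : Ω → S} (hX : Measurable X)
    (u : A) (y i : S) (v : A) :
    Measurable fun ω => noise M i₀ Φ V (Q ω) (ρ ω) (X ω) u y i v := by
  refine measurable_eval_finite (f := fun x ω => noise M i₀ Φ V (Q ω) (ρ ω) x u y i v) hX
    fun x => ?_
  have hd := measurable_displacement (M := M) (i₀ := i₀) hQ hρ i v
  exact (((measurable_increment hQ hρ y i v).const_mul _).sub (hd.const_mul _)).add
    ((hd.const_mul _).mul_const _)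

lemma measurable_correctedError (hQ : Measurable Q) (hρ : Measurable ρ) (hY : Measurable Y)
    {X : Ω → S} (hX : Measurable X) (a₀ : ℝ) (n : ℕ) (i : S) (v : A) :
    Measurable fun ω => correctedError M i₀ Φ V a₀ n (Q ω) (ρ ω) (Y ω) (X ω) i v := by
  refine measurable_eval_finite
    (f := fun x ω => correctedError M i₀ Φ V a₀ n (Q ω) (ρ ω) (Y ω) x i v) hX fun x => ?_
  have hd := measurable_displacement (M := M) (i₀ := i₀) hQ hρ i v
  exact ((measurable_apply_apply hQ i v).sub (measurable_apply_apply hY i v)).add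
    (((hd.const_mul _).mul_const _).const_mul _)

lemma measurable_tNorm (hQ : Measurable Q) : Measurable fun ω => tNorm τ (Q ω) := by
  have h : Continuous fun Q : S → A → ℝ => tNorm τ Q := by
    unfold tNorm wNorm
    exact Continuous.finset_sup'_apply _ fun z _ => by fun_prop
  exact h.measurable.comp hQ

lemma measurable_size (hQ : Measurable Q) (hρ : Measurable ρ) :
    Measurable fun ω => size τ (Q ω) (ρ ω) :=
  (measurable_const.add (measurable_tNorm hQ)).add hρ.abs

lemma continuous_fixed (hsol : IsSolution M i₀ τ lam qs ρs) : Continuous qs := by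
  refine continuous_pi fun i => continuous_pi fun v => ?_
  have hlam : 0 < 1 - lam := by linarith [hsol.lt_one]
  refine (LipschitzWith.of_dist_le_mul (K := ⟨τ i * (1 / (1 - lam)), ?_⟩)
    fun ρ ρ' => ?_).continuous
  · exact mul_nonneg (by linarith [hsol.one_le i]) (one_div_nonneg.2 hlam.le)
  · have := (tNorm_le_iff hsol.one_le).1
      (tNorm_fixed_sub_le hsol.toIsContractingWeight (hsol.fixed ρ) (hsol.fixed ρ')) i v
    rw [← mul_assoc] at this
    exact this

lemma measurable_lyapunov (hsol : IsSolution M i₀ τ lam qs ρs) (K : ℝ) (hY : Measurable Y)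
    (hρ : Measurable ρ) : Measurable fun ω => lyapunov τ qs ρs K (Y ω) (ρ ω) := by
  have hq : Measurable fun ω => qs (ρ ω) := (continuous_fixed hsol).measurable.comp hρ
  refine (Measurable.const_mul (measurable_tNorm ?_) K).add (hρ.sub_const _).abs
  exact measurable_pi_iff.2 fun i => measurable_pi_iff.2 fun v =>
    (measurable_apply_apply hY i v).sub (measurable_apply_apply hq i v)

lemma measurable_iterate_succ {D : S → A → ℝ} {a b : ℝ} {X X' : Ω → S} {U : Ω → A}
    {Q' Y' : Ω → S → A → ℝ} {ρ' : Ω → ℝ} (hX : Measurable X) (hX' : Measurable X')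
    (hU : Measurable U) (hQ : Measurable Q) (hρ : Measurable ρ) (hY : Measurable Y)
    (hQ' : ∀ ω i v, Q' ω i v = Q ω i v + a * (if X ω = i ∧ U ω = v then 1 else 0) *
      (M.k i v + (if X' ω ≠ i₀ then 1 else 0) * minAct (Q ω) (X' ω) - Q ω i v - ρ ω))
    (hρ' : ∀ ω, ρ' ω = ρ ω + b * minAct (Q ω) i₀)
    (hY' : ∀ ω i v, Y' ω i v =
      (1 - a * D i v) * Y ω i v + a * D i v * bellman M i₀ (Q ω) (ρ ω) i v) :
    Measurable Q' ∧ Measurable ρ' ∧ Measurable Y' := by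
  refine ⟨measurable_pi_iff.2 fun i => measurable_pi_iff.2 fun v => ?_, ?_,
    measurable_pi_iff.2 fun i => measurable_pi_iff.2 fun v => ?_⟩
  · simp only [hQ']
    have h1 : Measurable fun ω => if X ω = i ∧ U ω = v then (1 : ℝ) else 0 :=
      (Measurable.of_discrete (f := fun z : S × A => if z.1 = i ∧ z.2 = v then (1 : ℝ) else 0)).comp
        (hX.prodMk hU)
    have h2 : Measurable fun ω => increment M i₀ (Q ω) (ρ ω) (X' ω) i v :=
      measurable_eval_finite (f := fun y ω => increment M i₀ (Q ω) (ρ ω) y i v) hX'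
        fun y => measurable_increment hQ hρ y i v
    exact (measurable_apply_apply hQ i v).add ((h1.const_mul _).mul h2)
  · have : ρ' = fun ω => ρ ω + b * minAct (Q ω) i₀ := funext hρ'
    rw [this]
    exact hρ.add ((measurable_minAct hQ i₀).const_mul _)
  · simp only [hY']
    exact ((measurable_apply_apply hY i v).const_mul _).add
      ((measurable_bellman hQ hρ i v).const_mul _)

lemma integrable_of_abs_le_mul {P : Measure Ω} {f g : Ω → ℝ} (hf : Integrable f P)
    (hg : Measurable g) {c : ℝ} (h : ∀ ω, |g ω| ≤ c * f ω) : Integrable g P :=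
  (hf.const_mul c).mono' hg.aestronglyMeasurable (ae_of_all _ h)

end Measurability

/-! ### Random trajectories and orthogonality of the noise. -/

section RandomTrajectories

variable {S A : Type*} [Fintype S] [Fintype A] [Nonempty S] [Nonempty A] [DecidableEq S]
  [DecidableEq A] [MeasurableSpace S] [MeasurableSpace A]

/-- The random trajectories of the algorithm, together with the averaged iterates. -/
structure IsProcess {Ω : Type*} {m0 mΩ : MeasurableSpace Ω} (M : MDP S A) (i₀ : S) (τ : S → ℝ) (Φ : S → A → ℝ) (d : S → ℝ) (a₀ b₀ : ℝ)
    (P : Measure Ω) (X : ℕ → Ω → S) (U : ℕ → Ω → A)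
    (Q : ℕ → Ω → S → A → ℝ) (ρ : ℕ → Ω → ℝ) (Y : ℕ → Ω → S → A → ℝ) : Prop where
  le : m0 ≤ mΩ
  chain : IsControlledChain M P m0 X U
  sampled : IsSampledBy Φ P m0 X U
  measurable_Q_zero : Measurable[m0] (Q 0)
  measurable_ρ_zero : Measurable[m0] (ρ 0)
  integrable_size_sq : Integrable (fun ω => size τ (Q 0 ω) (ρ 0 ω) ^ 2) P
  path : ∀ ω, IsPath M i₀ (fun i v => Φ i v * d i) a₀ b₀ (fun n => X n ω) (fun n => U n ω)
    (fun n => Q n ω) (fun n => ρ n ω) (fun n => Y n ω)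

end RandomTrajectories

section RandomTrajectories

variable {S A : Type*} [Fintype S] [Fintype A] [Nonempty S] [Nonempty A] [DecidableEq S]
  [DecidableEq A] [MeasurableSpace S] [MeasurableSingletonClass S] [MeasurableSpace A]
  [MeasurableSingletonClass A] {M : MDP S A} {i₀ : S} {τ : S → ℝ} {lam : ℝ} {Φ : S → A → ℝ}
  {V : S → S → ℝ} {d : S → ℝ} {qs : ℝ → S → A → ℝ} {ρs a₀ b₀ : ℝ} {Ω : Type*}
  {m0 mΩ : MeasurableSpace Ω} {P : Measure Ω} [IsProbabilityMeasure P]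
  {X : ℕ → Ω → S} {U : ℕ → Ω → A}

/-- Averaging over the next action and the next state. -/
lemma integral_action_next (hm0 : m0 ≤ mΩ) (hc : IsControlledChain M P m0 X U)
    (hs : IsSampledBy Φ P m0 X U) {n : ℕ} {B : A → S → Ω → ℝ}
    (hB : ∀ u y, Measurable[preHistory m0 X U n] (B u y)) (hBi : ∀ u y, Integrable (B u y) P) :
    ∫ ω, B (U n ω) (X (n + 1) ω) ω ∂P =
      ∫ ω, ∑ u, ∑ y, Φ (X n ω) u * M.p (X n ω) u y * B u y ω ∂P := by
  have hpost := postHistory_le hm0 hc.measurable_state hc.measurable_action n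
  have hpre : preHistory m0 X U n ≤ mΩ := (preHistory_le_postHistory n).trans hpost
  have hXpre : Measurable[preHistory m0 X U n] (X n) := measurable_state_preHistory n
  have hUset : ∀ u, MeasurableSet (U n ⁻¹' {u}) := fun u =>
    hc.measurable_action n (measurableSet_singleton u)
  have hXset : ∀ y, MeasurableSet (X (n + 1) ⁻¹' {y}) := fun y =>
    hc.measurable_state (n + 1) (measurableSet_singleton y)
  have hind : ∀ (s : Set Ω) (f : Ω → ℝ) ω,
      s.indicator (fun _ => (1 : ℝ)) ω * f ω = s.indicator f ω := by
    intro s f ω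
    by_cases h : ω ∈ s <;> simp [h]
  have hpB : ∀ (q : S → ℝ) u y, Measurable[preHistory m0 X U n] fun ω => q (X n ω) * B u y ω := by
    intro q u y
    exact Measurable.mul ((Measurable.of_discrete (f := q)).comp hXpre) (hB u y)
  have hqB : ∀ (q : S → ℝ) u y, Integrable (fun ω => q (X n ω) * B u y ω) P := by
    intro q u y
    obtain ⟨C, hC⟩ := (Set.finite_range fun t => ‖q t‖).bddAbove
    exact (hBi u y).bdd_mul
      ((Measurable.of_discrete (f := q)).comp (hc.measurable_state n)).aestronglyMeasurable
      (ae_of_all _ fun ω => hC ⟨X n ω, rfl⟩)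
  -- Conditioning on the history after the action averages out the next state; conditioning on the
  -- history before it averages out the action.
  have hterm : ∀ u y, ∫ ω, (X (n + 1) ⁻¹' {y}).indicator (fun _ => (1 : ℝ)) ω *
      (U n ⁻¹' {u}).indicator (B u y) ω ∂P =
      ∫ ω, Φ (X n ω) u * M.p (X n ω) u y * B u y ω ∂P := by
    intro u y
    rw [integral_indicator_mul_of_condProb hpost (hXset y) (hc.transition n y)
      (Measurable.indicator ((hB u y).mono (preHistory_le_postHistory n) le_rfl)
        (measurable_action_postHistory n (measurableSet_singleton u)))
      ((hBi u y).indicator (hUset u))]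
    have h1 : ∀ ω, M.p (X n ω) (U n ω) y * (U n ⁻¹' {u}).indicator (B u y) ω =
        (U n ⁻¹' {u}).indicator (fun _ => (1 : ℝ)) ω * (M.p (X n ω) u y * B u y ω) := by
      intro ω
      by_cases h : U n ω = u <;> simp [h]
    simp_rw [h1]
    rw [integral_indicator_mul_of_condProb hpre (hUset u) (hs n u)
      (hpB (fun x => M.p x u y) u y) (hqB (fun x => M.p x u y) u y)]
    simp only [mul_assoc]
  have hsum : ∀ ω, B (U n ω) (X (n + 1) ω) ω = ∑ u, ∑ y,
      (X (n + 1) ⁻¹' {y}).indicator (fun _ => (1 : ℝ)) ω *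
        (U n ⁻¹' {u}).indicator (B u y) ω := by
    intro ω
    rw [Finset.sum_eq_single (U n ω), Finset.sum_eq_single (X (n + 1) ω)]
    · simp
    · intro y _ hy
      simp [hy.symm]
    · simp
    · intro u _ hu
      simp [hu.symm]
    · simp
  have hi1 : ∀ u y, Integrable (fun ω => (X (n + 1) ⁻¹' {y}).indicator (fun _ => (1 : ℝ)) ω *
        (U n ⁻¹' {u}).indicator (B u y) ω) P := by
    intro u y
    simp_rw [hind]
    exact ((hBi u y).indicator (hUset u)).indicator (hXset y)
  have hi2 : ∀ u y, Integrable (fun ω => Φ (X n ω) u * M.p (X n ω) u y * B u y ω) P := fun u y =>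
    hqB (fun x => Φ x u * M.p x u y) u y
  simp_rw [hsum]
  rw [integral_finsetSum _ fun u _ => integrable_finsetSum _ fun y _ => hi1 u y,
    integral_finsetSum _ fun u _ => integrable_finsetSum _ fun y _ => hi2 u y]
  refine Finset.sum_congr rfl fun u _ => ?_
  rw [integral_finsetSum _ fun y _ => hi1 u y, integral_finsetSum _ fun y _ => hi2 u y]
  exact Finset.sum_congr rfl fun y _ => hterm u y

variable {Q Y : ℕ → Ω → S → A → ℝ} {ρ : ℕ → Ω → ℝ}

/-- The iterates at time `n` use the states up to `n` and the actions up to `n - 1`, so they are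
known before the noise at time `n` is drawn. -/
lemma IsProcess.measurable_preHistory (h : IsProcess (m0 := m0) M i₀ τ Φ d a₀ b₀ P X U Q ρ Y) (n : ℕ) :
    Measurable[preHistory m0 X U n] (Q n) ∧ Measurable[preHistory m0 X U n] (ρ n) ∧
      Measurable[preHistory m0 X U n] (Y n) := by
  induction n with
  | zero =>
    have hY : Y 0 = Q 0 := funext fun ω => (h.path ω).Y_zero
    rw [hY]
    have hQ := h.measurable_Q_zero.mono (le_preHistory_zero (m0 := m0) (X := X) (U := U)) le_rfl
    exact ⟨hQ, h.measurable_ρ_zero.mono le_preHistory_zero le_rfl, hQ⟩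
  | succ n ih =>
    have hle1 : postHistory m0 X U n ≤ preHistory m0 X U (n + 1) := postHistory_le_preHistory_succ n
    have hle : preHistory m0 X U n ≤ preHistory m0 X U (n + 1) :=
      (preHistory_le_postHistory n).trans hle1
    obtain ⟨hQ, hρ, hY⟩ := ih
    exact measurable_iterate_succ (m := preHistory m0 X U (n + 1)) (M := M) (i₀ := i₀)
      (D := fun i v => Φ i v * d i) (a := a₀ / ((n : ℝ) + 1)) (b := b₀ / ((n : ℝ) + 1))
      ((measurable_state_preHistory n).mono hle le_rfl) (measurable_state_preHistory (n + 1))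
      ((measurable_action_postHistory n).mono hle1 le_rfl) (hQ.mono hle le_rfl)
      (hρ.mono hle le_rfl) (hY.mono hle le_rfl) (fun ω => (h.path ω).Q_succ n)
      (fun ω => (h.path ω).ρ_succ n) (fun ω => (h.path ω).Y_succ n)

lemma IsProcess.preHistory_le (h : IsProcess (m0 := m0) M i₀ τ Φ d a₀ b₀ P X U Q ρ Y) (n : ℕ) :
    preHistory m0 X U n ≤ mΩ :=
  (preHistory_le_postHistory n).trans
    (postHistory_le h.le h.chain.measurable_state h.chain.measurable_action n)

/-- The corrected error is uncorrelated with the martingale noise. -/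
lemma IsProcess.integral_correctedError_mul_noise (hsol : IsSolution M i₀ τ lam qs ρs)
    (hΦsum : ∀ i, ∑ u, Φ i u = 1) (hD0 : ∀ i v, 0 ≤ Φ i v * d i) (hD1 : ∀ i v, Φ i v * d i ≤ 1)
    (V : S → S → ℝ) (h : IsProcess (m0 := m0) M i₀ τ Φ d a₀ b₀ P X U Q ρ Y) (n : ℕ) (i : S) (v : A) :
    Integrable (fun ω => correctedError M i₀ Φ V a₀ n (Q n ω) (ρ n ω) (Y n ω) (X n ω) i v *
        noise M i₀ Φ V (Q n ω) (ρ n ω) (X n ω) (U n ω) (X (n + 1) ω) i v) P ∧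
      ∫ ω, correctedError M i₀ Φ V a₀ n (Q n ω) (ρ n ω) (Y n ω) (X n ω) i v *
        noise M i₀ Φ V (Q n ω) (ρ n ω) (X n ω) (U n ω) (X (n + 1) ω) i v ∂P = 0 := by
  obtain ⟨hQ, hρ, hY⟩ := h.measurable_preHistory n
  have hle := h.preHistory_le n
  have hX : Measurable[preHistory m0 X U n] (X n) := measurable_state_preHistory n
  -- The weight `K = 1` is a dummy, since the Lyapunov bound is discarded here.
  obtain ⟨B, hB0, hB⟩ := exists_initial_bounds hsol hD0 hD1 Φ V a₀ b₀ one_pos n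
  obtain ⟨C, hC0, hC⟩ := exists_noise_bound M i₀ hsol.one_le Φ V
  let G : A → S → Ω → ℝ := fun u y ω =>
    correctedError M i₀ Φ V a₀ n (Q n ω) (ρ n ω) (Y n ω) (X n ω) i v *
      noise M i₀ Φ V (Q n ω) (ρ n ω) (X n ω) u y i v
  have hG : ∀ u y, Measurable[preHistory m0 X U n] (G u y) := fun u y =>
    Measurable.mul (measurable_correctedError (m := preHistory m0 X U n) hQ hρ hY hX a₀ n i v)
      (measurable_noise (m := preHistory m0 X U n) hQ hρ hX u y i v)
  have hbound : ∀ u y ω, |G u y ω| ≤ B * (C * B) * size τ (Q 0 ω) (ρ 0 ω) ^ 2 := by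
    intro u y ω
    obtain ⟨h1, -, h3⟩ := hB (h.path ω)
    have h4 := (hC (Q n ω) (ρ n ω) (X n ω) u y i v).trans (mul_le_mul_of_nonneg_left h1 hC0)
    have hs := one_le_size τ (Q 0 ω) (ρ 0 ω)
    simp only [G]
    rw [abs_mul]
    calc _ ≤ B * size τ (Q 0 ω) (ρ 0 ω) * (C * (B * size τ (Q 0 ω) (ρ 0 ω))) :=
          mul_le_mul (h3 i v) h4 (abs_nonneg _) (by positivity)
      _ = _ := by ring
  have hGi : ∀ u y, Integrable (G u y) P := fun u y =>
    integrable_of_abs_le_mul h.integrable_size_sq ((hG u y).mono hle le_rfl) (hbound u y)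
  constructor
  · have hm : Measurable fun ω => G (U n ω) (X (n + 1) ω) ω :=
      measurable_eval_finite (f := fun (z : A × S) ω => G z.1 z.2 ω)
        ((h.chain.measurable_action n).prodMk (h.chain.measurable_state (n + 1)))
        fun z => (hG z.1 z.2).mono hle le_rfl
    exact integrable_of_abs_le_mul h.integrable_size_sq hm fun ω => hbound _ _ ω
  · have h1 := integral_action_next h.le h.chain h.sampled hG hGi
    refine h1.trans ?_
    have h2 : ∀ ω, ∑ u, ∑ y, Φ (X n ω) u * M.p (X n ω) u y * G u y ω = 0 := by
      intro ω
      have h3 := sum_noise_eq_zero (M := M) (i₀ := i₀) hΦsum V (Q n ω) (ρ n ω) (X n ω) i v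
      have h4 : ∀ u y, Φ (X n ω) u * M.p (X n ω) u y * G u y ω =
          correctedError M i₀ Φ V a₀ n (Q n ω) (ρ n ω) (Y n ω) (X n ω) i v *
          (Φ (X n ω) u * M.p (X n ω) u y * noise M i₀ Φ V (Q n ω) (ρ n ω) (X n ω) u y i v) := by
        intro u y
        simp only [G]
        ring
      simp_rw [h4, ← Finset.mul_sum, h3, mul_zero]
    simp_rw [h2, integral_zero]

end RandomTrajectories

/-! ### Mean-square recursions and their rate. -/

section MeanSquare

variable {S A : Type*} [Fintype S] [Fintype A] [Nonempty S] [Nonempty A] [DecidableEq S]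
  [DecidableEq A] [MeasurableSpace S] [MeasurableSingletonClass S] [MeasurableSpace A]
  [MeasurableSingletonClass A] {M : MDP S A} {i₀ : S} {τ : S → ℝ} {lam : ℝ} {Φ : S → A → ℝ}
  {V : S → S → ℝ} {d : S → ℝ} {qs : ℝ → S → A → ℝ} {ρs a₀ b₀ : ℝ}

lemma integrable_sq_of_abs_le {Ω : Type*} {mΩ : MeasurableSpace Ω} {P : Measure Ω} {f g : Ω → ℝ}
    (hf : Integrable (fun ω => f ω ^ 2) P) (hg : Measurable g) {B : ℝ}
    (h : ∀ ω, |g ω| ≤ B * f ω) :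
    Integrable (fun ω => g ω ^ 2) P ∧ ∫ ω, g ω ^ 2 ∂P ≤ B ^ 2 * ∫ ω, f ω ^ 2 ∂P := by
  have h1 : ∀ ω, g ω ^ 2 ≤ B ^ 2 * f ω ^ 2 := fun ω => by
    rw [← mul_pow]
    exact sq_le_sq' (abs_le.1 (h ω)).1 (abs_le.1 (h ω)).2
  have h2 : Integrable (fun ω => g ω ^ 2) P := integrable_of_abs_le_mul hf (hg.pow_const 2)
    fun ω => by rw [abs_of_nonneg (sq_nonneg _)]; exact h1 ω
  refine ⟨h2, ?_⟩
  rw [← integral_const_mul]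
  exact integral_mono h2 (hf.const_mul _) h1

section

variable {Ω : Type*} {m0 mΩ : MeasurableSpace Ω} {P : Measure Ω} [IsProbabilityMeasure P]
  {X : ℕ → Ω → S} {U : ℕ → Ω → A} {Q Y : ℕ → Ω → S → A → ℝ} {ρ : ℕ → Ω → ℝ}

lemma IsProcess.moments (hsol : IsSolution M i₀ τ lam qs ρs)
    (h : IsProcess (m0 := m0) M i₀ τ Φ d a₀ b₀ P X U Q ρ Y) {K : ℝ} (hK : 0 ≤ K) {n : ℕ} {B : ℝ}
    (hB : ∀ {x u Q ρ Y}, IsPath M i₀ (fun i v => Φ i v * d i) a₀ b₀ x u Q ρ Y →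
      size τ (Q n) (ρ n) ≤ B * size τ (Q 0) (ρ 0) ∧
      lyapunov τ qs ρs K (Y n) (ρ n) ≤ B * size τ (Q 0) (ρ 0) ∧
      ∀ i v, |correctedError M i₀ Φ V a₀ n (Q n) (ρ n) (Y n) (x n) i v| ≤
        B * size τ (Q 0) (ρ 0)) :
    (Integrable (fun ω => lyapunov τ qs ρs K (Y n ω) (ρ n ω) ^ 2) P ∧
      ∫ ω, lyapunov τ qs ρs K (Y n ω) (ρ n ω) ^ 2 ∂P ≤
        B ^ 2 * ∫ ω, size τ (Q 0 ω) (ρ 0 ω) ^ 2 ∂P) ∧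
    (Integrable (fun ω => size τ (Q n ω) (ρ n ω) ^ 2) P ∧
      ∫ ω, size τ (Q n ω) (ρ n ω) ^ 2 ∂P ≤ B ^ 2 * ∫ ω, size τ (Q 0 ω) (ρ 0 ω) ^ 2 ∂P) ∧
    ∀ i v,
      Integrable (fun ω =>
        correctedError M i₀ Φ V a₀ n (Q n ω) (ρ n ω) (Y n ω) (X n ω) i v ^ 2) P ∧
      ∫ ω, correctedError M i₀ Φ V a₀ n (Q n ω) (ρ n ω) (Y n ω) (X n ω) i v ^ 2 ∂P ≤
        B ^ 2 * ∫ ω, size τ (Q 0 ω) (ρ 0 ω) ^ 2 ∂P := by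
  obtain ⟨hQ', hρ', hY'⟩ := h.measurable_preHistory n
  have hQ := hQ'.mono (h.preHistory_le n) le_rfl
  have hρ := hρ'.mono (h.preHistory_le n) le_rfl
  have hY := hY'.mono (h.preHistory_le n) le_rfl
  refine ⟨integrable_sq_of_abs_le h.integrable_size_sq (measurable_lyapunov hsol K hY hρ)
    fun ω => ?_, integrable_sq_of_abs_le h.integrable_size_sq (measurable_size hQ hρ)
    fun ω => ?_, fun i v => integrable_sq_of_abs_le h.integrable_size_sq
    (measurable_correctedError hQ hρ hY (h.chain.measurable_state n) a₀ n i v) fun ω => ?_⟩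
  · rw [abs_of_nonneg (lyapunov_nonneg hK _ _)]
    exact (hB (h.path ω)).2.1
  · rw [abs_of_nonneg (by linarith [one_le_size τ (Q n ω) (ρ n ω)])]
    exact (hB (h.path ω)).1
  · exact (hB (h.path ω)).2.2 i v

/-- The mean-square recursion of the corrected error. -/
lemma IsProcess.integral_sumSq_succ_le (hsol : IsSolution M i₀ τ lam qs ρs)
    (hΦsum : ∀ i, ∑ u, Φ i u = 1) (hD0 : ∀ i v, 0 < Φ i v * d i) (hD1 : ∀ i v, Φ i v * d i ≤ 1)
    (ha₀ : 0 < a₀) (h : IsProcess (m0 := m0) M i₀ τ Φ d a₀ b₀ P X U Q ρ Y) {δ C : ℝ}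
    (hδ : ∀ i v, δ ≤ Φ i v * d i) {n : ℕ}
    (hC : ∀ {x u Q ρ Y}, IsPath M i₀ (fun i v => Φ i v * d i) a₀ b₀ x u Q ρ Y → ∀ i v,
      correctedError M i₀ Φ V a₀ (n + 1) (Q (n + 1)) (ρ (n + 1)) (Y (n + 1)) (x (n + 1)) i v ^ 2
        ≤ (1 - a₀ / ((n : ℝ) + 1) * (Φ i v * d i)) *
          correctedError M i₀ Φ V a₀ n (Q n) (ρ n) (Y n) (x n) i v ^ 2
        + 2 * (a₀ / ((n : ℝ) + 1)) * (1 + a₀ / ((n : ℝ) + 1) * (Φ i v * d i)) *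
          (1 - a₀ / ((n : ℝ) + 1) * (Φ i v * d i)) *
          (correctedError M i₀ Φ V a₀ n (Q n) (ρ n) (Y n) (x n) i v *
            noise M i₀ Φ V (Q n) (ρ n) (x n) (u n) (x (n + 1)) i v)
        + C * (size τ (Q n) (ρ n) ^ 2 / ((n : ℝ) + 1) ^ 2))
    (hE : ∀ n i v, Integrable (fun ω =>
      correctedError M i₀ Φ V a₀ n (Q n ω) (ρ n ω) (Y n ω) (X n ω) i v ^ 2) P)
    (hs : Integrable (fun ω => size τ (Q n ω) (ρ n ω) ^ 2) P) :
    ∫ ω, sumSq (correctedError M i₀ Φ V a₀ (n + 1) (Q (n + 1) ω) (ρ (n + 1) ω) (Y (n + 1) ω)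
        (X (n + 1) ω)) ∂P ≤
      (1 - a₀ * δ / ((n : ℝ) + 1)) *
        ∫ ω, sumSq (correctedError M i₀ Φ V a₀ n (Q n ω) (ρ n ω) (Y n ω) (X n ω)) ∂P +
      (Fintype.card S * Fintype.card A * C) *
        ((∫ ω, size τ (Q n ω) (ρ n ω) ^ 2 ∂P) / ((n : ℝ) + 1) ^ 2) := by
  have hsum : ∀ m, ∫ ω, sumSq (correctedError M i₀ Φ V a₀ m (Q m ω) (ρ m ω) (Y m ω) (X m ω)) ∂P =
      ∑ i, ∑ v, ∫ ω, correctedError M i₀ Φ V a₀ m (Q m ω) (ρ m ω) (Y m ω) (X m ω) i v ^ 2 ∂P := by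
    intro m
    unfold sumSq
    rw [integral_finsetSum _ fun i _ => integrable_finsetSum _ fun v _ => hE m i v]
    exact Finset.sum_congr rfl fun i _ => integral_finsetSum _ fun v _ => hE m i v
  have hstep : ∀ i v, ∫ ω, correctedError M i₀ Φ V a₀ (n + 1) (Q (n + 1) ω) (ρ (n + 1) ω)
      (Y (n + 1) ω) (X (n + 1) ω) i v ^ 2 ∂P ≤ (1 - a₀ * δ / ((n : ℝ) + 1)) *
        ∫ ω, correctedError M i₀ Φ V a₀ n (Q n ω) (ρ n ω) (Y n ω) (X n ω) i v ^ 2 ∂P +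
      C * ((∫ ω, size τ (Q n ω) (ρ n ω) ^ 2 ∂P) / ((n : ℝ) + 1) ^ 2) := by
    intro i v
    obtain ⟨hν, hν0⟩ := h.integral_correctedError_mul_noise hsol hΦsum (fun i v => (hD0 i v).le)
      hD1 V n i v
    have i1 := (hE n i v).const_mul (1 - a₀ / ((n : ℝ) + 1) * (Φ i v * d i))
    have i2 := hν.const_mul (2 * (a₀ / ((n : ℝ) + 1)) * (1 + a₀ / ((n : ℝ) + 1) * (Φ i v * d i)) *
          (1 - a₀ / ((n : ℝ) + 1) * (Φ i v * d i)))
    have i3 := (hs.div_const (((n : ℝ) + 1) ^ 2)).const_mul C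
    have h1 := integral_mono (hE (n + 1) i v) ((i1.add i2).add i3) fun ω => hC (h.path ω) i v
    rw [integral_add' (i1.add i2) i3, integral_add' i1 i2, integral_const_mul, integral_const_mul,
      integral_const_mul, integral_div, hν0, mul_zero, add_zero] at h1
    refine h1.trans (add_le_add (mul_le_mul_of_nonneg_right ?_ ?_) le_rfl)
    · have : a₀ * δ / ((n : ℝ) + 1) = a₀ / ((n : ℝ) + 1) * δ := by ring
      rw [this]
      linarith [mul_le_mul_of_nonneg_left (hδ i v) (by positivity : 0 ≤ a₀ / ((n : ℝ) + 1))]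
    · exact integral_nonneg fun ω => sq_nonneg _
  rw [hsum, hsum]
  refine (Finset.sum_le_sum fun i _ => Finset.sum_le_sum fun v _ => hstep i v).trans (le_of_eq ?_)
  simp only [Finset.sum_add_distrib, ← Finset.mul_sum, Finset.sum_const, Finset.card_univ,
    nsmul_eq_mul]
  ring

end

/-- The mean-square rate of convergence under explicit conditions on the step sizes. -/
theorem exists_meanSquare_rate (hsol : IsSolution M i₀ τ lam qs ρs)
    (hΦsum : ∀ i, ∑ u, Φ i u = 1)
    (hV : ∀ i x, (if x = i then 1 else 0) = d i + V i x - ∑ y, stateKernel M Φ x y * V i y)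
    (hD0 : ∀ i v, 0 < Φ i v * d i) (hD1 : ∀ i v, Φ i v * d i ≤ 1) {δ K L : ℝ}
    (hδ : ∀ i v, δ ≤ Φ i v * d i * (1 - lam)) (hL : L = 1 / (1 - lam)) (hK : 0 < K)
    (hKL : K * (τ i₀ * L ^ 2) ≤ 1 / 2) (ha₀ : 0 < a₀) (hb₀ : 4 ≤ b₀)
    (hab : b₀ * (K * (L * τ i₀) + τ i₀ + K / 2) ≤ K * (a₀ * δ)) (hab' : b₀ / 2 < a₀ * δ)
    (W : ℝ) :
    ∃ C, ∀ {Ω : Type*} {m0 _mΩ : MeasurableSpace Ω} {P : Measure Ω} [IsProbabilityMeasure P]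
      {X : ℕ → Ω → S} {U : ℕ → Ω → A} {Q Y : ℕ → Ω → S → A → ℝ} {ρ : ℕ → Ω → ℝ},
      IsProcess (m0 := m0) M i₀ τ Φ d a₀ b₀ P X U Q ρ Y →
      ∫ ω, size τ (Q 0 ω) (ρ 0 ω) ^ 2 ∂P ≤ W → ∀ n : ℕ,
        (Integrable (fun ω => tNorm τ (fun i v => Q n ω i v - qs ρs i v) ^ 2) P ∧
          ∫ ω, tNorm τ (fun i v => Q n ω i v - qs ρs i v) ^ 2 ∂P ≤ C / ((n : ℝ) + 1)) ∧
        (Integrable (fun ω => |ρ n ω - ρs| ^ 2) P ∧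
          ∫ ω, |ρ n ω - ρs| ^ 2 ∂P ≤ C / ((n : ℝ) + 1)) := by
  have hτ := hsol.one_le
  have hD0' : ∀ i v, 0 ≤ Φ i v * d i := fun i v => (hD0 i v).le
  have hδ' : ∀ i v, δ ≤ Φ i v * d i := fun i v =>
    (hδ i v).trans (mul_le_of_le_one_right (hD0' i v) (by linarith [hsol.nonneg]))
  obtain ⟨C₁, hC₁0, hC₁⟩ := exists_lyapunov_sq_le hsol hD0' hD1 hδ hL hK.le hKL ha₀
    (by linarith : 0 < b₀) hab
  obtain ⟨C₂, n₂, hC₂0, hC₂⟩ := exists_sq_bounds hsol Φ V a₀ hK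
  obtain ⟨C₃, hC₃0, hC₃⟩ := exists_correctedError_sq_le M i₀ hτ hV hD0 hD1 ha₀ b₀
  choose B hB0 hB using fun n => exists_initial_bounds hsol hD0' hD1 Φ V a₀ b₀ hK n
  obtain ⟨n₁, hn₁⟩ := exists_nat_ge (max a₀ (max (b₀ * (τ i₀ * L)) (b₀ / 2)))
  set N : ℝ := Fintype.card S * Fintype.card A with hN
  have hN0 : 0 ≤ N := by positivity
  set C := C₁ * C₂ + N * C₃ + C₂ with hC
  have hC0 : 0 ≤ C := by positivity
  -- The coefficients are `b = b₀ / 2` for the squared Lyapunov function and `g = a₀ * δ` for the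
  -- corrected error. The factor `1 + N` covers the single moments as well as the sum over the `N`
  -- components.
  obtain ⟨C', hC'⟩ := exists_rate (by linarith : 2 ≤ b₀ / 2) hab' hC0 (max n₁ n₂)
    fun n => (1 + N) * (B n ^ 2 * W)
  refine ⟨(1 + C₂) * C', fun {Ω m0 mΩ P _ X U Q Y ρ} h hW => ?_⟩
  have hmom := fun n => h.moments hsol hK.le (V := V) (B := B n) (hB n)
  have hHi := fun n => (hmom n).1.1
  have hsi := fun n => (hmom n).2.1.1
  have hEi := fun n i v => ((hmom n).2.2 i v).1
  have hei : ∀ n, Integrable (fun ω =>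
      sumSq (correctedError M i₀ Φ V a₀ n (Q n ω) (ρ n ω) (Y n ω) (X n ω))) P := fun n =>
    integrable_finsetSum _ fun i _ => integrable_finsetSum _ fun v _ => hEi n i v
  have hBW : ∀ n, B n ^ 2 * ∫ ω, size τ (Q 0 ω) (ρ 0 ω) ^ 2 ∂P ≤ B n ^ 2 * W := fun n =>
    mul_le_mul_of_nonneg_left hW (sq_nonneg _)
  have hW0 : 0 ≤ W := le_trans (integral_nonneg fun ω => sq_nonneg _) hW
  have hlarge : ∀ n ≥ max n₁ n₂, a₀ ≤ (n : ℝ) + 1 ∧ b₀ * (τ i₀ * L) ≤ (n : ℝ) + 1 ∧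
      b₀ / 2 ≤ (n : ℝ) + 1 := by
    intro n hn
    have h1 : (n₁ : ℝ) ≤ n := by exact_mod_cast (le_max_left _ _).trans hn
    have h2 := (le_max_left _ _).trans hn₁
    have h3 := (le_max_left _ _).trans ((le_max_right _ _).trans hn₁)
    have h4 := (le_max_right _ _).trans ((le_max_right _ _).trans hn₁)
    exact ⟨by linarith, by linarith, by linarith⟩
  have hrate := hC' (fun n => ∫ ω, lyapunov τ qs ρs K (Y n ω) (ρ n ω) ^ 2 ∂P)
    (fun n => ∫ ω, sumSq (correctedError M i₀ Φ V a₀ n (Q n ω) (ρ n ω) (Y n ω) (X n ω)) ∂P)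
    (fun n => ∫ ω, size τ (Q n ω) (ρ n ω) ^ 2 ∂P)
    (fun n => integral_nonneg fun ω => sq_nonneg _)
    (fun n => integral_nonneg fun ω => sumSq_nonneg _)
    (fun n => integral_nonneg fun ω => sq_nonneg _)
    (fun n => by
      have hB2 : 0 ≤ B n ^ 2 * W := by positivity
      have hNB : 0 ≤ N * (B n ^ 2 * W) := by positivity
      refine ⟨?_, ?_, ?_⟩
      · linarith [(hmom n).1.2, hBW n]
      · have h1 : ∫ ω, sumSq (correctedError M i₀ Φ V a₀ n (Q n ω) (ρ n ω) (Y n ω) (X n ω)) ∂P ≤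
            N * (B n ^ 2 * W) := by
          unfold sumSq
          rw [integral_finsetSum _ fun i _ => integrable_finsetSum _ fun v _ => hEi n i v]
          calc _ ≤ ∑ i : S, ∑ v : A, B n ^ 2 * W := by
                refine Finset.sum_le_sum fun i _ => ?_
                rw [integral_finsetSum _ fun v _ => hEi n i v]
                exact Finset.sum_le_sum fun v _ => (((hmom n).2.2 i v).2).trans (hBW n)
            _ = _ := by
                simp only [Finset.sum_const, Finset.card_univ, nsmul_eq_mul, hN]
                ring
        linarith
      · linarith [(hmom n).2.1.2, hBW n])
    (fun n hn => by
      obtain ⟨l1, l2, l3⟩ := hlarge n hn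
      have hpt : ∀ ω, lyapunov τ qs ρs K (Y (n + 1) ω) (ρ (n + 1) ω) ^ 2 ≤
          (1 - b₀ / 2 / ((n : ℝ) + 1)) * lyapunov τ qs ρs K (Y n ω) (ρ n ω) ^ 2 +
          C₁ * C₂ * ((sumSq (correctedError M i₀ Φ V a₀ n (Q n ω) (ρ n ω) (Y n ω) (X n ω)) +
            size τ (Q n ω) (ρ n ω) ^ 2 / ((n : ℝ) + 1) ^ 2) / ((n : ℝ) + 1)) := by
        intro ω
        refine (hC₁ (h.path ω) n l1 l2 l3).trans (add_le_add le_rfl ?_)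
        have h2 := (hC₂ n (Q n ω) (Y n ω) (ρ n ω) (X n ω)).1
        have h3 := div_le_div_of_nonneg_right h2 (by positivity : 0 ≤ (n : ℝ) + 1)
        refine (mul_le_mul_of_nonneg_left h3 hC₁0).trans (le_of_eq ?_)
        ring
      have i1 := (hHi n).const_mul (1 - b₀ / 2 / ((n : ℝ) + 1))
      have i2 := (hsi n).div_const (((n : ℝ) + 1) ^ 2)
      have i3 := (((hei n).add i2).div_const ((n : ℝ) + 1)).const_mul (C₁ * C₂)
      have h1 := integral_mono (hHi (n + 1)) (i1.add i3) hpt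
      rw [integral_add' i1 i3, integral_const_mul, integral_const_mul, integral_div] at h1
      simp only [Pi.add_apply] at h1
      rw [integral_add (hei n) i2, integral_div] at h1
      refine h1.trans (add_le_add le_rfl (mul_le_mul_of_nonneg_right ?_ ?_))
      · have : 0 ≤ N * C₃ := by positivity
        linarith
      · have e1 : 0 ≤ ∫ ω, sumSq (correctedError M i₀ Φ V a₀ n (Q n ω) (ρ n ω) (Y n ω)
            (X n ω)) ∂P := integral_nonneg fun ω => sumSq_nonneg _
        have e2 : 0 ≤ ∫ ω, size τ (Q n ω) (ρ n ω) ^ 2 ∂P := integral_nonneg fun ω => sq_nonneg _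
        positivity)
    (fun n hn => by
      obtain ⟨l1, -, -⟩ := hlarge n hn
      refine (h.integral_sumSq_succ_le hsol hΦsum hD0 hD1 ha₀ hδ' (fun hp => hC₃ hp n l1) hEi
        (hsi n)).trans (add_le_add le_rfl (mul_le_mul_of_nonneg_right ?_ ?_))
      · have : 0 ≤ C₁ * C₂ := by positivity
        linarith
      · have e2 : 0 ≤ ∫ ω, size τ (Q n ω) (ρ n ω) ^ 2 ∂P := integral_nonneg fun ω => sq_nonneg _
        positivity)
    (fun n hn => by
      have i1 := ((integrable_const (1 : ℝ)).add (hHi n)).add (hei n)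
      have h1 := integral_mono (hsi n) (i1.const_mul C₂) fun ω =>
        (hC₂ n (Q n ω) (Y n ω) (ρ n ω) (X n ω)).2.2 ((le_max_right _ _).trans hn)
      rw [integral_const_mul, integral_add' ((integrable_const (1 : ℝ)).add (hHi n)) (hei n),
        integral_add' (integrable_const (1 : ℝ)) (hHi n), integral_const] at h1
      simp only [probReal_univ, one_smul] at h1
      refine h1.trans (mul_le_mul_of_nonneg_right ?_ ?_)
      · have : 0 ≤ C₁ * C₂ + N * C₃ := by positivity
        linarith
      · have e1 : 0 ≤ ∫ ω, sumSq (correctedError M i₀ Φ V a₀ n (Q n ω) (ρ n ω) (Y n ω)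
            (X n ω)) ∂P := integral_nonneg fun ω => sumSq_nonneg _
        have e2 : 0 ≤ ∫ ω, lyapunov τ qs ρs K (Y n ω) (ρ n ω) ^ 2 ∂P :=
          integral_nonneg fun ω => sq_nonneg _
        positivity)
  intro n
  have hr := hrate n
  have e1 : 0 ≤ ∫ ω, sumSq (correctedError M i₀ Φ V a₀ n (Q n ω) (ρ n ω) (Y n ω)
    (X n ω)) ∂P := integral_nonneg fun ω => sumSq_nonneg _
  have e2 : 0 ≤ ∫ ω, lyapunov τ qs ρs K (Y n ω) (ρ n ω) ^ 2 ∂P :=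
    integral_nonneg fun ω => sq_nonneg _
  have e3 : 0 ≤ (∫ ω, size τ (Q n ω) (ρ n ω) ^ 2 ∂P) / ((n : ℝ) + 1) ^ 2 :=
    div_nonneg (integral_nonneg fun ω => sq_nonneg _) (by positivity)
  have e4 : 0 ≤ C' / ((n : ℝ) + 1) := le_trans (by positivity) hr
  have e5 : (1 + C₂) * C' / ((n : ℝ) + 1) = C' / ((n : ℝ) + 1) + C₂ * (C' / ((n : ℝ) + 1)) := by
    ring
  have e6 : 0 ≤ C₂ * (C' / ((n : ℝ) + 1)) := by positivity
  obtain ⟨hQ', hρ', -⟩ := h.measurable_preHistory n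
  have hQ := hQ'.mono (h.preHistory_le n) le_rfl
  have hρ := hρ'.mono (h.preHistory_le n) le_rfl
  rw [e5]
  constructor
  · have i2 := (hsi n).div_const (((n : ℝ) + 1) ^ 2)
    have i3 := ((hHi n).add (hei n)).add i2
    have hpt := fun ω => (hC₂ n (Q n ω) (Y n ω) (ρ n ω) (X n ω)).2.1
    have hm : Measurable fun ω => tNorm τ (fun i v => Q n ω i v - qs ρs i v) :=
      measurable_tNorm (measurable_pi_iff.2 fun i => measurable_pi_iff.2 fun v =>
        (measurable_apply_apply hQ i v).sub_const _)
    have hi : Integrable (fun ω => tNorm τ (fun i v => Q n ω i v - qs ρs i v) ^ 2) P := by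
      refine integrable_of_abs_le_mul i3 (hm.pow_const 2) (c := C₂) fun ω => ?_
      rw [abs_of_nonneg (sq_nonneg _)]
      exact hpt ω
    refine ⟨hi, ?_⟩
    have h1 := integral_mono hi (i3.const_mul C₂) hpt
    rw [integral_const_mul, integral_add' ((hHi n).add (hei n)) i2, integral_add' (hHi n) (hei n),
      integral_div] at h1
    have h2 := mul_le_mul_of_nonneg_left hr hC₂0
    linarith
  · obtain ⟨C₄, -, hC₄⟩ := exists_size_le hsol hK
    have hpt : ∀ ω, |ρ n ω - ρs| ^ 2 ≤ lyapunov τ qs ρs K (Y n ω) (ρ n ω) ^ 2 := fun ω =>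
      pow_le_pow_left₀ (abs_nonneg _) (hC₄ (Q n ω) (Y n ω) (ρ n ω)).2.2.1 2
    have hi : Integrable (fun ω => |ρ n ω - ρs| ^ 2) P := by
      refine integrable_of_abs_le_mul (hHi n) ((hρ.sub_const _).abs.pow_const 2) (c := 1)
        fun ω => ?_
      rw [abs_of_nonneg (by positivity), one_mul]
      exact hpt ω
    refine ⟨hi, ?_⟩
    have h1 := integral_mono hi (hHi n) hpt
    linarith

end MeanSquare

end SSPQ

/-! ### Choice of the constants and assembly. -/

theorem mainTheorem3 {S A : Type*} [Fintype S] [Fintype A] [Nonempty S] [Nonempty A]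
    [DecidableEq S] [DecidableEq A]
    [MeasurableSpace S] [MeasurableSingletonClass S]
    [MeasurableSpace A] [MeasurableSingletonClass A]
    (M : SSPQ.MDP S A) (hirr : M.IrreducibleUnderAllControls) (i₀ : S)
    (Φ : S → A → ℝ) (hΦpos : ∀ i u, 0 < Φ i u) (hΦsum : ∀ i, ∑ u, Φ i u = 1) :
    ∃ (Qs : S → A → ℝ) (ρs : ℝ),
      -- `(Q*, ρ*)` is the unique fixed point, and `ρ*` is the minimal average cost
      SSPQ.IsSSPFixedPoint M i₀ Qs ρs ∧
      (∀ Q' ρ', SSPQ.IsSSPFixedPoint M i₀ Q' ρ' → Q' = Qs ∧ ρ' = ρs) ∧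
      (∀ x, IsLeast (SSPQ.averageCosts M x) ρs) ∧
      -- the rate of convergence
      ∃ w : S → A → ℝ, (∀ i u, 0 < w i u) ∧
      ∀ β' : ℝ, 0 < β' →
      ∃ C₄ C₅ : ℝ, 0 < C₄ ∧ 0 < C₅ ∧
      ∀ α₀ β₀ : ℝ, 0 < α₀ → β₀ / α₀ ≤ C₄ → C₅ ≤ β₀ →
      ∀ R : ℝ, ∃ C : ℝ,
      ∀ (Ω : Type*) [MeasurableSpace Ω] (P : Measure Ω) [IsProbabilityMeasure P]
        (X : ℕ → Ω → S) (U : ℕ → Ω → A) (Q₀ : Ω → S → A → ℝ) (ρ₀ : Ω → ℝ),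
        Measurable Q₀ → Measurable ρ₀ →
        (∀ᵐ ω ∂P, ∀ i u, 0 ≤ Q₀ ω i u) →
        Integrable (fun ω => SSPQ.wNorm w (Q₀ ω) ^ 2) P →
        Integrable (fun ω => |ρ₀ ω| ^ 2) P →
        ∫ ω, SSPQ.wNorm w (Q₀ ω) ^ 2 ∂P + ∫ ω, |ρ₀ ω| ^ 2 ∂P ≤ R →
        SSPQ.IsControlledChain M P
          (MeasurableSpace.comap Q₀ inferInstance ⊔ MeasurableSpace.comap ρ₀ inferInstance) X U →
        SSPQ.IsSampledBy Φ P
          (MeasurableSpace.comap Q₀ inferInstance ⊔ MeasurableSpace.comap ρ₀ inferInstance) X U →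
        ∀ (Q : ℕ → Ω → S → A → ℝ) (ρ : ℕ → Ω → ℝ),
        (∀ n ω, (Q n ω, ρ n ω) =
          SSPQ.iterates M i₀ (fun m => α₀ / ((m : ℝ) + 1)) (fun m => β' * (β₀ / ((m : ℝ) + 1)))
            (fun m => X m ω) (fun m => U m ω) (Q₀ ω) (ρ₀ ω) n) →
        ∀ n : ℕ,
          (Integrable (fun ω => SSPQ.wNorm w (fun i u => Q n ω i u - Qs i u) ^ 2) P ∧
            ∫ ω, SSPQ.wNorm w (fun i u => Q n ω i u - Qs i u) ^ 2 ∂P ≤ C / ((n : ℝ) + 1)) ∧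
          (Integrable (fun ω => |ρ n ω - ρs| ^ 2) P ∧
            ∫ ω, |ρ n ω - ρs| ^ 2 ∂P ≤ C / ((n : ℝ) + 1)) := by
  obtain ⟨τ, lam, hw⟩ := SSPQ.exists_isContractingWeight M hirr i₀
  obtain ⟨qs, ρs, hsol⟩ := SSPQ.exists_isSolution hw
  obtain ⟨V, d, hd0, hd1, hV⟩ := SSPQ.exists_poisson_indicator hirr hΦpos hΦsum
  have hτpos : ∀ i, 0 < τ i := fun i => by linarith [hw.one_le i]
  have hΦ1 : ∀ i u, Φ i u ≤ 1 := fun i u => by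
    rw [← hΦsum i]
    exact Finset.single_le_sum (fun v _ => (hΦpos i v).le) (Finset.mem_univ u)
  have hD0 : ∀ i v, 0 < Φ i v * d i := fun i v => mul_pos (hΦpos i v) (hd0 i)
  have hD1 : ∀ i v, Φ i v * d i ≤ 1 := fun i v => mul_le_one₀ (hΦ1 i v) (hd0 i).le (hd1 i)
  refine ⟨qs ρs, ρs, hsol.isSSPFixedPoint, fun Q' ρ' h' => hsol.unique h',
    SSPQ.isLeast_averageCosts hsol.isSSPFixedPoint, fun i _ => (τ i)⁻¹,
    fun i _ => inv_pos.2 (hτpos i), fun β' hβ' => ?_⟩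
  have hlam : 0 < 1 - lam := by linarith [hw.lt_one]
  obtain ⟨⟨i₁, v₁⟩, hmin⟩ := Finite.exists_min fun z : S × A => Φ z.1 z.2 * d z.1
  set δ := Φ i₁ v₁ * d i₁ * (1 - lam) with hδ
  have hδ0 : 0 < δ := mul_pos (hD0 _ _) hlam
  have hδle : ∀ i v, δ ≤ Φ i v * d i * (1 - lam) := fun i v =>
    mul_le_mul_of_nonneg_right (hmin (i, v)) hlam.le
  set L := 1 / (1 - lam) with hL
  have hL0 : 0 < L := by positivity
  have hτ0 := hτpos i₀
  -- The largest `K` allowed by `hKL`.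
  set K := 1 / (2 * (τ i₀ * L ^ 2)) with hK
  have hK0 : 0 < K := by positivity
  have hKL : K * (τ i₀ * L ^ 2) ≤ 1 / 2 := by
    rw [hK]
    exact le_of_eq (by field_simp)
  -- `K * G` is the coefficient in the drift condition, so `β' * β₀ * G ≤ α₀ * δ` is that condition
  -- divided by `K`. Since `G > 1/2`, it also makes the corrected error contract faster than the
  -- Lyapunov function.
  set G := L * τ i₀ + τ i₀ / K + 1 / 2 with hG
  have hG0 : 0 < G := by positivity
  -- The value `4 / β'` makes the contraction coefficient `β' * β₀ / 2` at least `2`, as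
  -- `exists_rate` requires.
  refine ⟨δ / (β' * G), 4 / β', by positivity, by positivity, fun α₀ β₀ hα₀ hab hβ₀ R => ?_⟩
  have hb : 4 ≤ β' * β₀ := by
    rw [div_le_iff₀ hβ'] at hβ₀
    linarith
  have hbG : β' * β₀ * G ≤ α₀ * δ := by
    rw [div_le_div_iff₀ hα₀ (by positivity)] at hab
    linarith
  obtain ⟨C, hC⟩ := SSPQ.exists_meanSquare_rate (b₀ := β' * β₀) hsol hΦsum hV hD0 hD1 hδle hL hK0
    hKL hα₀ hb
    (by
      have h1 := mul_le_mul_of_nonneg_left hbG hK0.le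
      have h2 : K * (β' * β₀ * G) = β' * β₀ * (K * (L * τ i₀) + τ i₀ + K / 2) := by
        rw [hG]
        field_simp
      rwa [h2] at h1)
    (by
      have h1 : 0 < L * τ i₀ + τ i₀ / K := by positivity
      have h2 : 0 < β' * β₀ * (L * τ i₀ + τ i₀ / K) := mul_pos (by linarith) h1
      have h3 : β' * β₀ * G = β' * β₀ * (L * τ i₀ + τ i₀ / K) + β' * β₀ / 2 := by
        rw [hG]; ring
      linarith)
    -- From `(1 + x + y)² ≤ 3 * (1 + x² + y²)` applied to the initial size.
    (3 * (1 + R))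
  refine ⟨C, ?_⟩
  intro Ω mΩ P _ X U Q₀ ρ₀ hQ₀ hρ₀ _ hQi hρi hR hchain hsamp Q ρ hit n
  let Y : ℕ → Ω → S → A → ℝ := fun n => Nat.rec Q₀ (fun n y ω i v =>
    (1 - α₀ / ((n : ℝ) + 1) * (Φ i v * d i)) * y ω i v +
      α₀ / ((n : ℝ) + 1) * (Φ i v * d i) * SSPQ.bellman M i₀ (Q n ω) (ρ n ω) i v) n
  have hQ0 : Q 0 = Q₀ := funext fun ω => congrArg Prod.fst (hit 0 ω)
  have hρ0 : ρ 0 = ρ₀ := funext fun ω => congrArg Prod.snd (hit 0 ω)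
  have hsize : ∀ ω, SSPQ.size τ (Q₀ ω) (ρ₀ ω) ^ 2 ≤
      3 * (1 + SSPQ.tNorm τ (Q₀ ω) ^ 2 + |ρ₀ ω| ^ 2) := fun ω => by
    have := SSPQ.sq_add_three_le 1 (SSPQ.tNorm τ (Q₀ ω)) |ρ₀ ω|
    rwa [one_pow] at this
  have hsum : Integrable (fun ω => 1 + SSPQ.tNorm τ (Q₀ ω) ^ 2 + |ρ₀ ω| ^ 2) P :=
    ((integrable_const 1).add hQi).add hρi
  have hsi : Integrable (fun ω => SSPQ.size τ (Q₀ ω) (ρ₀ ω) ^ 2) P := by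
    refine SSPQ.integrable_of_abs_le_mul hsum ((SSPQ.measurable_size hQ₀ hρ₀).pow_const 2) (c := 3)
      fun ω => ?_
    rw [abs_of_nonneg (sq_nonneg _)]
    exact hsize ω
  have hproc : SSPQ.IsProcess
      (m0 := MeasurableSpace.comap Q₀ inferInstance ⊔ MeasurableSpace.comap ρ₀ inferInstance)
      M i₀ τ Φ d α₀ (β' * β₀) P X U Q ρ Y := by
    refine ⟨sup_le hQ₀.comap_le hρ₀.comap_le, hchain, hsamp, ?_, ?_, ?_, fun ω => ⟨?_, ?_, ?_, ?_⟩⟩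
    · rw [hQ0]
      exact (comap_measurable Q₀).mono le_sup_left le_rfl
    · rw [hρ0]
      exact (comap_measurable ρ₀).mono le_sup_right le_rfl
    · rw [hQ0, hρ0]
      exact hsi
    · intro n i v
      have h1 := congrArg Prod.fst (hit (n + 1) ω)
      simp only [SSPQ.iterates, ← hit n ω] at h1
      exact congrFun (congrFun h1 i) v
    · intro n
      have h1 := congrArg Prod.snd (hit (n + 1) ω)
      simp only [SSPQ.iterates, ← hit n ω] at h1
      rw [h1]
      ring
    · exact (congrFun hQ0 ω).symm
    · intro n i v
      rfl
  refine hC hproc ?_ n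
  rw [hQ0, hρ0]
  refine (integral_mono hsi (hsum.const_mul 3) hsize).trans ?_
  rw [integral_const_mul]
  refine mul_le_mul_of_nonneg_left ?_ (by norm_num)
  have h1 := integral_add' ((integrable_const (μ := P) (1 : ℝ)).add hQi) hρi
  rw [integral_add' (integrable_const (μ := P) (1 : ℝ)) hQi, integral_const] at h1
  simp only [probReal_univ, one_smul] at h1
  refine le_trans (le_of_eq h1) ?_
  linarith
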